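/- **Model.** In a distributed interactive proof (DIP) protocol a verifier runs at every node of a graph, each node knowing its local input, and a centralized prover that sees the whole instance interacts with all nodes. In a prover round the prover sends each node a label (a bitstring, which may depend on the instance and on all coins drawn so far). In a verifier round each node draws a uniformly random bitstring, independently of all other draws, and sends it to the prover (public coins). Prover and verifier rounds alternate, and the last round is a prover round. Afterwards each node outputs yes or no as a function of its local input, its own random strings, its own labels and the labels of its neighbors. The verifier accepts if all nodes output yes. The number of rounds counts prover and verifier rounds. The proof size is the maximum length in bits of a message exchanged between the honest prover and the verifier. **LR-sorting in planar graphs.** An instance on $n$ nodes is a pair $(G,H)$, where $G=(V,E)$ is a loopless directed graph with $|V|=n$ whose underlying undirected graph is planar, and $H$ is a directed Hamiltonian path of $G$. Each node knows, for each of its incident edges, whether the edge is incoming or outgoing and whether it belongs to $H$. The instance is a yes-instance if $u$ appears before $v$ on $H$ for every directed edge $(u,v)\in E\setminus H$, and a no-instance otherwise. Let $\log^* n$ be the least number of applications of the binary logarithm that bring $n$ down to at most $1$. **Theorem.** There is a DIP protocol for LR-sorting in planar graphs with $O(\log^* n)$ interaction rounds, proof size $O(1)$, perfect completeness and soundness error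 $1/8$. That is, there are a constant $C$ and, for every $n$, a DIP protocol $\Pi_n$ with at most $C\cdot\max\{1,\log^* n\}$ rounds such that for every instance $(G,H)$ of LR-sorting on $n$ nodes with $G$ planar: 1. if $(G,H)$ is a yes-instance, there is a prover strategy that makes the verifier accept with probability $1$ and for which every message exchanged, in either direction, always has at most $C$ bits; 2. if $(G,H)$ is a no-instance, then for every prover strategy (with messages of any length) the verifier accepts with probability at most $1/8$. -/

import Mathlib

noncomputable section

/-! ### The iterated logarithm -/

/-- `log* n`: the least number of applications of the binary logarithm that bring `n` down to
at most `1`. -/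
def logStar (n : ℕ) : ℕ := sInf {k : ℕ | (Real.logb 2)^[k] (n : ℝ) ≤ 1}

/-! ### Planar graphs -/

/-- A rotation system of a graph: a permutation of the darts (oriented edges) whose cycles are
exactly the sets of darts leaving a common vertex, that is, a cyclic (clockwise) order of the
edges around each vertex. -/
def IsRotation {V : Type} (G : SimpleGraph V) (σ : Equiv.Perm G.Dart) : Prop :=
  ∀ d e : G.Dart, σ.SameCycle d e ↔ d.fst = e.fst

/-- The face permutation: having traversed the dart `d`, continue with the dart that follows the
reversal of `d` in the clockwise order around the head of `d`. Its cycles are the boundary walks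
of the faces. -/
def facePerm {V : Type} (G : SimpleGraph V) (σ : Equiv.Perm G.Dart) : Equiv.Perm G.Dart :=
  (SimpleGraph.Dart.symm_involutive (G := G)).toPerm.trans σ

/-- The number of boundary walks: the cycles of the face permutation, together with one trivial
walk at each isolated vertex. -/
def numFaces {V : Type} (G : SimpleGraph V) (σ : Equiv.Perm G.Dart) : ℕ :=
  Nat.card (Quotient (Equiv.Perm.SameCycle.setoid (facePerm G σ))) +
    Nat.card {v : V // ∀ w, ¬ G.Adj v w}

/-- A finite graph is planar if it has a planar (genus `0`) combinatorial embedding: a rotation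
system for which `|V| - |E| + |F| = 2` on every connected component. Since
`|V| - |E| + |F| ≤ 2` holds for every rotation system of a connected graph, this may be stated as
one equation, summed over the components. -/
def IsPlanar {V : Type} (G : SimpleGraph V) : Prop :=
  ∃ σ : Equiv.Perm G.Dart, IsRotation G σ ∧
    Nat.card V + numFaces G σ = Nat.card G.edgeSet + 2 * Nat.card G.ConnectedComponent

/-! ### Distributed interactive proofs -/

/-- A communication network with local inputs. The local input of a node `v` is a mark
`mark v u` on each of its incident edges `vu`. -/
structure Network (V : Type) (M : Type) where
  graph : SimpleGraph V
  mark : V → V → M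

/-- What a node sees at the end of a protocol with `k` prover rounds: the random strings that it
drew, the labels that it received, and, for each incident edge, its own mark on that edge
together with the labels received by the neighbor at the other end. Nodes have no identifiers, and
the incident edges come in no particular order. -/
structure LocalView (k : ℕ) (coinLen : Fin k → ℕ) (M : Type) where
  coins : (i : Fin k) → Fin (coinLen i) → Bool
  labels : Fin k → List Bool
  nbrs : Multiset (M × (Fin k → List Bool))

/-- A distributed interactive proof protocol (the verifier's side). There are `proverRounds`
prover rounds. Immediately before prover round `i` every node draws `coinLen i` uniform random
bits and sends them to the prover (a verifier round). After the last prover round each node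
outputs yes (`true`) or no (`false`) as a function of its local view. -/
structure DIP (M : Type) where
  proverRounds : ℕ
  proverRounds_pos : 0 < proverRounds
  coinLen : Fin proverRounds → ℕ
  accept : LocalView proverRounds coinLen M → Bool

namespace DIP

variable {M : Type} (𝒟 : DIP M) {V : Type}

/-- The number of interaction rounds, counting prover rounds and verifier rounds; if nothing is
drawn before the first prover round, the interaction starts with the prover. -/
def rounds : ℕ :=
  if 𝒟.coinLen ⟨0, 𝒟.proverRounds_pos⟩ = 0 then 2 * 𝒟.proverRounds - 1 else 2 * 𝒟.proverRounds

/-- The outcomes of all coin tosses of all nodes. -/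
abbrev Coins (V : Type) : Type :=
  (i : Fin 𝒟.proverRounds) → V → Fin (𝒟.coinLen i) → Bool

/-- A prover strategy: the label that each node receives in each prover round, depending only on
the coins drawn so far (and, the strategy being chosen for one instance, arbitrarily on the whole
instance). Labels are arbitrary bitstrings. -/
structure Prover (V : Type) where
  msg : Fin 𝒟.proverRounds → 𝒟.Coins V → V → List Bool
  causal : ∀ (i : Fin 𝒟.proverRounds) (ω ω' : 𝒟.Coins V),
    (∀ j ≤ i, ω j = ω' j) → msg i ω = msg i ω'

variable {𝒟}

open Classical in
/-- The local view of the node `v` in the execution against the prover `P` with coins `ω`. -/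
def view [Fintype V] (N : Network V M) (P : 𝒟.Prover V) (ω : 𝒟.Coins V) (v : V) :
    LocalView 𝒟.proverRounds 𝒟.coinLen M where
  coins := fun i => ω i v
  labels := fun i => P.msg i ω v
  nbrs := (Finset.univ.filter fun u => N.graph.Adj v u).val.map
    fun u => (N.mark v u, fun i => P.msg i ω u)

/-- The verifier accepts if all nodes output yes. -/
def Accepts [Fintype V] (N : Network V M) (P : 𝒟.Prover V) (ω : 𝒟.Coins V) : Prop :=
  ∀ v, 𝒟.accept (view N P ω v) = true

/-- The probability, over independent uniform coins, that the verifier accepts. -/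
def acceptProb [Fintype V] (N : Network V M) (P : 𝒟.Prover V) : ℝ :=
  (Nat.card {ω : 𝒟.Coins V // Accepts N P ω} : ℝ) / (Nat.card (𝒟.Coins V) : ℝ)

/-- Every message exchanged in the execution of `𝒟` with the prover `P`, in either direction and
for all outcomes of the coins, has at most `s` bits. -/
def MessagesAtMost (P : 𝒟.Prover V) (s : ℕ) : Prop :=
  ∀ i, 𝒟.coinLen i ≤ s ∧ ∀ ω v, (P.msg i ω v).length ≤ s

end DIP

/-! ### LR-sorting -/

/-- An instance of LR-sorting on `n` nodes: a directed graph `G` (without loops) and a directed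
Hamiltonian path `H` of `G`, given by the position `pos v` of each node on the path. -/
structure LRInstance (V : Type) (n : ℕ) where
  G : Digraph V
  loopless : ∀ v, ¬ G.Adj v v
  pos : V ≃ Fin n
  path_adj : ∀ u v, (pos u : ℕ) + 1 = (pos v : ℕ) → G.Adj u v

/-- What a node `v` knows about an incident edge `vu`: whether it is an outgoing edge `(v, u)`,
whether it is an incoming edge `(u, v)`, and whether `(v, u)`, respectively `(u, v)`, is an edge of
the Hamiltonian path. -/
structure EdgeMark where
  outgoing : Bool
  incoming : Bool
  outgoingPath : Bool
  incomingPath : Bool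

namespace LRInstance

variable {V : Type} {n : ℕ} (I : LRInstance V n)

/-- `(u, v)` is an edge of the Hamiltonian path. -/
def PathEdge (u v : V) : Prop := (I.pos u : ℕ) + 1 = (I.pos v : ℕ)

/-- Yes-instances: `u` appears before `v` on the path for every directed edge `(u, v)` not on the
path. -/
def IsYes : Prop := ∀ u v, I.G.Adj u v → ¬ I.PathEdge u v → I.pos u < I.pos v

/-- The underlying undirected graph. -/
def graph : SimpleGraph V := I.G.toSimpleGraphInclusive

open Classical in
/-- The communication network of the instance, with the local inputs of the nodes. -/
def network : Network V EdgeMark where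
  graph := I.graph
  mark := fun v u =>
    { outgoing := decide (I.G.Adj v u)
      incoming := decide (I.G.Adj u v)
      outgoingPath := decide (I.PathEdge v u)
      incomingPath := decide (I.PathEdge u v) }

end LRInstance

end

/-! The path is read as a sequence of groups of one or two nodes, and above it stands a tower of
base-`3` counters. At level `0` every group carries a whole row of nine cells. In general `3 ^ width
i` consecutive rows of level `i` make up one row of level `i + 1`, which is spread over them, one
symbol per row and 27 symbols per cell, so that a node holds boundedly many bits per level. Since `2
^ width i ≤ width (i + 1)`, the number of levels is bounded by the iterated logarithm
(`topLevel_le_logStar`).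

Checking the counters. Neighboring cells of a row can be compared along the path, but the transition
from a row of level `i + 1` to the next one relates cells that are far apart. It is checked by level
`i`: each of its rows absorbs one symbol of the parent row, and together they run a Horner scheme
that evaluates the content of the parent row, a polynomial over the extension of degree `width i` of
`Fq`, at a random point (`RowRun.rowVal_absorb_top`). The hash of the prescribed next content is
carried through the following parent row and compared with the hash of its actual content. The
recursion ends at level `0`, where neighbors compare complete rows. The labels of level `i + 1` are
sent before the coins of level `i` are drawn, so a collision is unlikely for every prover
(`card_level_event_le`). Without collisions an induction on the level shows that all rows are
aligned and all counters correct (`PathOK.levels`).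

Checking an edge. For two different groups there is a level `k` at which they lie in different rows
with a common parent row (`exists_level_ne`), and their order is that of the counters of level `k`.
One of the two rows stores the counter of the other in a slot and compares it with its own counter
digit by digit along the row. At the edge it remains to see that the slot belongs to the other end;
for this the names of rows are compared, which consist of a color and, above level `0`, a random
linear form of a hash of the counter (`PathOK.lt_of_edgeOK`).

Planarity makes four slots suffice. Walking around the path in a planar embedding lists the darts in
a linear order in which the other edges are noncrossing chords (`SimpleGraph.exists_contour`). After
contracting rows to points of the contour, every chord is the farthest one to the right at its left
end or the farthest one to the left at its right end, for otherwise two chords would cross. A row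
meets the contour in at most two points, so it is responsible for at most four others
(`SimpleGraph.exists_block_orientation`). A relation of out-degree four also has a proper
`9`-coloring; the colors let honest labels exhibit the level `k` with certainty, which gives perfect
completeness.

The error. In a no-instance fix one backward edge. It is accepted only if a transition goes
undetected, which has probability at most `1 / 256` over all levels, or if one of ten comparisons of
fingerprints at a single level fails, each with probability at most `1 / 128 + 1 / 512`. The sum is
`13 / 128`. -/

/-! ### Planar graphs with a Hamiltonian path -/

section PlanarPaths

open Equiv

/-! ### Transpositions and the number of cycles -/

section CycleCount

variable {α : Type*}

theorem Equiv.Perm.SameCycle.mem_of_invariant [Finite α] {f : Perm α} {A : Set α}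
    (hA : ∀ x ∈ A, f x ∈ A) {x y : α} (h : f.SameCycle x y) (hx : x ∈ A) : y ∈ A := by
  obtain ⟨i, rfl⟩ := h.exists_nat_pow_eq
  clear h
  induction i with
  | zero => simpa
  | succ k ih => rw [pow_succ']; exact hA _ ih

/-- The number of cycles of a permutation, fixed points included. -/
noncomputable def cycleCount (f : Perm α) : ℕ :=
  Nat.card (Quotient (Perm.SameCycle.setoid f))

variable [DecidableEq α]

/-- The product sends `b` to `f a` and then follows the `f`-cycle of `a`, which avoids `b`, all the
way round to `a`. -/
theorem Equiv.Perm.sameCycle_mul_swap [Finite α] {f : Perm α} {a b : α}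
    (h : ¬ f.SameCycle a b) : (f * swap a b).SameCycle a b := by
  have key : ∀ i : ℕ, (f * swap a b).SameCycle b ((f ^ (i + 1)) a) := by
    intro i
    induction i with
    | zero =>
      have : (f * swap a b) b = f a := by simp
      rw [zero_add, pow_one, ← this]
      exact (Perm.sameCycle_apply_right).2 (Perm.SameCycle.refl _ _)
    | succ k ih =>
      have hb : (f ^ (k + 1)) a ≠ b := fun e => h ⟨(k + 1 : ℕ), by rw [zpow_natCast, e]⟩
      by_cases ha : (f ^ (k + 1)) a = a
      · rw [pow_succ', Perm.mul_apply, ha]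
        have : (f * swap a b) b = f a := by simp
        rw [← this]
        exact (Perm.sameCycle_apply_right).2 (Perm.SameCycle.refl _ _)
      · have : (f * swap a b) ((f ^ (k + 1)) a) = (f ^ (k + 1 + 1)) a := by
          rw [Perm.mul_apply, swap_apply_of_ne_of_ne ha hb, pow_succ' f (k + 1), Perm.mul_apply]
        rw [← this]
        exact (Perm.sameCycle_apply_right).2 ih
  have := key (orderOf f - 1)
  rw [Nat.sub_add_cancel (orderOf_pos f), pow_orderOf_eq_one] at this
  exact this.symm

theorem Equiv.Perm.SameCycle.mul_swap [Finite α] {f : Perm α} {a b : α}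
    (h : (f * swap a b).SameCycle a b) {x y : α} (hxy : f.SameCycle x y) :
    (f * swap a b).SameCycle x y := by
  refine hxy.mem_of_invariant (A := {y | (f * swap a b).SameCycle x y}) ?_ (Perm.SameCycle.refl _ _)
  intro z hz
  have : f z = (f * swap a b) (swap a b z) := by simp
  simp only [Set.mem_ofPred_eq] at hz ⊢
  rw [this]
  refine (Perm.sameCycle_apply_right).2 ?_
  rcases eq_or_ne z a with rfl | ha
  · rw [swap_apply_left]; exact hz.trans h
  rcases eq_or_ne z b with rfl | hb
  · rw [swap_apply_right]; exact hz.trans h.symm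
  · rwa [swap_apply_of_ne_of_ne ha hb]

/-- Two cycles merge: the identity induces a surjection from the old cycles onto the new ones, and
it identifies those of `a` and `b`. -/
theorem cycleCount_mul_swap_lt [Finite α] {f : Perm α} {a b : α} (h : ¬ f.SameCycle a b) :
    cycleCount (f * swap a b) + 1 ≤ cycleCount f := by
  have hs := Perm.sameCycle_mul_swap h
  let g : Quotient (Perm.SameCycle.setoid f) → Quotient (Perm.SameCycle.setoid (f * swap a b)) :=
    Quotient.map' id fun x y hxy => hs.mul_swap hxy
  have hg : Function.Surjective g := by
    intro y
    induction y using Quotient.inductionOn with | _ x => exact ⟨Quotient.mk _ x, rfl⟩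
  have hg' : ¬ Function.Injective g := by
    intro hi
    have : (Quotient.mk (Perm.SameCycle.setoid f) a) = Quotient.mk _ b :=
      hi (Quotient.sound (s := Perm.SameCycle.setoid (f * swap a b)) hs)
    exact h (Quotient.exact this)
  have hle := Nat.card_le_card_of_surjective g hg
  rcases Nat.lt_or_ge (cycleCount (f * swap a b)) (cycleCount f) with h1 | h1
  · exact h1
  · have hb := (Nat.bijective_iff_surjective_and_card g).2 ⟨hg, le_antisymm h1 hle⟩
    exact absurd hb.1 hg'

/-- A cycle of the product that avoids `a` and `b` is also a cycle of `f`. Hence it is injective to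
send the cycle of `b` to `none` and every other one to the `f`-cycle of a representative. -/
theorem cycleCount_mul_swap_le [Finite α] (f : Perm α) (a b : α) :
    cycleCount (f * swap a b) ≤ cycleCount f + 1 := by
  classical
  let X := Quotient (Perm.SameCycle.setoid (f * swap a b))
  let Y := Quotient (Perm.SameCycle.setoid f)
  let g : X → Option Y := fun x =>
    if (f * swap a b).SameCycle b x.out then none else some (Quotient.mk _ x.out)
  have aux : ∀ x y : α, f.SameCycle x y → ¬ (f * swap a b).SameCycle a x →
      ¬ (f * swap a b).SameCycle b x → (f * swap a b).SameCycle x y := by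
    intro x y hxy ha hb
    refine hxy.mem_of_invariant (A := {y | (f * swap a b).SameCycle x y}) ?_
      (Perm.SameCycle.refl _ _)
    intro z hz
    simp only [Set.mem_ofPred_eq] at hz ⊢
    have : f z = (f * swap a b) z := by
      rw [Perm.mul_apply, swap_apply_of_ne_of_ne]
      · rintro rfl; exact ha hz.symm
      · rintro rfl; exact hb hz.symm
    rw [this]
    exact (Perm.sameCycle_apply_right).2 hz
  have hout : ∀ x y : X, (f * swap a b).SameCycle x.out y.out → x = y := by
    intro x y h
    rw [← Quotient.out_eq x, ← Quotient.out_eq y]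
    exact Quotient.sound h
  have hg : Function.Injective g := by
    intro x y hxy
    by_cases hx : (f * swap a b).SameCycle b x.out
    · by_cases hy : (f * swap a b).SameCycle b y.out
      · exact hout _ _ (hx.symm.trans hy)
      · simp [g, hx, hy] at hxy
    · by_cases hy : (f * swap a b).SameCycle b y.out
      · simp [g, hx, hy] at hxy
      · simp only [g, hx, hy, if_false, Option.some.injEq] at hxy
        have h : f.SameCycle x.out y.out := Quotient.exact hxy
        apply hout
        by_cases hx' : (f * swap a b).SameCycle a x.out
        · by_cases hy' : (f * swap a b).SameCycle a y.out
          · exact hx'.symm.trans hy'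
          · exact (aux _ _ h.symm hy' hy).symm
        · exact aux _ _ h hx' hx
  calc cycleCount (f * swap a b) = Nat.card X := rfl
    _ ≤ Nat.card (Option Y) := Nat.card_le_card_of_injective g hg
    _ = cycleCount f + 1 := Finite.card_option

end CycleCount

/-! ### Reversing the darts of a set of edges -/

namespace SimpleGraph

variable {V : Type*} {G : SimpleGraph V}

instance finite_dart [Finite V] : Finite G.Dart :=
  Finite.of_injective (fun d : G.Dart => d.toProd) fun _ _ h => Dart.ext _ _ h

open Classical in
/-- The permutation of the darts that reverses the darts of the edges in `S`. -/
noncomputable def flipDarts (G : SimpleGraph V) (S : Set (Sym2 V)) : Perm G.Dart :=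
  Function.Involutive.toPerm (fun d : G.Dart => if d.edge ∈ S then d.symm else d) fun d => by
    by_cases h : d.edge ∈ S <;> simp [h]

theorem flipDarts_of_mem {S : Set (Sym2 V)} {d : G.Dart} (h : d.edge ∈ S) :
    G.flipDarts S d = d.symm :=
  if_pos h

theorem flipDarts_of_notMem {S : Set (Sym2 V)} {d : G.Dart} (h : d.edge ∉ S) :
    G.flipDarts S d = d :=
  if_neg h

theorem flipDarts_empty : G.flipDarts ∅ = 1 := by
  ext1 d; exact flipDarts_of_notMem (by simp)

theorem flipDarts_union {S T : Set (Sym2 V)} (h : Disjoint S T) :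
    G.flipDarts (S ∪ T) = G.flipDarts S * G.flipDarts T := by
  ext1 d
  rw [Perm.mul_apply]
  by_cases hT : d.edge ∈ T
  · have hS : d.edge ∉ S := fun h' => Set.disjoint_left.1 h h' hT
    rw [flipDarts_of_mem (Or.inr hT), flipDarts_of_mem hT, flipDarts_of_notMem (by simpa)]
  · rw [flipDarts_of_notMem hT]
    by_cases hS : d.edge ∈ S
    · rw [flipDarts_of_mem (Or.inl hS), flipDarts_of_mem hS]
    · rw [flipDarts_of_notMem (by simp [hS, hT]), flipDarts_of_notMem hS]

variable [DecidableEq G.Dart]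

theorem flipDarts_singleton (d : G.Dart) : G.flipDarts {d.edge} = swap d d.symm := by
  ext1 x
  by_cases h : x.edge = d.edge
  · rw [flipDarts_of_mem (by simpa)]
    rcases (dart_edge_eq_iff _ _).1 h with rfl | rfl <;> simp
  · rw [flipDarts_of_notMem (by simpa), swap_apply_of_ne_of_ne]
    · rintro rfl; exact h rfl
    · rintro rfl; exact h (by simp)

/-- Reversing one edge is a transposition of darts, or the identity if the pair is no edge. -/
theorem cycleCount_mul_flipDarts_le [Finite V] (f : Perm G.Dart) (T : Finset (Sym2 V)) :
    cycleCount (f * G.flipDarts T) ≤ cycleCount f + T.card := by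
  classical
  induction T using Finset.induction_on generalizing f with
  | empty => simp [flipDarts_empty]
  | insert e T he ih =>
    rw [Finset.coe_insert, Set.insert_eq,
      flipDarts_union (by simpa using he), ← mul_assoc, Finset.card_insert_of_notMem he]
    have h1 : cycleCount (f * G.flipDarts {e}) ≤ cycleCount f + 1 := by
      by_cases h : ∃ d : G.Dart, d.edge = e
      · obtain ⟨d, rfl⟩ := h
        rw [flipDarts_singleton]
        exact cycleCount_mul_swap_le _ _ _
      · have : G.flipDarts {e} = 1 := by
          ext1 d
          exact flipDarts_of_notMem fun h' => h ⟨d, h'⟩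
        rw [this, mul_one]; omega
    have := ih (f * G.flipDarts {e})
    omega

end SimpleGraph

/-- The single cycle is cut behind `w`: `t x` is the number of steps from `c w` to `x`. -/
theorem Equiv.Perm.exists_cycle_index {α : Type*} [Finite α] {c : Perm α}
    (hc : ∀ x y, c.SameCycle x y) (w : α) :
    ∃ t : α → ℕ, Function.Injective t ∧ (∀ x, x ≠ w → t (c x) = t x + 1) ∧ (∀ x, t x ≤ t w) ∧
      t (c w) = 0 := by
  classical
  have hex : ∀ x, ∃ k : ℕ, (c ^ k) (c w) = x := fun x => (hc (c w) x).exists_nat_pow_eq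
  let t : α → ℕ := fun x => Nat.find (hex x)
  have ht : ∀ x, (c ^ t x) (c w) = x := fun x => Nat.find_spec (hex x)
  have hmin : ∀ x k, (c ^ k) (c w) = x → t x ≤ k := fun x k h => Nat.find_min' (hex x) h
  have hinj : Function.Injective t := fun x y h => by rw [← ht x, ← ht y, h]
  have hle : ∀ x, t x ≤ t w := by
    intro x
    by_contra hlt
    push Not at hlt
    have hper : (c ^ (t w + 1)) (c w) = c w := by rw [pow_succ', Perm.mul_apply, ht]
    have : (c ^ (t x - (t w + 1))) (c w) = x := by
      conv_rhs => rw [← ht x, show t x = (t x - (t w + 1)) + (t w + 1) by omega, pow_add,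
        Perm.mul_apply, hper]
    have := hmin _ _ this
    omega
  have h0 : t (c w) = 0 := Nat.le_zero.1 (hmin _ 0 (by simp))
  refine ⟨t, hinj, ?_, hle, h0⟩
  intro x hx
  apply le_antisymm
  · apply hmin
    rw [pow_succ', Perm.mul_apply, ht]
  · have hne : t (c x) ≠ 0 := fun h => hx (c.injective (hinj (h.trans h0.symm)))
    have : (c ^ (t (c x) - 1)) (c w) = x := by
      apply c.injective
      rw [← Perm.mul_apply, ← pow_succ', Nat.sub_add_cancel (by omega), ht]
    have := hmin _ _ this
    omega

/-! ### The contour of the Hamiltonian path -/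

namespace SimpleGraph

variable {V : Type} {G : SimpleGraph V} {n : ℕ}

/-- The edges of the Hamiltonian path whose left end has position less than `k`. -/
def pathEdgesBelow (pos : V ≃ Fin n) (k : ℕ) : Set (Sym2 V) :=
  {e | ∃ u v, e = s(u, v) ∧ (pos u : ℕ) + 1 = pos v ∧ (pos u : ℕ) < k}

theorem mem_pathEdgesBelow {pos : V ≃ Fin n} {k : ℕ} {u v : V} :
    s(u, v) ∈ pathEdgesBelow pos k ↔
      ((pos u : ℕ) + 1 = pos v ∧ (pos u : ℕ) < k) ∨ ((pos v : ℕ) + 1 = pos u ∧ (pos v : ℕ) < k) := by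
  constructor
  · rintro ⟨a, b, h, h1, h2⟩
    rcases Sym2.eq_iff.1 h with ⟨rfl, rfl⟩ | ⟨rfl, rfl⟩
    · exact Or.inl ⟨h1, h2⟩
    · exact Or.inr ⟨h1, h2⟩
  · rintro (⟨h1, h2⟩ | ⟨h1, h2⟩)
    · exact ⟨u, v, rfl, h1, h2⟩
    · exact ⟨v, u, Sym2.eq_swap, h1, h2⟩

theorem pathEdgesBelow_succ (pos : V ≃ Fin n) {k : ℕ} (hk : k + 1 < n) :
    pathEdgesBelow pos (k + 1) = pathEdgesBelow pos k ∪
      {s(pos.symm ⟨k, by omega⟩, pos.symm ⟨k + 1, hk⟩)} := by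
  ext e
  induction e with | _ u v
  rw [Set.mem_union, mem_pathEdgesBelow, mem_pathEdgesBelow, Set.mem_singleton_iff, Sym2.eq_iff]
  simp only [Equiv.eq_symm_apply, Fin.ext_iff]
  omega

theorem disjoint_pathEdgesBelow (pos : V ≃ Fin n) {k : ℕ} (hk : k + 1 < n) :
    Disjoint (pathEdgesBelow pos k) {s(pos.symm ⟨k, by omega⟩, pos.symm ⟨k + 1, hk⟩)} := by
  rw [Set.disjoint_singleton_right, mem_pathEdgesBelow]
  simp

theorem le_ncard_pathEdgesBelow [Finite V] (pos : V ≃ Fin n) {k : ℕ} (hk : k < n) :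
    k ≤ (pathEdgesBelow pos k).ncard := by
  induction k with
  | zero => simp
  | succ k ih =>
    rw [pathEdgesBelow_succ pos hk, Set.ncard_union_eq (disjoint_pathEdgesBelow pos hk)
      (Set.toFinite _) (Set.toFinite _), Set.ncard_singleton]
    have := ih (by omega)
    omega

theorem preconnected_of_path {pos : V ≃ Fin n}
    (hpath : ∀ u v, (pos u : ℕ) + 1 = pos v → G.Adj u v) : G.Preconnected := by
  have key : ∀ k (hk : k < n) (h0 : 0 < n),
      G.Reachable (pos.symm ⟨0, h0⟩) (pos.symm ⟨k, hk⟩) := by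
    intro k
    induction k with
    | zero => intro _ _; exact Reachable.refl _
    | succ k ih =>
      intro hk h0
      exact (ih (by omega) h0).trans (hpath _ _ (by simp)).reachable
  intro u v
  have h0 : 0 < n := (pos u).pos
  have hu := key (pos u) (pos u).2 h0
  have hv := key (pos v) (pos v).2 h0
  simp only [Fin.eta, Equiv.symm_apply_apply] at hu hv
  exact hu.symm.trans hv

variable {σ : Perm G.Dart}

theorem _root_.IsRotation.fst_apply (hσ : IsRotation G σ) (d : G.Dart) : (σ d).fst = d.fst :=
  (hσ _ _).1 (Perm.sameCycle_apply_left.2 (Perm.SameCycle.refl _ _))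

theorem cycleCount_rotation_le [Finite V] (hσ : IsRotation G σ) (pos : V ≃ Fin n) :
    cycleCount σ ≤ n := by
  let g : Quotient (Perm.SameCycle.setoid σ) → V :=
    Quotient.lift (fun d => d.fst) fun a b h => (hσ a b).1 h
  have hg : Function.Injective g := by
    intro x y
    induction x using Quotient.inductionOn
    induction y using Quotient.inductionOn
    exact fun h => Quotient.sound ((hσ _ _).2 h)
  calc cycleCount σ ≤ Nat.card V := Nat.card_le_card_of_injective g hg
    _ = n := by rw [Nat.card_congr pos, Nat.card_fin]

open Classical in
/-- The contour permutation moves the tail of a dart only along path edges. -/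
theorem fst_rotation_flipDarts (hσ : IsRotation G σ) {pos : V ≃ Fin n} (j : ℕ) (d : G.Dart) :
    ((σ * G.flipDarts (pathEdgesBelow pos j)) d).fst =
      if s(d.fst, d.snd) ∈ pathEdgesBelow pos j then d.snd else d.fst := by
  rw [Perm.mul_apply, hσ.fst_apply]
  by_cases h : d.edge ∈ pathEdgesBelow pos j
  · rw [flipDarts_of_mem h]
    exact (if_pos h).symm
  · rw [flipDarts_of_notMem h]
    exact (if_neg h).symm

/-- Every further path edge merges two cycles: its first dart lies on a cycle that keeps to the
tails at positions at most `k`, while its reversal starts at position `k + 1`. For `k = n - 1` at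
most one cycle is left, the walk around the path. -/
theorem cycleCount_contour_le [Finite V] (hσ : IsRotation G σ) {pos : V ≃ Fin n}
    (hpath : ∀ u v, (pos u : ℕ) + 1 = pos v → G.Adj u v) {k : ℕ} (hk : k < n) :
    cycleCount (σ * G.flipDarts (pathEdgesBelow pos k)) + k ≤ n := by
  classical
  induction k with
  | zero =>
    have : pathEdgesBelow pos 0 = ∅ := by ext e; simp [pathEdgesBelow]
    rw [this, flipDarts_empty, mul_one]
    exact cycleCount_rotation_le hσ pos
  | succ k ih =>
    have ih := ih (by omega)
    let u : G.Dart := ⟨(pos.symm ⟨k, by omega⟩, pos.symm ⟨k + 1, hk⟩), hpath _ _ (by simp)⟩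
    have hu : s(pos.symm ⟨k, by omega⟩, pos.symm ⟨k + 1, hk⟩) = u.edge := rfl
    rw [pathEdgesBelow_succ pos hk, flipDarts_union (disjoint_pathEdgesBelow pos hk), ← mul_assoc,
      hu, flipDarts_singleton]
    have hns : ¬ (σ * G.flipDarts (pathEdgesBelow pos k)).SameCycle u u.symm := by
      intro h
      have := h.mem_of_invariant (A := {d | (pos d.fst : ℕ) ≤ k}) ?_ ?_
      · simp [u, Dart.symm] at this
      · intro d hd
        simp only [Set.mem_ofPred_eq] at hd ⊢
        rw [fst_rotation_flipDarts hσ]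
        split_ifs with h
        · rw [mem_pathEdgesBelow] at h
          omega
        · exact hd
      · simp [u]
    have := cycleCount_mul_swap_lt hns
    omega

/-- In a planar graph the number of boundary walks of a genus-`0` rotation system is determined by
the number of edges off the Hamiltonian path. -/
theorem cycleCount_facePerm [Finite V] {pos : V ≃ Fin n} (hn : 2 ≤ n)
    (hpath : ∀ u v, (pos u : ℕ) + 1 = pos v → G.Adj u v)
    (h : Nat.card V + numFaces G σ = Nat.card G.edgeSet + 2 * Nat.card G.ConnectedComponent) :
    (G.edgeSet \ pathEdgesBelow pos (n - 1)).ncard + 1 ≤ cycleCount (facePerm G σ) := by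
  have hV : Nat.card V = n := by rw [Nat.card_congr pos, Nat.card_fin]
  have hcc : Nat.card G.ConnectedComponent = 1 := by
    have := (preconnected_of_path hpath).subsingleton_connectedComponent
    exact Nat.card_eq_one_iff_unique.2
      ⟨this, ⟨G.connectedComponentMk (pos.symm ⟨0, by omega⟩)⟩⟩
  have hiso : Nat.card {v : V // ∀ w, ¬ G.Adj v w} = 0 := by
    rw [Nat.card_eq_zero]
    left
    refine ⟨fun ⟨v, hv⟩ => ?_⟩
    have hlt := (pos v).2
    rcases Nat.lt_or_ge ((pos v : ℕ) + 1) n with h1 | h1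
    · exact hv (pos.symm ⟨pos v + 1, h1⟩) (hpath _ _ (by simp))
    · exact hv (pos.symm ⟨pos v - 1, by omega⟩) (hpath _ _ (by simp; omega)).symm
  have hsub : pathEdgesBelow pos (n - 1) ⊆ G.edgeSet := by
    rintro _ ⟨u, v, rfl, huv, -⟩
    exact hpath _ _ huv
  -- The graph is connected without isolated vertices, so Euler's formula reads `n + F = E + 2`, and
  -- at least `n - 1` of the edges lie on the path.
  have hE : Nat.card G.edgeSet = G.edgeSet.ncard := rfl
  have hd := Set.ncard_sdiff_add_ncard_of_subset hsub (Set.toFinite _)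
  have hp := le_ncard_pathEdgesBelow pos (k := n - 1) (by omega)
  have hF : numFaces G σ = cycleCount (facePerm G σ) + Nat.card {v : V // ∀ w, ¬ G.Adj v w} := rfl
  omega

end SimpleGraph

/-! ### Noncrossing chords -/

namespace SimpleGraph

variable {V : Type} {G : SimpleGraph V} {n : ℕ} {σ : Perm G.Dart}

/-- The face permutation reverses every edge before rotating; with `S` the path edges, it arises
from the contour by reversing the remaining edges. -/
theorem facePerm_eq (S : Set (Sym2 V)) :
    facePerm G σ = σ * G.flipDarts S * G.flipDarts (G.edgeSet \ S) := by
  rw [mul_assoc, ← flipDarts_union Set.disjoint_sdiff_right]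
  ext1 d
  rw [Perm.mul_apply, flipDarts_of_mem (by simp [d.edge_mem])]
  rfl

/-- A finite set of chords of a cycle whose reversal maximizes the number of cycles is
noncrossing. -/
theorem noncrossing_of_cycleCount [Finite V] {c : Perm G.Dart} {w : G.Dart} {t : G.Dart → ℕ}
    (hc : cycleCount c ≤ 1) (ht : Function.Injective t) (hs : ∀ x, x ≠ w → t (c x) = t x + 1)
    (hw : ∀ x, t x ≤ t w) {S : Set (Sym2 V)}
    (hS : S.ncard + 1 ≤ cycleCount (c * G.flipDarts S)) {a b : G.Dart} (ha : a.edge ∈ S)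
    (hb : b.edge ∈ S) (h1 : t a < t b) (h2 : t b < t a.symm) (h3 : t a.symm < t b.symm) :
    False := by
  classical
  have hfin : S.Finite := Set.toFinite S
  have hab : a.edge ≠ b.edge := by
    intro h
    rcases (dart_edge_eq_iff _ _).1 h with rfl | rfl
    · exact lt_irrefl _ h1
    · simp at h3
      omega
  -- Once `a` is reversed, the darts behind `a` up to `a.symm` form an invariant set. It contains
  -- `b` but not `b.symm`, so reversing `b` merges two cycles and undoes the gain from reversing
  -- `a`.
  have hns : ¬ (c * swap a a.symm).SameCycle b b.symm := by
    intro h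
    have := h.mem_of_invariant (A := {d | t a < t d ∧ t d ≤ t a.symm}) ?_ ⟨h1, h2.le⟩
    · exact absurd this.2 (by omega)
    · rintro d ⟨hd1, hd2⟩
      have hdw : d ≠ w := by rintro rfl; have := hw b.symm; omega
      rcases eq_or_ne d a.symm with rfl | hda
      · have haw : a ≠ w := by rintro rfl; have := hw b; omega
        rw [Perm.mul_apply, swap_apply_right]
        exact ⟨by rw [hs _ haw]; omega, by rw [hs _ haw]; omega⟩
      · have hda' : d ≠ a := by rintro rfl; exact lt_irrefl _ hd1
        rw [Perm.mul_apply, swap_apply_of_ne_of_ne hda' hda]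
        have : t d ≠ t a.symm := fun h => hda (ht h)
        exact ⟨by rw [hs _ hdw]; omega, by rw [hs _ hdw]; omega⟩
  have e1 := cycleCount_mul_swap_lt hns
  have e2 := cycleCount_mul_swap_le c a a.symm
  let T : Finset (Sym2 V) := (hfin.toFinset.erase a.edge).erase b.edge
  have hST : S = {a.edge} ∪ ({b.edge} ∪ (T : Set (Sym2 V))) := by
    ext e
    simp only [T, Finset.coe_erase, Set.Finite.coe_toFinset, Set.mem_union, Set.mem_singleton_iff,
      Set.mem_sdiff]
    constructor
    · intro h; tauto
    · rintro (rfl | rfl | h)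
      · exact ha
      · exact hb
      · exact h.1.1
  have hT : T.card + 2 = S.ncard := by
    rw [Set.ncard_eq_toFinset_card _ hfin]
    have hb' : b.edge ∈ hfin.toFinset.erase a.edge := by simp [hb, hab.symm]
    have ha' : a.edge ∈ hfin.toFinset := by simpa
    have := Finset.card_erase_add_one hb'
    have := Finset.card_erase_add_one ha'
    simp only [T]
    omega
  -- The other `S.ncard - 2` edges add at most one cycle each, so altogether there are fewer than
  -- `S.ncard + 1` cycles.
  have e3 := cycleCount_mul_flipDarts_le (c * swap a a.symm * swap b b.symm) T
  have : c * G.flipDarts S = c * swap a a.symm * swap b b.symm * G.flipDarts T := by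
    conv_lhs => rw [hST]
    rw [flipDarts_union, flipDarts_union, flipDarts_singleton, flipDarts_singleton]
    · simp only [mul_assoc]
    · simp [T]
    · simp [T, hab]
  rw [this] at hS
  omega

/-- The contour of the Hamiltonian path of a planar graph: a linear order of the darts in which
the edges off the path are noncrossing and the tails run along the path and back. -/
theorem exists_contour [Finite V] {pos : V ≃ Fin n} (hn : 2 ≤ n)
    (hpath : ∀ u v, (pos u : ℕ) + 1 = pos v → G.Adj u v) (hG : IsPlanar G) :
    ∃ (t : G.Dart → ℕ) (m : ℕ),
      (∀ d d', t d ≤ t d' → t d' ≤ m → pos d.fst ≤ pos d'.fst) ∧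
      (∀ d d', m < t d → t d ≤ t d' → pos d'.fst ≤ pos d.fst) ∧
      ∀ a b : G.Dart, ¬ ((pos a.fst : ℕ) + 1 = pos a.snd ∨ (pos a.snd : ℕ) + 1 = pos a.fst) →
        ¬ ((pos b.fst : ℕ) + 1 = pos b.snd ∨ (pos b.snd : ℕ) + 1 = pos b.fst) →
        t a < t b → t b < t a.symm → t a.symm < t b.symm → False := by
  classical
  obtain ⟨σ, hσ, hcount⟩ := hG
  have hF := cycleCount_facePerm hn hpath hcount
  set S := pathEdgesBelow pos (n - 1) with hS
  set c := σ * G.flipDarts S with hcdef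
  have hc1 : cycleCount c ≤ 1 := by
    have : cycleCount c + (n - 1) ≤ n := cycleCount_contour_le hσ hpath (by omega)
    omega
  rw [facePerm_eq S, ← hcdef] at hF
  have hsame : ∀ x y, c.SameCycle x y := by
    intro x y
    have := Finite.card_le_one_iff_subsingleton.1 hc1
    exact Quotient.exact (s := Perm.SameCycle.setoid c) (Subsingleton.elim _ _)
  have hnode : ∀ k, k + 1 < n → ∃ u : G.Dart, (pos u.fst : ℕ) = k ∧ (pos u.snd : ℕ) = k + 1 := by
    intro k hk
    exact ⟨⟨(pos.symm ⟨k, by omega⟩, pos.symm ⟨k + 1, hk⟩), hpath _ _ (by simp)⟩, by simp, by simp⟩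
  have hmemS : ∀ d : G.Dart, s(d.fst, d.snd) ∈ S ↔
      ((pos d.fst : ℕ) + 1 = pos d.snd ∨ (pos d.snd : ℕ) + 1 = pos d.fst) := by
    intro d
    rw [hS, mem_pathEdgesBelow]
    have h1 := (pos d.fst).2
    have h2 := (pos d.snd).2
    omega
  obtain ⟨u0, hu0, hu0'⟩ := hnode 0 (by omega)
  -- Cutting the contour behind its return to the first vertex puts all darts of that vertex at the
  -- beginning.
  obtain ⟨t, hinj, hstep, hmax, hzero⟩ := Perm.exists_cycle_index hsame u0.symm
  have hfst : ∀ d, (c d).fst = if s(d.fst, d.snd) ∈ S then d.snd else d.fst :=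
    fun d => fst_rotation_flipDarts hσ _ d
  have hdart : ∀ d d' : G.Dart, (pos d.fst : ℕ) = pos d'.fst → (pos d.snd : ℕ) = pos d'.snd →
      d = d' := by
    intro d d' h1 h2
    exact Dart.ext _ _ (Prod.ext (pos.injective (Fin.ext h1)) (pos.injective (Fin.ext h2)))
  -- The contour enters the part of the path beyond the edge `u` only after the dart `u` and leaves
  -- it only after `u.symm`, so the darts with tail in this part fill the interval between these
  -- two.
  have key : ∀ u : G.Dart, (pos u.fst : ℕ) + 1 = pos u.snd → ∀ N, ∀ d, t d = N →
      ((pos u.fst : ℕ) < pos d.fst ↔ t u < t d ∧ t d ≤ t u.symm) := by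
    intro u hu N
    induction N using Nat.strong_induction_on with | _ N ih
    intro d hd
    rcases N with _ | N
    · have : d = c u0.symm := hinj (by rw [hd, hzero])
      have h0 : (pos d.fst : ℕ) = 0 := by
        rw [this, hfst, if_pos]
        · exact hu0
        · rw [hmemS]; right; change (pos u0.fst : ℕ) + 1 = pos u0.snd; omega
      omega
    · obtain ⟨d', rfl⟩ := c.surjective d
      have hd' : d' ≠ u0.symm := by rintro rfl; omega
      have hst := hstep _ hd'
      have ih' := ih N (by omega) d' (by omega)
      by_cases hdu : d' = u
      · subst hdu
        have hp : (pos (c d').fst : ℕ) = pos d'.snd := by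
          rw [hfst, if_pos]; rw [hmemS]; exact Or.inl hu
        have hne : t d' ≠ t d'.symm := fun h => Dart.symm_ne d' (hinj h).symm
        have hge : ¬ t d'.symm < t d' := by
          intro hlt
          have := (ih _ (by omega) d'.symm rfl).1 (by
            change (pos d'.fst : ℕ) < pos d'.snd; omega)
          omega
        omega
      by_cases hdw : d' = u.symm
      · subst hdw
        have hp : (pos (c u.symm).fst : ℕ) = pos u.fst := by
          rw [hfst, if_pos]
          · rfl
          · rw [hmemS]; exact Or.inr hu
        omega
      · have hne1 : t d' ≠ t u := fun h => hdu (hinj h)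
        have hne2 : t d' ≠ t u.symm := fun h => hdw (hinj h)
        have hiff : ((pos u.fst : ℕ) < pos (c d').fst ↔ (pos u.fst : ℕ) < pos d'.fst) := by
          rw [hfst]
          split_ifs with h
          · rw [hmemS] at h
            have h1 : ¬ ((pos d'.fst : ℕ) = pos u.fst ∧ (pos d'.snd : ℕ) = pos u.snd) :=
              fun h => hdu (hdart _ _ h.1 h.2)
            have h2 : ¬ ((pos d'.fst : ℕ) = pos u.snd ∧ (pos d'.snd : ℕ) = pos u.fst) :=
              fun h => hdw (hdart _ _ h.1 h.2)
            omega
          · exact Iff.rfl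
        rw [hiff, ih']
        omega
  -- The contour turns at the last vertex, whose last dart is the reversal of the last path edge.
  obtain ⟨uL, hL, hL'⟩ := hnode (n - 2) (by omega)
  have hlast : ∀ u : G.Dart, (pos u.fst : ℕ) + 1 = pos u.snd →
      t u < t uL.symm ∧ t uL.symm ≤ t u.symm := by
    intro u hu
    refine (key u hu _ uL.symm rfl).1 ?_
    change (pos u.fst : ℕ) < pos uL.snd
    have := (pos u.snd).2
    omega
  refine ⟨t, t uL.symm, ?_, ?_, ?_⟩
  · intro d d' h1 h2
    by_contra hlt
    rw [Fin.le_iff_val_le_val] at hlt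
    have := (pos d.fst).2
    obtain ⟨u, hu, hu'⟩ := hnode (pos d'.fst) (by omega)
    have a1 := (key u (by omega) _ d rfl).1 (by omega)
    have a2 := hlast u (by omega)
    have := (key u (by omega) _ d' rfl).2 (by omega)
    omega
  · intro d d' h1 h2
    by_contra hlt
    rw [Fin.le_iff_val_le_val] at hlt
    have := (pos d'.fst).2
    obtain ⟨u, hu, hu'⟩ := hnode (pos d.fst) (by omega)
    have a1 := (key u (by omega) _ d' rfl).1 (by omega)
    have a2 := hlast u (by omega)
    have := (key u (by omega) _ d rfl).2 (by omega)
    omega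
  · intro a b ha hb
    exact noncrossing_of_cycleCount hc1 hinj hstep hmax hF
      ⟨a.edge_mem, fun h => ha ((hmemS a).1 h)⟩ ⟨b.edge_mem, fun h => hb ((hmemS b).1 h)⟩

end SimpleGraph

/-- A relation of out-degree at most `4` on a finite set has a proper `9`-coloring. -/
theorem exists_coloring_of_outdegree (tgt : ℕ → Fin 4 → ℕ) (S : Finset ℕ) :
    ∃ color : ℕ → Fin 9, ∀ x ∈ S, ∀ y ∈ S, x ≠ y → (∃ l, tgt x l = y) → color x ≠ color y := by
  classical
  induction hN : S.card generalizing S with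
  | zero => exact ⟨fun _ => 0, by simp [Finset.card_eq_zero.1 hN]⟩
  | succ N ih =>
    have hS : S.Nonempty := Finset.card_pos.1 (by omega)
    -- By double counting the average in-degree is at most `4`. Hence some element has at most eight
    -- neighbors; color the others by induction, and one of nine colors is free for it.
    have hsum : ∑ x ∈ S, (S.filter fun y => ∃ l, tgt y l = x).card ≤ ∑ x ∈ S, 4 := by
      have h1 : ∀ x ∈ S, (S.filter fun y => ∃ l, tgt y l = x).card =
          ∑ y ∈ S, if ∃ l, tgt y l = x then 1 else 0 := by
        intro x _; rw [Finset.card_filter]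
      rw [Finset.sum_congr rfl h1, Finset.sum_comm]
      refine Finset.sum_le_sum fun y _ => ?_
      rw [← Finset.card_filter]
      calc (S.filter fun x => ∃ l, tgt y l = x).card
          ≤ (Finset.univ.image (tgt y)).card := by
            apply Finset.card_le_card
            intro x hx
            simpa using (Finset.mem_filter.1 hx).2
        _ ≤ 4 := Finset.card_image_le.trans (by simp)
    obtain ⟨x, hx, hdeg⟩ := Finset.exists_le_of_sum_le hS hsum
    obtain ⟨color, hcol⟩ := ih (S.erase x) (by rw [Finset.card_erase_of_mem hx]; omega)
    let bad : Finset (Fin 9) :=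
      (S.filter fun y => ∃ l, tgt y l = x).image color ∪ Finset.univ.image fun l => color (tgt x l)
    have hbad : bad.card < Finset.card (Finset.univ : Finset (Fin 9)) := by
      calc bad.card ≤ _ := Finset.card_union_le _ _
        _ ≤ 4 + 4 := add_le_add (Finset.card_image_le.trans hdeg)
            (Finset.card_image_le.trans (by simp))
        _ < _ := by simp
    obtain ⟨a, -, ha⟩ := Finset.exists_mem_notMem_of_card_lt_card hbad
    simp only [bad, Finset.mem_union, Finset.mem_image, Finset.mem_filter, Finset.mem_univ,
      true_and, not_or, not_exists, not_and] at ha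
    refine ⟨Function.update color x a, ?_⟩
    intro y hy z hz hyz hl
    by_cases hyx : y = x
    · subst hyx
      rw [Function.update_self, Function.update_of_ne hyz.symm]
      obtain ⟨l, rfl⟩ := hl
      exact fun h => ha.2 l h.symm
    · rw [Function.update_of_ne hyx]
      by_cases hzx : z = x
      · subst hzx
        rw [Function.update_self]
        exact ha.1 y ⟨hy, hl⟩
      · rw [Function.update_of_ne hzx]
        exact hcol y (Finset.mem_erase.2 ⟨hyx, hy⟩) z (Finset.mem_erase.2 ⟨hzx, hz⟩) hyz hl

namespace SimpleGraph

/-- If the Hamiltonian path of a planar graph is cut into blocks, then every block can be made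
responsible for at most four others such that every edge off the path that joins two blocks is
covered, and the blocks have a proper `9`-coloring. -/
theorem exists_block_orientation {V : Type} [Finite V] {G : SimpleGraph V} {n : ℕ}
    {pos : V ≃ Fin n} (hpath : ∀ u v, (pos u : ℕ) + 1 = pos v → G.Adj u v) (hG : IsPlanar G)
    {f : ℕ → ℕ} (hf : Monotone f) :
    ∃ (tgt : ℕ → Fin 4 → ℕ) (color : ℕ → Fin 9), ∀ u v, G.Adj u v →
      (pos u : ℕ) + 1 ≠ pos v → (pos v : ℕ) + 1 ≠ pos u → f (pos u) ≠ f (pos v) →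
      color (f (pos u)) ≠ color (f (pos v)) ∧
        ((∃ l, tgt (f (pos u)) l = f (pos v)) ∨ ∃ l, tgt (f (pos v)) l = f (pos u)) := by
  classical
  rcases Nat.lt_or_ge n 2 with hn | hn
  · refine ⟨fun _ _ => 0, fun _ => 0, fun u v huv _ _ _ => ?_⟩
    have : u = v := pos.injective (Fin.ext (by have := (pos u).2; have := (pos v).2; omega))
    exact absurd this huv.ne
  obtain ⟨t, m, hup, hdown, hcross⟩ := exists_contour hn hpath hG
  let p : G.Dart → ℕ := fun d => pos d.fst
  have hup : ∀ d d', t d ≤ t d' → t d' ≤ m → p d ≤ p d' := hup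
  have hdown : ∀ d d', m < t d → t d ≤ t d' → p d' ≤ p d := hdown
  have hK : ∀ d, f (p d) ≤ f n := fun d => hf (pos d.fst).2.le
  let g : G.Dart → ℕ := fun d => if t d ≤ m then f (p d) else 2 * f n - f (p d)
  let b : ℕ → ℕ := fun x => if x ≤ f n then x else 2 * f n - x
  have hbg : ∀ d, b (g d) = f (p d) := by
    intro d
    have := hK d
    simp only [g, b]
    split_ifs <;> omega
  have hg : ∀ d, g d = f (p d) ∨ g d = 2 * f n - f (p d) := by
    intro d; simp only [g]; split_ifs <;> simp
  have hmono : ∀ d d', t d ≤ t d' → g d ≤ g d' := by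
    intro d d' h
    have h1 := hK d
    have h2 := hK d'
    simp only [g]
    split_ifs with h3 h4 h4
    · exact hf (hup _ _ h h4)
    · omega
    · omega
    · have := hf (hdown _ _ (by omega) h)
      omega
  have hlt : ∀ d d', g d < g d' → t d < t d' := by
    intro d d' h
    by_contra h'
    have := hmono d' d (by omega)
    omega
  let A : ℕ → ℕ → Prop := fun x y => x < y ∧ ∃ d : G.Dart,
    ¬ ((pos d.fst : ℕ) + 1 = pos d.snd ∨ (pos d.snd : ℕ) + 1 = pos d.fst) ∧ g d = x ∧ g d.symm = y
  have hA : ∀ x y x' y', A x y → A x' y' → x < x' → x' < y → y < y' → False := by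
    rintro x y x' y' ⟨-, d, hd, rfl, rfl⟩ ⟨-, d', hd', rfl, rfl⟩ h1 h2 h3
    exact hcross d d' hd hd' (hlt _ _ h1) (hlt _ _ h2) (hlt _ _ h3)
  have hAle : ∀ x y, A x y → y ≤ 2 * f n := by
    rintro x y ⟨-, d, -, -, rfl⟩
    have := hK d.symm
    rcases hg d.symm with h | h <;> omega
  let right : ℕ → ℕ := fun x => Nat.findGreatest (A x) (2 * f n)
  let left : ℕ → ℕ := fun y => sInf {x | A x y}
  have hchord : ∀ x y, A x y → right x = y ∨ left y = x := by
    intro x y h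
    by_contra hne
    rw [not_or] at hne
    -- Otherwise `left y < x < y < right x`, and the chords from `left y` to `y` and from `x` to
    -- `right x` cross.
    have h1 : y ≤ right x := Nat.le_findGreatest (hAle _ _ h) h
    have h2 : A x (right x) := Nat.findGreatest_spec (hAle _ _ h) h
    have h3 : left y ≤ x := Nat.sInf_le h
    have h4 : A (left y) y := Nat.sInf_mem (s := {x | A x y}) ⟨x, h⟩
    exact hA _ _ _ _ h4 h2 (by omega) h.1 (by omega)
  -- A block occurs on the contour only at the numbers `x` and `2 * f n - x`, each of which answers
  -- for two extreme chords.
  let tgt : ℕ → Fin 4 → ℕ := fun x =>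
    ![b (right x), b (left x), b (right (2 * f n - x)), b (left (2 * f n - x))]
  have hright : ∀ d, ∃ l, tgt (f (p d)) l = b (right (g d)) := by
    intro d
    rcases hg d with h | h
    · exact ⟨0, by rw [h]; rfl⟩
    · exact ⟨2, by rw [h]; rfl⟩
  have hleft : ∀ d, ∃ l, tgt (f (p d)) l = b (left (g d)) := by
    intro d
    rcases hg d with h | h
    · exact ⟨1, by rw [h]; rfl⟩
    · exact ⟨3, by rw [h]; rfl⟩
  obtain ⟨color, hcol⟩ := exists_coloring_of_outdegree tgt (Finset.range (f n + 1))
  have hcov : ∀ u v, G.Adj u v → (pos u : ℕ) + 1 ≠ pos v → (pos v : ℕ) + 1 ≠ pos u →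
      f (pos u) ≠ f (pos v) →
        ((∃ l, tgt (f (pos u)) l = f (pos v)) ∨ ∃ l, tgt (f (pos v)) l = f (pos u)) := by
    intro u v huv h1 h2 hne
    let d : G.Dart := ⟨(u, v), huv⟩
    have e1 : f (p d) = f (pos u) := rfl
    have e2 : f (p d.symm) = f (pos v) := rfl
    have hgne : g d ≠ g d.symm := by
      intro h
      apply hne
      rw [← e1, ← e2, ← hbg d, ← hbg d.symm, h]
    rcases lt_or_gt_of_ne hgne with h | h
    · rcases hchord _ _ ⟨h, d, by rintro (h | h); exacts [h1 h, h2 h], rfl, rfl⟩ with h' | h'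
      · left
        obtain ⟨l, hl⟩ := hright d
        exact ⟨l, by rw [← e1, hl, h', hbg, e2]⟩
      · right
        obtain ⟨l, hl⟩ := hleft d.symm
        exact ⟨l, by rw [← e2, hl, h', hbg, e1]⟩
    · rcases hchord _ _ ⟨h, d.symm, by rintro (h | h); exacts [h2 h, h1 h], rfl, by simp⟩ with h' | h'
      · right
        obtain ⟨l, hl⟩ := hright d.symm
        exact ⟨l, by rw [← e2, hl, h', hbg, e1]⟩
      · left
        obtain ⟨l, hl⟩ := hleft d
        exact ⟨l, by rw [← e1, hl, h', hbg, e2]⟩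
  refine ⟨tgt, color, fun u v huv h1 h2 hne => ⟨?_, hcov u v huv h1 h2 hne⟩⟩
  have hu : f (pos u) ∈ Finset.range (f n + 1) := Finset.mem_range.2 (Nat.lt_succ_of_le (hf (pos u).2.le))
  have hv : f (pos v) ∈ Finset.range (f n + 1) := Finset.mem_range.2 (Nat.lt_succ_of_le (hf (pos v).2.le))
  rcases hcov u v huv h1 h2 hne with h | h
  · exact hcol _ hu _ hv hne h
  · exact (hcol _ hv _ hu hne.symm h).symm

end SimpleGraph

end PlanarPaths

/-! ### The sizes of the levels -/

section Sizes

/-- The exponents of the row widths. -/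
def widthExp : ℕ → ℕ
  | 0 => 2
  | i + 1 => 3 ^ widthExp i - 3

/-- The number of cells in a row of level `i`. -/
def width (i : ℕ) : ℕ := 3 ^ widthExp i

/-- The number of rows of level `0` that make up a row of level `i`. -/
def span : ℕ → ℕ
  | 0 => 1
  | i + 1 => 3 ^ width i * span i

theorem width_succ (i : ℕ) : width (i + 1) = 3 ^ (width i - 3) := rfl

theorem span_succ (i : ℕ) : span (i + 1) = 3 ^ width i * span i := rfl

theorem add_one_le_three_pow_sub {w : ℕ} (hw : 9 ≤ w) : w + 1 ≤ 3 ^ (w - 3) := by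
  obtain ⟨k, rfl⟩ := Nat.exists_eq_add_of_le hw
  rw [show 9 + k - 3 = 6 + k by omega]
  induction k with
  | zero => norm_num
  | succ k ih => have := ih (by omega); rw [show 6 + (k + 1) = 6 + k + 1 by omega, pow_succ]; omega

theorem two_pow_le_three_pow_sub {w : ℕ} (hw : 9 ≤ w) : 2 ^ w ≤ 3 ^ (w - 3) := by
  obtain ⟨k, rfl⟩ := Nat.exists_eq_add_of_le hw
  rw [show 9 + k - 3 = 6 + k by omega]
  induction k with
  -- The base case is `512 ≤ 729`; the inequality fails for the exponents `8` and `5`.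
  | zero => norm_num
  | succ k ih =>
    have := ih (by omega)
    rw [show 6 + (k + 1) = 6 + k + 1 by omega, show 9 + (k + 1) = 9 + k + 1 by omega, pow_succ,
      pow_succ]
    omega

theorem nine_add_le_width (i : ℕ) : 9 + i ≤ width i := by
  induction i with
  | zero => exact le_refl _
  | succ i ih =>
    have := add_one_le_three_pow_sub (w := width i) (by omega)
    rw [width_succ]; omega

theorem width_pos (i : ℕ) : 0 < width i := by have := nine_add_le_width i; omega

theorem two_pow_width_le (i : ℕ) : 2 ^ width i ≤ width (i + 1) :=
  two_pow_le_three_pow_sub (by have := nine_add_le_width i; omega)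

/-- The rows below one parent row have exactly 27 symbols for each of its cells, without remainder.
-/
theorem three_pow_width (i : ℕ) : 3 ^ width i = width (i + 1) * 27 := by
  have := nine_add_le_width i
  rw [width_succ, show (27 : ℕ) = 3 ^ 3 by norm_num, ← pow_add]
  congr 1; omega

/-- The symbols of a parent row split into complete pieces of length `width i`, so the rotating mark
is back in the first cell whenever a new parent row begins. -/
theorem width_dvd (i : ℕ) : width i ∣ 3 ^ width i :=
  pow_dvd_pow 3 (Nat.lt_pow_self (by norm_num)).le

theorem span_pos (i : ℕ) : 0 < span i := by
  induction i with
  | zero => exact Nat.one_pos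
  | succ i ih => exact Nat.mul_pos (by positivity) ih

theorem span_dvd_succ (i : ℕ) : span i ∣ span (i + 1) := ⟨3 ^ width i, by rw [span_succ, mul_comm]⟩

theorem span_dvd {i j : ℕ} (h : i ≤ j) : span i ∣ span j := by
  induction j, h using Nat.le_induction with
  | base => exact dvd_rfl
  | succ j _ ih => exact ih.trans (span_dvd_succ j)

theorem span_succ' (i : ℕ) : span (i + 1) = width (i + 1) * (27 * span i) := by
  rw [span_succ, three_pow_width, mul_assoc]

theorem lt_span (i : ℕ) : i < span i := by
  induction i with
  | zero => exact Nat.one_pos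
  | succ i ih =>
    rw [span_succ']
    have := width_pos (i + 1)
    nlinarith

theorem width_le_span (i : ℕ) : width (i + 1) ≤ span (i + 1) := by
  rw [span_succ']
  exact Nat.le_mul_of_pos_right _ (Nat.mul_pos (by norm_num) (span_pos i))

/-- The highest level whose rows fit into `n` nodes. -/
def topLevel (n : ℕ) : ℕ := Nat.findGreatest (fun i => span i ≤ n) n

theorem span_topLevel_le {n : ℕ} (hn : 0 < n) : span (topLevel n) ≤ n :=
  Nat.findGreatest_spec (P := fun i => span i ≤ n) (m := 0) (Nat.zero_le _) hn

theorem lt_span_topLevel_succ (n : ℕ) : n < span (topLevel n + 1) := by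
  by_contra h
  push Not at h
  have h1 : topLevel n + 1 ≤ n := (lt_span _).le.trans h
  have := Nat.le_findGreatest (P := fun i => span i ≤ n) h1 h
  change topLevel n + 1 ≤ topLevel n at this
  omega

/-- One logarithm takes a number that is at least `width (J + 1)` to one that is at least `width J`,
because `2 ^ width J ≤ width (J + 1)`. -/
theorem one_lt_iterate_logb (J : ℕ) : ∀ x : ℝ, (width J : ℝ) ≤ x → ∀ k ≤ J,
    1 < (Real.logb 2)^[k] x := by
  have hw : ∀ i, (1 : ℝ) < width i := fun i => by
    have := nine_add_le_width i
    exact_mod_cast (by omega : 1 < width i)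
  induction J with
  | zero =>
    intro x hx k hk
    obtain rfl : k = 0 := by omega
    exact (hw 0).trans_le hx
  | succ J ih =>
    intro x hx k hk
    rcases k with _ | k
    · exact (hw _).trans_le hx
    · rw [Function.iterate_succ_apply]
      apply ih _ _ k (by omega)
      have hx0 : 0 < x := by have := hw (J + 1); linarith
      rw [Real.le_logb_iff_rpow_le (by norm_num) hx0, Real.rpow_natCast]
      refine le_trans ?_ hx
      exact_mod_cast two_pow_width_le J

/-- The infimum in `logStar` is attained only if its set is nonempty. Above `2` the logarithm lowers
a number by at least `1`. -/
theorem exists_iterate_logb_le_one (m : ℕ) : ∀ x : ℝ, x ≤ m → ∃ k, (Real.logb 2)^[k] x ≤ 1 := by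
  induction m with
  | zero => intro x hx; exact ⟨0, by simp at hx ⊢; linarith⟩
  | succ m ih =>
    intro x hx
    rcases le_or_gt x 1 with h1 | h1
    · exact ⟨0, h1⟩
    rcases le_or_gt x 2 with h2 | h2
    · refine ⟨1, ?_⟩
      simp only [Function.iterate_one]
      rw [Real.logb_le_iff_le_rpow (by norm_num) (by linarith)]
      simpa using h2
    · obtain ⟨k, hk⟩ := ih (Real.logb 2 x) (by
        push_cast at hx
        refine le_trans ?_ (by linarith : x - 1 ≤ m)
        rw [Real.logb_le_iff_le_rpow (by norm_num) (by linarith)]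
        -- Bernoulli's inequality gives `x ≤ 2 ^ (x - 1)`.
        have := one_add_mul_self_le_rpow_one_add (s := (1 : ℝ)) (by norm_num) (p := x - 1) (by linarith)
        norm_num at this
        linarith)
      exact ⟨k + 1, by rwa [Function.iterate_succ_apply]⟩

theorem topLevel_le_logStar (n : ℕ) : topLevel n ≤ logStar n := by
  rcases Nat.eq_zero_or_pos (topLevel n) with h0 | hpos
  · omega
  have hn : 0 < n := by
    rcases Nat.eq_zero_or_pos n with rfl | h
    · simp [topLevel] at hpos
    · exact h
  obtain ⟨j, hj⟩ : ∃ j, topLevel n = j + 1 := ⟨topLevel n - 1, by omega⟩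
  have hle := span_topLevel_le hn
  rw [hj] at hle ⊢
  obtain ⟨k, hk⟩ := exists_iterate_logb_le_one n n le_rfl
  have hmem : logStar n ∈ {k : ℕ | (Real.logb 2)^[k] (n : ℝ) ≤ 1} := Nat.sInf_mem ⟨k, hk⟩
  by_contra hlt
  have := one_lt_iterate_logb (j + 1) n (by exact_mod_cast (width_le_span j).trans hle) (logStar n)
    (by omega)
  exact absurd hmem (not_le.2 this)

end Sizes

/-! ### Rows of cells -/

/-- The base field of the hash values. -/
abbrev Fq := ZMod 139

instance fact_prime_139 : Fact (Nat.Prime 139) := ⟨by norm_num⟩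

/-- The hashed symbol streams: the current content of the parent row (`inl false`), its next
content (`inl true`), its digits (`inr none`), and its slots (`inr (some l)`). -/
abbrev Fam := Bool ⊕ Option (Fin 4)

/-- The content of a cell. A row of cells holds a random multiplier (`seed`), a random linear form
(`proj`), a rotating mark, the hash of the previous parent row (`ret`), a base-`3` counter (`digit`),
and the registers of the Horner schemes that hash the symbol streams. -/
structure Cell where
  seed : Fq
  proj : Fq
  mark : Fq
  ret : Fq
  digit : Fq
  pow : Fam → Fq
  acc : Fam → Fq

section Rows

/-- The accumulators of a row after the current symbol has been absorbed. -/
def absorb (e : ℕ) (x : ℕ → Cell) (s : Fam → Fq) (f : Fam) (j : ℕ) : Fq :=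
  (x j).acc f + (∑ i ∈ Finset.range e, (x i).mark * (x i).seed) * (x j).pow f + s f * (x j).mark

/-- The counter of the row is at its maximum. -/
def RowTop (e : ℕ) (x : ℕ → Cell) : Prop := ∀ j < e, (x j).digit = 2

open Classical in
/-- The row that follows the row `x`. -/
noncomputable def nextRow (e : ℕ) (x : ℕ → Cell) (s : Fam → Fq) (j : ℕ) : Cell where
  seed := (x j).seed
  proj := (x j).proj
  mark := if j = 0 then (x (e - 1)).mark else (x (j - 1)).mark
  ret := if RowTop e x then absorb e x s (.inl true) j else (x j).ret
  digit := if ∀ i < j, (x i).digit = 2 then (if (x j).digit = 2 then 0 else (x j).digit + 1)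
    else (x j).digit
  pow f := if RowTop e x then 0 else if (x (e - 1)).mark = 1 then absorb e x s f j
    else if j = 0 then 2 * (x (e - 1)).pow f else (x (j - 1)).pow f
  acc f := if (x (e - 1)).mark = 1 then 0 else absorb e x s f j

/-- The content of the first cells of the protocol, up to the random entries. -/
def Cell.IsInitial (c : Cell) (first : Prop) : Prop :=
  (first → c.mark = 1) ∧ (¬ first → c.mark = 0) ∧ c.digit = 0 ∧ (∀ f, c.pow f = 0) ∧
    ∀ f, c.acc f = 0

/-- A run of `T` consecutive rows, the first of which is initial. -/
structure RowRun (e T : ℕ) (x : ℕ → ℕ → Cell) (s : ℕ → Fam → Fq) : Prop where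
  init : ∀ j < e, (x 0 j).IsInitial (j = 0)
  step : ∀ b, b + 1 < T → ∀ j < e, x (b + 1) j = nextRow e (x b) (s b) j

/-- The increment of `b` carries into digit `j` exactly when all lower digits overflow. -/
theorem digits_eq_two_iff (b j : ℕ) : (∀ i < j, b / 3 ^ i % 3 = 2) ↔ 3 ^ j ∣ b + 1 := by
  induction j with
  | zero => simp
  | succ j ih =>
    have : (∀ i < j + 1, b / 3 ^ i % 3 = 2) ↔ (∀ i < j, b / 3 ^ i % 3 = 2) ∧ b / 3 ^ j % 3 = 2 := by
      constructor
      · exact fun h => ⟨fun i hi => h i (by omega), h j (by omega)⟩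
      · rintro ⟨h1, h2⟩ i hi
        rcases Nat.lt_succ_iff_lt_or_eq.1 hi with h | rfl
        exacts [h1 i h, h2]
    rw [this, ih]
    constructor
    · rintro ⟨h1, h2⟩
      have h3 : (b + 1) / 3 ^ j = b / 3 ^ j + 1 := by rw [Nat.succ_div, if_pos h1]
      rw [pow_succ]
      obtain ⟨k, hk⟩ := h1
      rw [hk, Nat.mul_div_cancel_left _ (by positivity)] at h3
      rw [hk]
      exact Nat.mul_dvd_mul_left _ (by omega)
    · intro h
      have h1 : 3 ^ j ∣ b + 1 := (pow_dvd_pow 3 (by omega)).trans h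
      refine ⟨h1, ?_⟩
      have h3 : (b + 1) / 3 ^ j = b / 3 ^ j + 1 := by rw [Nat.succ_div, if_pos h1]
      obtain ⟨k, hk⟩ := h
      rw [hk, pow_succ, mul_assoc, Nat.mul_div_cancel_left _ (by positivity)] at h3
      omega

theorem natCast_eq_two_iff {d : ℕ} (hd : d < 3) : ((d : ℕ) : Fq) = 2 ↔ d = 2 := by
  interval_cases d <;> decide

variable {e T : ℕ} {x : ℕ → ℕ → Cell} {s : ℕ → Fam → Fq}

theorem RowRun.digit_eq (h : RowRun e T x s) {b : ℕ} (hb : b < T) {j : ℕ} (hj : j < e) :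
    (x b j).digit = ((b / 3 ^ j % 3 : ℕ) : Fq) := by
  induction b generalizing j with
  | zero => rw [(h.init j hj).2.2.1]; simp
  | succ b ih =>
    have ih := fun i (hi : i < e) => ih (by omega) hi
    rw [h.step b hb j hj]
    have hc : (∀ i < j, (x b i).digit = 2) ↔ 3 ^ j ∣ b + 1 := by
      rw [← digits_eq_two_iff]
      refine forall₂_congr fun i hi => ?_
      rw [ih i (by omega), natCast_eq_two_iff (Nat.mod_lt _ (by norm_num))]
    simp only [nextRow, hc, ih j hj, natCast_eq_two_iff (Nat.mod_lt _ (by norm_num : 3 > 0))]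
    rw [Nat.succ_div]
    have := Nat.mod_lt (b / 3 ^ j) (by norm_num : 3 > 0)
    split_ifs with h1 h2
    · rw [show (b / 3 ^ j + 1) % 3 = 0 by omega]; simp
    · rw [show (b / 3 ^ j + 1) % 3 = b / 3 ^ j % 3 + 1 by omega]; push_cast; rfl
    · rfl

theorem RowRun.rowTop_iff (h : RowRun e T x s) {b : ℕ} (hb : b < T) :
    RowTop e (x b) ↔ 3 ^ e ∣ b + 1 := by
  rw [← digits_eq_two_iff]
  refine forall₂_congr fun i hi => ?_
  rw [h.digit_eq hb hi, natCast_eq_two_iff (Nat.mod_lt _ (by norm_num))]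

theorem RowRun.mark_eq (h : RowRun e T x s) {b : ℕ} (hb : b < T) {j : ℕ} (hj : j < e) :
    (x b j).mark = if j = b % e then 1 else 0 := by
  induction b generalizing j with
  | zero =>
    obtain ⟨h1, h2, -⟩ := h.init j hj
    rw [Nat.zero_mod]
    split_ifs with h0
    exacts [h1 h0, h2 h0]
  | succ b ih =>
    have ih := fun i (hi : i < e) => ih (by omega) hi
    rw [h.step b hb j hj]
    simp only [nextRow]
    have hm := Nat.mod_lt b (show e > 0 by omega)
    have hsucc : (b + 1) % e = if b % e = e - 1 then 0 else b % e + 1 := by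
      split_ifs with h1
      · have : e ∣ b + 1 := by
          rw [← Nat.div_add_mod b e, h1, add_assoc, Nat.sub_add_cancel (by omega)]
          exact ⟨b / e + 1, by ring⟩
        exact Nat.mod_eq_zero_of_dvd this
      · rw [Nat.add_mod, Nat.mod_eq_of_lt (a := 1) (by omega), Nat.mod_eq_of_lt (by omega)]
    rw [hsucc]
    by_cases h0 : j = 0
    · rw [if_pos h0, ih _ (by omega)]
      exact if_congr (by split_ifs <;> omega) rfl rfl
    · rw [if_neg h0, ih _ (by omega)]
      exact if_congr (by split_ifs <;> omega) rfl rfl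

theorem RowRun.mark_last (h : RowRun e T x s) (he : 0 < e) {b : ℕ} (hb : b < T) :
    (x b (e - 1)).mark = 1 ↔ b % e = e - 1 := by
  rw [h.mark_eq hb (by omega)]
  split_ifs with h1
  · simp [h1.symm]
  · constructor
    · intro h2; exact absurd h2 (by decide)
    · exact fun h2 => absurd h2.symm h1

theorem RowRun.seed_eq (h : RowRun e T x s) {b : ℕ} (hb : b < T) {j : ℕ} (hj : j < e) :
    (x b j).seed = (x 0 j).seed := by
  induction b with
  | zero => rfl
  | succ b ih => rw [h.step b hb j hj]; exact ih (by omega)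

theorem RowRun.proj_eq (h : RowRun e T x s) {b : ℕ} (hb : b < T) {j : ℕ} (hj : j < e) :
    (x b j).proj = (x 0 j).proj := by
  induction b with
  | zero => rfl
  | succ b ih => rw [h.step b hb j hj]; exact ih (by omega)

/-- Exactly one cell is marked, so the sum in `absorb` reads off the coordinate `b % e` of the
multiplier, and the symbol enters at the same place. -/
theorem RowRun.absorb_eq (h : RowRun e T x s) {b : ℕ} (hb : b < T) (f : Fam) {j : ℕ} (hj : j < e) :
    absorb e (x b) (s b) f j = (x b j).acc f + (x 0 (b % e)).seed * (x b j).pow f +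
      s b f * if j = b % e then 1 else 0 := by
  have hm := Nat.mod_lt b (show e > 0 by omega)
  rw [absorb, h.mark_eq hb hj, Finset.sum_eq_single (b % e), h.mark_eq hb hm, if_pos rfl, one_mul,
    h.seed_eq hb hm]
  · intro i hi hne
    rw [h.mark_eq hb (Finset.mem_range.1 hi), if_neg hne, zero_mul]
  · exact fun hn => absurd (Finset.mem_range.2 hm) hn

/-! ### The Horner scheme that a run of rows performs -/

section Hash

variable {K : Type} [Field K] [Algebra Fq K]

/-- The element of `K` with coordinates `v 0, ..., v (e - 1)` in the powers of `z`. -/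
def rowVal (e : ℕ) (z : K) (v : ℕ → Fq) : K := ∑ j ∈ Finset.range e, algebraMap Fq K (v j) * z ^ j

theorem rowVal_congr {z : K} {v w : ℕ → Fq} (h : ∀ j < e, v j = w j) :
    rowVal e z v = rowVal e z w :=
  Finset.sum_congr rfl fun j hj => by rw [h j (Finset.mem_range.1 hj)]

/-- In the basis of powers of `z`, multiplication by `z` is a cyclic shift; the coordinate that
wraps around is doubled since `z ^ e = 2`. Rows can thus multiply in the field by moving entries
between neighboring cells. -/
theorem rowVal_shift {z : K} (hz : z ^ e = 2) (he : 0 < e) (v : ℕ → Fq) :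
    rowVal e z (fun j => if j = 0 then 2 * v (e - 1) else v (j - 1)) = z * rowVal e z v := by
  obtain ⟨d, rfl⟩ : ∃ d, e = d + 1 := ⟨e - 1, by omega⟩
  simp only [rowVal]
  rw [Finset.sum_range_succ', Finset.sum_range_succ, mul_add, Finset.mul_sum]
  congr 1
  · refine Finset.sum_congr rfl fun i _ => ?_
    simp only [Nat.add_eq_zero_iff, one_ne_zero, and_false, if_false, Nat.add_sub_cancel]
    ring
  · simp only [if_true, Nat.add_sub_cancel, map_mul, map_ofNat, pow_zero, mul_one]
    rw [← hz]; ring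

/-- The Horner scheme: the hash of the first `q * e` symbols of a stream, cut into pieces of
length `e` that are read as elements of `K`. -/
def horner (e : ℕ) (z r : K) (S : ℕ → Fq) : ℕ → K
  | 0 => 0
  | q + 1 => horner e z r S q * r + rowVal e z (fun i => S (q * e + i))

theorem horner_congr {z r : K} {S S' : ℕ → Fq} {q : ℕ} (h : ∀ t < q * e, S t = S' t) :
    horner e z r S q = horner e z r S' q := by
  induction q with
  | zero => rfl
  | succ q ih =>
    have : (q + 1) * e = q * e + e := by ring
    rw [horner, horner, ih fun t ht => h t (by omega),
      rowVal_congr fun i hi => h (q * e + i) (by omega)]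

/-- Read in the field, a single row contributes one term of the product with the multiplier and one
coordinate of the current piece. -/
theorem RowRun.rowVal_absorb (h : RowRun e T x s) (he : 0 < e) {b : ℕ} (hb : b < T) (f : Fam)
    (z : K) :
    rowVal e z (absorb e (x b) (s b) f) = rowVal e z (fun j => (x b j).acc f) +
      algebraMap Fq K (x 0 (b % e)).seed * rowVal e z (fun j => (x b j).pow f) +
        algebraMap Fq K (s b f) * z ^ (b % e) := by
  rw [rowVal_congr fun j hj => h.absorb_eq hb f hj]
  simp only [rowVal, map_add, map_mul, add_mul, Finset.sum_add_distrib, Finset.mul_sum, mul_assoc]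
  congr 1
  rw [Finset.sum_eq_single (b % e)]
  · simp
  · intro j _ hj; simp [hj]
  · exact fun hn => absurd (Finset.mem_range.2 (Nat.mod_lt b he)) hn

variable {z : K}

/-- The registers of the Horner scheme in the course of a run. -/
theorem RowRun.registers (h : RowRun e T x s) (hz : z ^ e = 2) (he : 0 < e) (hd : e ∣ 3 ^ e)
    (f : Fam) {b : ℕ} (hb : b < T) : ∀ B q i, b = B * 3 ^ e + (q * e + i) → q * e + i < 3 ^ e →
      i < e →
    rowVal e z (fun j => (x b j).pow f) =
      z ^ i * horner e z (rowVal e z fun j => (x 0 j).seed) (fun t => s (B * 3 ^ e + t) f) q ∧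
    rowVal e z (fun j => (x b j).acc f) =
      rowVal i z (fun j => (x 0 j).seed) *
        horner e z (rowVal e z fun j => (x 0 j).seed) (fun t => s (B * 3 ^ e + t) f) q +
      rowVal i z (fun i' => s (B * 3 ^ e + (q * e + i')) f) := by
  obtain ⟨m, hm⟩ := hd
  induction b with
  | zero =>
    intro B q i hB _ _
    have h0 : ∀ j < e, (x 0 j).pow f = 0 ∧ (x 0 j).acc f = 0 := fun j hj =>
      ⟨(h.init j hj).2.2.2.1 f, (h.init j hj).2.2.2.2 f⟩
    have hq : q = 0 := by
      by_contra hq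
      have : 1 * e ≤ q * e := Nat.mul_le_mul_right _ (by omega)
      omega
    have hi : i = 0 := by omega
    subst hq hi
    rw [rowVal_congr fun j hj => (h0 j hj).1, rowVal_congr fun j hj => (h0 j hj).2]
    simp [rowVal, horner]
  | succ b ih =>
    intro B q i hB ht hi
    have ih := ih (by omega)
    have hmod : ∀ B q i, b = B * 3 ^ e + (q * e + i) → i < e → b % e = i := by
      intro B q i hb hi
      rw [hb, hm, show B * (e * m) + (q * e + i) = i + (B * m + q) * e by ring,
        Nat.add_mul_mod_self_right, Nat.mod_eq_of_lt hi]
    have hstep := h.step b hb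
    have hpow : 0 < 3 ^ e := by positivity
    rcases Nat.eq_zero_or_pos (q * e + i) with h0 | hpos
    -- A new parent row begins: the counter has just wrapped, and since `e` divides `3 ^ e` a piece
    -- has ended as well, so both registers are cleared.
    · have hi0 : i = 0 := by omega
      have hq0 : q = 0 := by
        by_contra hq
        have : 1 * e ≤ q * e := Nat.mul_le_mul_right _ (by omega)
        omega
      subst hi0 hq0
      have hdv : 3 ^ e ∣ b + 1 := ⟨B, by rw [hB]; ring⟩
      have htop := (h.rowTop_iff (by omega : b < T)).2 hdv
      have hlast : (x b (e - 1)).mark = 1 := by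
        rw [h.mark_last he (by omega)]
        have h1 : (b + 1) % e = 0 := Nat.mod_eq_zero_of_dvd (Dvd.dvd.trans ⟨m, hm⟩ hdv)
        have h2 := Nat.mod_lt b he
        have h3 := Nat.div_add_mod b e
        by_contra hne
        rw [← h3, add_assoc, Nat.mul_add_mod, Nat.mod_eq_of_lt (by omega)] at h1
        omega
      rw [rowVal_congr (v := fun j => (x (b + 1) j).pow f) (w := fun _ => 0)
          fun j hj => by rw [hstep j hj]; exact if_pos htop,
        rowVal_congr (v := fun j => (x (b + 1) j).acc f) (w := fun _ => 0)
          fun j hj => by rw [hstep j hj]; exact if_pos hlast]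
      simp [rowVal, horner]
    · have hntop : ¬ RowTop e (x b) := by
        rw [h.rowTop_iff (by omega : b < T), hB]
        rw [Nat.dvd_add_right (Dvd.intro_left _ rfl)]
        exact fun hdv => absurd (Nat.le_of_dvd hpos hdv) (by omega)
      rcases Nat.eq_zero_or_pos i with rfl | hipos
      -- A piece is complete: the accumulator has received all coordinates of the multiplier and of
      -- the piece, so it is the next Horner value. It moves to `pow`, and `acc` restarts from zero.
      · obtain ⟨q, rfl⟩ : ∃ q', q = q' + 1 := ⟨q - 1, by
          rcases q with _ | q
          · simp at hpos
          · rfl⟩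
        have hqe : (q + 1) * e = q * e + e := by ring
        have hb' : b = B * 3 ^ e + (q * e + (e - 1)) := by omega
        have hbe := hmod _ _ _ hb' (by omega)
        obtain ⟨ih1, ih2⟩ := ih B q (e - 1) hb' (by omega) (by omega)
        have hlast : (x b (e - 1)).mark = 1 := (h.mark_last he (by omega)).2 hbe
        have habs : rowVal e z (absorb e (x b) (s b) f) =
            horner e z (rowVal e z fun j => (x 0 j).seed) (fun t => s (B * 3 ^ e + t) f) (q + 1) := by
          rw [h.rowVal_absorb he (by omega), ih1, ih2, hbe, horner]
          have hsum : ∀ v : ℕ → Fq, rowVal e z v =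
              rowVal (e - 1) z v + algebraMap Fq K (v (e - 1)) * z ^ (e - 1) := by
            intro v
            obtain ⟨d, hd⟩ : ∃ d, e = d + 1 := ⟨e - 1, by omega⟩
            rw [hd, Nat.add_sub_cancel, rowVal, Finset.sum_range_succ, rowVal]
          rw [hsum fun j => (x 0 j).seed, hsum fun i => s (B * 3 ^ e + (q * e + i)) f, ← hb']
          ring
        rw [rowVal_congr (v := fun j => (x (b + 1) j).pow f) (w := absorb e (x b) (s b) f)
            fun j hj => by rw [hstep j hj]; exact (if_neg hntop).trans (if_pos hlast),
          rowVal_congr (v := fun j => (x (b + 1) j).acc f) (w := fun _ => 0)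
            fun j hj => by rw [hstep j hj]; exact if_pos hlast, habs]
        simp [rowVal]
      -- Within a piece `pow` is multiplied by `z`, ready for the next coordinate of the multiplier.
      · have hb' : b = B * 3 ^ e + (q * e + (i - 1)) := by omega
        have hbe := hmod _ _ _ hb' (by omega)
        obtain ⟨ih1, ih2⟩ := ih B q (i - 1) hb' (by omega) (by omega)
        have hlast : ¬ (x b (e - 1)).mark = 1 := by
          rw [h.mark_last he (by omega)]; omega
        rw [rowVal_congr (v := fun j => (x (b + 1) j).pow f)
            (w := fun j => if j = 0 then 2 * (x b (e - 1)).pow f else (x b (j - 1)).pow f)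
            fun j hj => by rw [hstep j hj]; exact (if_neg hntop).trans (if_neg hlast),
          rowVal_shift hz he (fun j => (x b j).pow f),
          rowVal_congr (v := fun j => (x (b + 1) j).acc f) (w := absorb e (x b) (s b) f)
            fun j hj => by rw [hstep j hj]; exact if_neg hlast,
          h.rowVal_absorb he (by omega), ih1, ih2, hbe]
        obtain ⟨k, rfl⟩ : ∃ k, i = k + 1 := ⟨i - 1, by omega⟩
        simp only [Nat.add_sub_cancel] at hb' ⊢
        have hsum : ∀ v : ℕ → Fq, rowVal (k + 1) z v =
            rowVal k z v + algebraMap Fq K (v k) * z ^ k := fun v => Finset.sum_range_succ _ _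
        rw [hsum, hsum, ← hb']
        constructor <;> ring

/-- At the end of a parent row the accumulators hold the hashes of its symbol streams. -/
theorem RowRun.rowVal_absorb_top (h : RowRun e T x s) (hz : z ^ e = 2) (he : 0 < e)
    (hd : e ∣ 3 ^ e) (f : Fam) {b B : ℕ} (hb : b < T) (hB : b + 1 = (B + 1) * 3 ^ e) :
    rowVal e z (absorb e (x b) (s b) f) =
      horner e z (rowVal e z fun j => (x 0 j).seed) (fun t => s (B * 3 ^ e + t) f) (3 ^ e / e) := by
  obtain ⟨m, hm⟩ := hd
  have hmpos : 0 < m := by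
    rcases Nat.eq_zero_or_pos m with rfl | h
    · have : 0 < 3 ^ e := by positivity
      omega
    · exact h
  obtain ⟨q, rfl⟩ : ∃ q, m = q + 1 := ⟨m - 1, by omega⟩
  have hm' : 3 ^ e = q * e + e := by rw [hm]; ring
  have hb' : b = B * 3 ^ e + (q * e + (e - 1)) := by
    have : (B + 1) * 3 ^ e = B * 3 ^ e + 3 ^ e := by ring
    omega
  have hbe : b % e = e - 1 := by
    rw [hb', hm, show B * (e * (q + 1)) + (q * e + (e - 1)) = (e - 1) + (B * (q + 1) + q) * e by ring,
      Nat.add_mul_mod_self_right, Nat.mod_eq_of_lt (by omega)]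
  obtain ⟨h1, h2⟩ := h.registers hz he ⟨_, hm⟩ f hb B q (e - 1) hb' (by omega) (by omega)
  rw [h.rowVal_absorb he hb, h1, h2, hbe, show 3 ^ e / e = q + 1 by
    rw [hm, Nat.mul_div_cancel_left _ he], horner]
  have hsum : ∀ v : ℕ → Fq, rowVal e z v =
      rowVal (e - 1) z v + algebraMap Fq K (v (e - 1)) * z ^ (e - 1) := by
    intro v
    obtain ⟨d, hd⟩ : ∃ d, e = d + 1 := ⟨e - 1, by omega⟩
    rw [hd, Nat.add_sub_cancel, rowVal, Finset.sum_range_succ, rowVal]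
  rw [hsum fun j => (x 0 j).seed, hsum fun i => s (B * 3 ^ e + (q * e + i)) f, ← hb']
  ring

/-- The stored hash is overwritten only when the counter wraps, so it survives through the whole
next parent row, at whose end it is needed. -/
theorem RowRun.ret_eq (h : RowRun e T x s) {b B : ℕ} {t : ℕ} (ht : t < 3 ^ e)
    (hb : (B + 1) * 3 ^ e + t < T) (hB : b + 1 = (B + 1) * 3 ^ e) {j : ℕ} (hj : j < e) :
    (x ((B + 1) * 3 ^ e + t) j).ret = absorb e (x b) (s b) (.inl true) j := by
  induction t with
  | zero =>
    rw [add_zero, ← hB, h.step b (by omega) j hj]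
    exact if_pos ((h.rowTop_iff (by omega)).2 ⟨B + 1, by rw [hB]; ring⟩)
  | succ t ih =>
    rw [← add_assoc, h.step _ (by omega) j hj, ← ih (by omega) (by omega)]
    refine if_neg ?_
    rw [h.rowTop_iff (by omega), add_assoc, Nat.dvd_add_right (Dvd.intro_left _ rfl)]
    exact fun hdv => absurd (Nat.le_of_dvd (by omega) hdv) (by omega)

end Hash

end Rows

/-! ### Hashing -/

section

open Polynomial

/-! ### The hash field and collisions of polynomials -/

section HashField

/-- As `2` is not a cube modulo `139`, the polynomial `X ^ 3 ^ a - 2` is irreducible, and the powers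
of its root below the degree are linearly independent. This is why widths are powers of `3`. -/
theorem exists_hashField (a : ℕ) : ∃ (K : Type) (_ : Field K) (_ : Algebra Fq K) (z : K),
    z ^ 3 ^ a = 2 ∧ ∀ v : ℕ → Fq, rowVal (3 ^ a) z v = 0 → ∀ j < 3 ^ a, v j = 0 := by
  have hcube : ∀ b : Fq, b ^ 3 ≠ 2 := by
    set_option maxRecDepth 20000 in decide
  have hirr : Irreducible (X ^ 3 ^ a - C 2 : Fq[X]) :=
    X_pow_sub_C_irreducible_of_prime_pow Nat.prime_three (by norm_num) a hcube
  have := Fact.mk hirr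
  refine ⟨AdjoinRoot (X ^ 3 ^ a - C 2 : Fq[X]), inferInstance, inferInstance,
    AdjoinRoot.root _, ?_, ?_⟩
  · rw [root_X_pow_sub_C_pow]; exact map_ofNat (AdjoinRoot.of _) 2
  · intro v hv j hj
    let p : Fq[X] := ∑ i ∈ Finset.range (3 ^ a), C (v i) * X ^ i
    have hp : AdjoinRoot.mk (X ^ 3 ^ a - C 2 : Fq[X]) p = 0 := by
      rw [← hv]
      simp [p, rowVal, AdjoinRoot.algebraMap_eq]
    have hdeg : p.degree < (X ^ 3 ^ a - C 2 : Fq[X]).degree := by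
      rw [degree_X_pow_sub_C (by positivity)]
      refine (degree_sum_le _ _).trans_lt ?_
      rw [Finset.sup_lt_iff (by exact WithBot.bot_lt_coe _)]
      intro i hi
      exact (degree_C_mul_X_pow_le _ _).trans_lt (by exact_mod_cast Finset.mem_range.1 hi)
    have hp0 : p = 0 := eq_zero_of_dvd_of_degree_lt (AdjoinRoot.mk_eq_zero.1 hp) hdeg
    have : p.coeff j = v j := by
      simp [p, coeff_C_mul, coeff_X_pow, hj]
    rw [← this, hp0, coeff_zero]

variable {K : Type} [Field K] [Algebra Fq K] {z : K} {e : ℕ}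

theorem rowVal_sub (v w : ℕ → Fq) :
    rowVal e z (fun j => v j - w j) = rowVal e z v - rowVal e z w := by
  simp [rowVal, sub_mul, Finset.sum_sub_distrib]

/-- The Horner scheme as a polynomial in the multiplier. -/
noncomputable def hornerPoly (e : ℕ) (z : K) (S : ℕ → Fq) : ℕ → K[X]
  | 0 => 0
  | q + 1 => hornerPoly e z S q * X + C (rowVal e z fun i => S (q * e + i))

theorem eval_hornerPoly (r : K) (S : ℕ → Fq) (q : ℕ) :
    (hornerPoly e z S q).eval r = horner e z r S q := by
  induction q with
  | zero => simp [hornerPoly, horner]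
  | succ q ih => simp [hornerPoly, horner, ih]

theorem degree_hornerPoly_lt (S : ℕ → Fq) (q : ℕ) : (hornerPoly e z S q).degree < q := by
  induction q with
  | zero => simp [hornerPoly]
  | succ q ih =>
    refine (degree_add_le _ _).trans_lt (max_lt ?_ (degree_C_le.trans_lt ?_))
    · rw [degree_mul, degree_X]
      push_cast
      exact WithBot.add_lt_add_right (by simp) ih
    · exact_mod_cast Nat.succ_pos q

theorem horner_sub (r : K) (S S' : ℕ → Fq) (q : ℕ) :
    horner e z r (fun t => S t - S' t) q = horner e z r S q - horner e z r S' q := by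
  induction q with
  | zero => simp [horner]
  | succ q ih => rw [horner, horner, horner, ih, rowVal_sub]; ring

/-- The coefficients of the polynomial are the pieces of the stream, and a piece is determined by
its value. -/
theorem hornerPoly_eq_zero (hz : ∀ v : ℕ → Fq, rowVal e z v = 0 → ∀ j < e, v j = 0)
    {S : ℕ → Fq} {q : ℕ} (h : hornerPoly e z S q = 0) : ∀ t < q * e, S t = 0 := by
  induction q with
  | zero => intro t ht; omega
  | succ q ih =>
    rw [hornerPoly] at h
    have h0 : rowVal e z (fun i => S (q * e + i)) = 0 := by
      simpa using congrArg (fun p => p.coeff 0) h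
    rw [h0, C_0, add_zero, mul_eq_zero, or_iff_left X_ne_zero] at h
    intro t ht
    rcases Nat.lt_or_ge t (q * e) with h1 | h1
    · exact ih h t h1
    · have := hz _ h0 (t - q * e) (by have : (q + 1) * e = q * e + e := by ring
                                      omega)
      rwa [show q * e + (t - q * e) = t by omega] at this

/-- Distinct streams collide for few multipliers. -/
theorem card_horner_collision_le (hz : ∀ v : ℕ → Fq, rowVal e z v = 0 → ∀ j < e, v j = 0)
    {S S' : ℕ → Fq} {q : ℕ} (hS : ∃ t < q * e, S t ≠ S' t) {ι : Type*} (A : Finset ι) {r : ι → K}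
    (hr : Function.Injective r) (hA : ∀ a ∈ A, horner e z (r a) S q = horner e z (r a) S' q) :
    A.card ≤ q := by
  classical
  let p := hornerPoly e z (fun t => S t - S' t) q
  have hp : p ≠ 0 := by
    intro h
    obtain ⟨t, ht, hne⟩ := hS
    exact hne (sub_eq_zero.1 (hornerPoly_eq_zero hz h t ht))
  have hsub : A.image r ⊆ p.roots.toFinset := by
    intro y hy
    obtain ⟨a, ha, rfl⟩ := Finset.mem_image.1 hy
    rw [Multiset.mem_toFinset, mem_roots hp, IsRoot, eval_hornerPoly, horner_sub, hA a ha, sub_self]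
  calc A.card = (A.image r).card := (Finset.card_image_of_injective _ hr).symm
    _ ≤ p.roots.toFinset.card := Finset.card_le_card hsub
    _ ≤ Multiset.card p.roots := Multiset.toFinset_card_le _
    _ ≤ p.natDegree := card_roots' _
    _ ≤ q := natDegree_le_of_degree_le (degree_hornerPoly_lt _ _).le

end HashField

/-! ### Random points, random linear forms, and fingerprints -/

section Coins

/-- The value of a block of seven coins. -/
noncomputable def coinVal : (Fin 7 → Bool) ↪ Fq :=
  -- Seven coins have `128 ≤ 139` outcomes.
  Classical.choice (Function.Embedding.nonempty_of_card_le (by simp [ZMod.card]))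

/-- The row of values of `e` blocks of coins. -/
noncomputable def coinRow {e : ℕ} (a : Fin e → Fin 7 → Bool) (j : ℕ) : Fq :=
  if h : j < e then coinVal (a ⟨j, h⟩) else 0

variable {K : Type} [Field K] [Algebra Fq K] {z : K} {e : ℕ}

theorem rowVal_coinRow_injective (hz : ∀ v : ℕ → Fq, rowVal e z v = 0 → ∀ j < e, v j = 0) :
    Function.Injective fun a : Fin e → Fin 7 → Bool => rowVal e z (coinRow a) := by
  intro a b hab
  ext1 j
  have := hz (fun j => coinRow a j - coinRow b j) (by rw [rowVal_sub]; exact sub_eq_zero.2 hab) j j.2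
  simp only [coinRow, j.2, dite_true, Fin.eta] at this
  exact coinVal.injective (sub_eq_zero.1 this)

/-- A nonzero linear form vanishes on at most `1 / 128` of the coin rows. -/
theorem card_linear_zero_le {D : ℕ → Fq} {j : ℕ} (hj : j < e) (hD : D j ≠ 0)
    (A : Finset (Fin e → Fin 7 → Bool))
    (hA : ∀ p ∈ A, ∑ i ∈ Finset.range e, coinRow p i * D i = 0) :
    A.card * 128 ≤ 128 ^ e := by
  classical
  -- the elements of `A` are determined by their values off `j`
  let g : (Fin e → Fin 7 → Bool) → ({i : Fin e // i ≠ ⟨j, hj⟩} → Fin 7 → Bool) :=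
    fun p i => p i
  have hg : Set.InjOn g (A : Set (Fin e → Fin 7 → Bool)) := by
    intro p hp p' hp' hpp
    have hoff : ∀ i : Fin e, i ≠ ⟨j, hj⟩ → p i = p' i := fun i hi => congrFun hpp ⟨i, hi⟩
    have hsplit : ∀ p : Fin e → Fin 7 → Bool, ∑ i ∈ Finset.range e, coinRow p i * D i =
        coinRow p j * D j + ∑ i ∈ (Finset.range e).erase j, coinRow p i * D i := fun p =>
      (Finset.add_sum_erase _ _ (Finset.mem_range.2 hj)).symm
    have h1 := hA p hp
    have h2 := hA p' hp'
    rw [hsplit] at h1 h2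
    have h3 : ∑ i ∈ (Finset.range e).erase j, coinRow p i * D i =
        ∑ i ∈ (Finset.range e).erase j, coinRow p' i * D i := by
      refine Finset.sum_congr rfl fun i hi => ?_
      have hi' := Finset.mem_erase.1 hi
      have hie := Finset.mem_range.1 hi'.2
      simp only [coinRow, hie, dite_true]
      rw [hoff ⟨i, hie⟩ (by simpa [Fin.ext_iff] using hi'.1)]
    rw [h3, ← h2, add_left_inj] at h1
    have h4 := mul_right_cancel₀ hD h1
    simp only [coinRow, hj, dite_true] at h4
    ext1 i
    by_cases hi : i = ⟨j, hj⟩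
    · rw [hi]; exact coinVal.injective h4
    · exact hoff i hi
  have hcard := Finset.card_le_card_of_injOn g (t := Finset.univ) (fun _ _ => Finset.mem_univ _) hg
  have : (Finset.univ : Finset ({i : Fin e // i ≠ ⟨j, hj⟩} → Fin 7 → Bool)).card = 128 ^ (e - 1) := by
    rw [Finset.card_univ, Fintype.card_fun, Fintype.card_subtype_compl]
    simp
  rw [this] at hcard
  calc A.card * 128 ≤ 128 ^ (e - 1) * 128 := Nat.mul_le_mul_right _ hcard
    _ = 128 ^ e := by rw [← pow_succ, Nat.sub_add_cancel (by omega)]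

/-- The streams `S` and `S'` are different, but the multiplier with coordinates `a` or the linear
form with coordinates `p` does not separate them. -/
def FingerprintCollision (e : ℕ) (z : K) (q : ℕ) (S S' : ℕ → Fq) (a p : ℕ → Fq) : Prop :=
  (∃ t < q * e, S t ≠ S' t) ∧
    (horner e z (rowVal e z a) S q = horner e z (rowVal e z a) S' q ∨
      ∃ w w' : ℕ → Fq, rowVal e z w = horner e z (rowVal e z a) S q ∧
        rowVal e z w' = horner e z (rowVal e z a) S' q ∧ (∃ j < e, w j ≠ w' j) ∧
        ∑ i ∈ Finset.range e, p i * w i = ∑ i ∈ Finset.range e, p i * w' i)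

open Classical in
-- Two sources of error: the multiplier is one of at most `q` points at which the two polynomials
-- agree, or the hashes differ and the linear form vanishes on their nonzero difference, which
-- happens for at most a fraction `1 / 128` of the forms.
theorem card_fingerprintCollision_le (hz : ∀ v : ℕ → Fq, rowVal e z v = 0 → ∀ j < e, v j = 0)
    (q : ℕ) (S S' : ℕ → Fq) :
    (Finset.univ.filter fun c : (Fin e → Fin 7 → Bool) × (Fin e → Fin 7 → Bool) =>
      FingerprintCollision e z q S S' (coinRow c.1) (coinRow c.2)).card * 128 ≤
        (128 * q + 128 ^ e) * 128 ^ e := by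
  by_cases hS : ∃ t < q * e, S t ≠ S' t
  swap
  · simp [FingerprintCollision, hS]
  let A : Finset (Fin e → Fin 7 → Bool) := Finset.univ.filter fun a =>
    horner e z (rowVal e z (coinRow a)) S q = horner e z (rowVal e z (coinRow a)) S' q
  let B : (Fin e → Fin 7 → Bool) → Finset (Fin e → Fin 7 → Bool) := fun a =>
    Finset.univ.filter fun p => ∃ w w' : ℕ → Fq, rowVal e z w = horner e z (rowVal e z (coinRow a)) S q ∧
        rowVal e z w' = horner e z (rowVal e z (coinRow a)) S' q ∧ (∃ j < e, w j ≠ w' j) ∧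
        ∑ i ∈ Finset.range e, coinRow p i * w i = ∑ i ∈ Finset.range e, coinRow p i * w' i
  have hA : A.card ≤ q := card_horner_collision_le hz hS A (rowVal_coinRow_injective hz)
    fun a ha => (Finset.mem_filter.1 ha).2
  have hB : ∀ a, (B a).card * 128 ≤ 128 ^ e := by
    intro a
    rcases (B a).eq_empty_or_nonempty with h0 | ⟨p0, hp0⟩
    · simp [h0]
    -- Coordinates of a field element are unique, so the witnesses of one member of `B a` serve for
    -- all of them.
    obtain ⟨w, w', hw, hw', ⟨j, hj, hne⟩, -⟩ := (Finset.mem_filter.1 hp0).2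
    refine card_linear_zero_le hj (D := fun i => w i - w' i) (sub_ne_zero.2 hne) (B a) ?_
    intro p hp
    obtain ⟨v, v', hv, hv', -, hsum⟩ := (Finset.mem_filter.1 hp).2
    have e1 : ∀ i < e, v i - w i = 0 :=
      hz (fun i => v i - w i) (by rw [rowVal_sub, hv, hw, sub_self])
    have e2 : ∀ i < e, v' i - w' i = 0 :=
      hz (fun i => v' i - w' i) (by rw [rowVal_sub, hv', hw', sub_self])
    rw [← sub_eq_zero, ← Finset.sum_sub_distrib] at hsum
    rw [← hsum]
    refine Finset.sum_congr rfl fun i hi => ?_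
    rw [← sub_eq_zero.1 (e1 i (Finset.mem_range.1 hi)), ← sub_eq_zero.1 (e2 i (Finset.mem_range.1 hi))]
    ring
  have hcardQ : Fintype.card (Fin e → Fin 7 → Bool) = 128 ^ e := by
    simp
  have hsub : (Finset.univ.filter fun c : (Fin e → Fin 7 → Bool) × (Fin e → Fin 7 → Bool) =>
      FingerprintCollision e z q S S' (coinRow c.1) (coinRow c.2)) ⊆
        A ×ˢ Finset.univ ∪ Finset.univ.biUnion fun a => ({a} : Finset _) ×ˢ B a := by
    intro c hc
    obtain ⟨-, h | h⟩ := (Finset.mem_filter.1 hc).2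
    · exact Finset.mem_union_left _ (by simp [A, h])
    · refine Finset.mem_union_right _ (Finset.mem_biUnion.2 ⟨c.1, Finset.mem_univ _, ?_⟩)
      simp only [Finset.mem_product, Finset.mem_singleton, true_and, B, Finset.mem_filter,
        Finset.mem_univ]
      exact h
  calc _ ≤ (A ×ˢ Finset.univ ∪ Finset.univ.biUnion fun a =>
          ({a} : Finset (Fin e → Fin 7 → Bool)) ×ˢ B a).card * 128 :=
        Nat.mul_le_mul_right _ (Finset.card_le_card hsub)
    _ ≤ (q * 128 ^ e + ∑ a : Fin e → Fin 7 → Bool, (B a).card) * 128 := by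
        refine Nat.mul_le_mul_right _ ((Finset.card_union_le _ _).trans (add_le_add ?_ ?_))
        · rw [Finset.card_product, Finset.card_univ, hcardQ]
          exact Nat.mul_le_mul_right _ hA
        · refine Finset.card_biUnion_le.trans (Finset.sum_le_sum fun a _ => ?_)
          simp
    _ = q * 128 ^ e * 128 + ∑ a : Fin e → Fin 7 → Bool, (B a).card * 128 := by
        rw [add_mul, Finset.sum_mul]
    _ ≤ q * 128 ^ e * 128 + ∑ _a : Fin e → Fin 7 → Bool, 128 ^ e :=
        Nat.add_le_add_left (Finset.sum_le_sum fun a _ => hB a) _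
    _ = (128 * q + 128 ^ e) * 128 ^ e := by
        rw [Finset.sum_const, Finset.card_univ, hcardQ, smul_eq_mul]; ring

end Coins

end

/-! ### Labels -/

/-- The data that all cells of a row share: the selected coordinate of the multiplier, the mark and
the registers of the last cell, whether the counter is at its maximum, whether the row is the first
of its level, the colors of the row and of its slots, the comparison of its slots with its counter,
and the fingerprints of the parent row. -/
structure RowInfo where
  sel : Fq
  wrapMark : Fq
  wrapPow : Fam → Fq
  top : Bool
  first : Bool
  color : Fin 9
  slotColor : Fin 4 → Fin 9
  dir : Fin 4 → Ordering
  fp : Option (Fin 4) → Fq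

/-- The partial results of the computations that run along a row. -/
structure RowState where
  sel : Fq
  carry : Bool
  cmp : Fin 4 → Ordering
  fp : Option (Fin 4) → Fq

/-- The label of a cell: its content, the content of the cell below it in the next row, a digit of
each slot, and the data used to verify the row. -/
structure CellLabel where
  cur : Cell
  nxt : Cell
  slot : Fin 4 → Fin 3
  info : RowInfo
  state : RowState

/-- The label of a node in one round: a full row (used at level `0`; the other levels use its first
cell only), the index of the symbol of the cell that is being absorbed, and whether the node
repeats the labels of its predecessor. -/
structure Label where
  cells : Fin 9 → CellLabel
  io : Fin 27
  stut : Bool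

section Finite

instance Cell.finite : Finite Cell :=
  Finite.of_injective (fun c : Cell => (c.seed, c.proj, c.mark, c.ret, c.digit, c.pow, c.acc)) <| by
    rintro ⟨⟩ ⟨⟩ h; simpa using h

instance Ordering.finite : Finite Ordering :=
  Finite.of_injective (fun o : Ordering => (o.isLT, o.isGT)) <| by
    intro a b; cases a <;> cases b <;> simp

instance RowInfo.finite : Finite RowInfo :=
  Finite.of_injective (fun c : RowInfo => (c.sel, c.wrapMark, c.wrapPow, c.top, c.first, c.color,
    c.slotColor, c.dir, c.fp)) <| by
    rintro ⟨⟩ ⟨⟩ h; simpa using h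

instance RowState.finite : Finite RowState :=
  Finite.of_injective (fun c : RowState => (c.sel, c.carry, c.cmp, c.fp)) <| by
    rintro ⟨⟩ ⟨⟩ h; simpa using h

instance CellLabel.finite : Finite CellLabel :=
  Finite.of_injective (fun c : CellLabel => (c.cur, c.nxt, c.slot, c.info, c.state)) <| by
    rintro ⟨⟩ ⟨⟩ h; simpa using h

instance Label.finite : Finite Label :=
  Finite.of_injective (fun c : Label => (c.cells, c.io, c.stut)) <| by
    rintro ⟨⟩ ⟨⟩ h; simpa using h

end Finite

namespace CellLabel

/-- The accumulators of a cell after the symbol `s` has been absorbed. -/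
def absorbed (s : Fam → Fq) (l : CellLabel) (f : Fam) : Fq :=
  l.cur.acc f + l.info.sel * l.cur.pow f + s f * l.cur.mark

/-- The partial results after the cell `l`. -/
def update (s : Fam → Fq) (l : CellLabel) : RowState where
  sel := l.state.sel + l.cur.mark * l.cur.seed
  carry := l.state.carry && decide (l.cur.digit = 2)
  cmp k := if (l.slot k : ℕ) < l.cur.digit.val then .lt
    else if l.cur.digit.val < (l.slot k : ℕ) then .gt else l.state.cmp k
  fp o := l.state.fp o + l.cur.proj * l.absorbed s (.inr o)

/-- The next content of `l` is correct, given the mark and the registers that move into it, and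
the hash of the current content of the parent row agrees with the stored one. -/
def NextOK (s : Fam → Fq) (mark : Fq) (pow : Fam → Fq) (l : CellLabel) : Prop :=
  l.nxt = { seed := l.cur.seed
            proj := l.cur.proj
            mark := mark
            ret := if l.info.top then l.absorbed s (.inl true) else l.cur.ret
            digit := if l.state.carry then (if l.cur.digit = 2 then 0 else l.cur.digit + 1)
              else l.cur.digit
            pow := fun f => if l.info.top then 0 else if l.info.wrapMark = 1 then l.absorbed s f
              else pow f
            acc := fun f => if l.info.wrapMark = 1 then 0 else l.absorbed s f } ∧
    (l.info.top → l.absorbed s (.inl false) = l.cur.ret)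

/-- The conditions on the first cell of a row. -/
def First (s : Fam → Fq) (l : CellLabel) : Prop :=
  l.state = ⟨0, true, fun _ => .eq, fun _ => 0⟩ ∧
    l.NextOK s l.info.wrapMark fun f => 2 * l.info.wrapPow f

/-- The conditions on two consecutive cells of a row. -/
def InRow (s : Fam → Fq) (l l' : CellLabel) : Prop :=
  l'.info = l.info ∧ l'.state = l.update s ∧ l'.NextOK s l.cur.mark l.cur.pow

/-- The conditions on the last cell of a row. -/
def Last (s : Fam → Fq) (l : CellLabel) : Prop :=
  l.info.wrapMark = l.cur.mark ∧ l.info.wrapPow = l.cur.pow ∧ l.info.sel = (l.update s).sel ∧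
    l.info.top = (l.update s).carry ∧ l.info.dir = (l.update s).cmp ∧
    (l.info.top → l.info.fp = (l.update s).fp)

end CellLabel

/-- A correctly labelled row of `e` cells. -/
structure RowOK (e : ℕ) (s : Fam → Fq) (lab : ℕ → CellLabel) : Prop where
  first : (lab 0).First s
  inRow : ∀ j, j + 1 < e → (lab j).InRow s (lab (j + 1))
  last : (lab (e - 1)).Last s

/-- The comparison of two numbers by their digits. -/
def cmpDigits (a b : ℕ → ℕ) : ℕ → Ordering
  | 0 => .eq
  | j + 1 => if a j < b j then .lt else if b j < a j then .gt else cmpDigits a b j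

/-- The number with the given base-`3` digits. -/
def ofDigits (e : ℕ) (a : ℕ → ℕ) : ℕ := ∑ j ∈ Finset.range e, a j * 3 ^ j

theorem ofDigits_lt {e : ℕ} {a : ℕ → ℕ} (ha : ∀ j < e, a j < 3) : ofDigits e a < 3 ^ e := by
  induction e with
  | zero => simp [ofDigits]
  | succ e ih =>
    have h1 := ih fun j hj => ha j (by omega)
    have h2 : a e * 3 ^ e ≤ 2 * 3 ^ e := Nat.mul_le_mul_right _ (by have := ha e (by omega); omega)
    rw [ofDigits, Finset.sum_range_succ, pow_succ]
    rw [ofDigits] at h1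
    omega

/-- Digits are read upwards from the least significant one, so a later difference overrides all
earlier ones. -/
theorem cmpDigits_eq {a b : ℕ → ℕ} {e : ℕ} (ha : ∀ j < e, a j < 3) (hb : ∀ j < e, b j < 3) :
    cmpDigits a b e = compare (ofDigits e a) (ofDigits e b) := by
  induction e with
  | zero => simp [cmpDigits, ofDigits]
  | succ e ih =>
    have ih := ih (fun j hj => ha j (by omega)) (fun j hj => hb j (by omega))
    have h1 := ofDigits_lt fun j (hj : j < e) => ha j (by omega)
    have h2 := ofDigits_lt fun j (hj : j < e) => hb j (by omega)
    have ea : ofDigits (e + 1) a = ofDigits e a + a e * 3 ^ e := Finset.sum_range_succ _ _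
    have eb : ofDigits (e + 1) b = ofDigits e b + b e * 3 ^ e := Finset.sum_range_succ _ _
    have hmul : ∀ u v : ℕ, u < v → u * 3 ^ e + 3 ^ e ≤ v * 3 ^ e := fun u v huv => by
      have : (u + 1) * 3 ^ e ≤ v * 3 ^ e := Nat.mul_le_mul_right _ huv
      linarith
    rw [cmpDigits]
    split_ifs with h3 h4
    · have := hmul _ _ h3
      exact (Nat.compare_eq_lt.2 (by omega)).symm
    · have := hmul _ _ h4
      exact (Nat.compare_eq_gt.2 (by omega)).symm
    · rw [ih, ea, eb, show a e = b e by omega]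
      rcases lt_trichotomy (ofDigits e a) (ofDigits e b) with h | h | h
      · rw [Nat.compare_eq_lt.2 h, Nat.compare_eq_lt.2 (by omega)]
      · rw [Nat.compare_eq_eq.2 h, Nat.compare_eq_eq.2 (by omega)]
      · rw [Nat.compare_eq_gt.2 h, Nat.compare_eq_gt.2 (by omega)]

theorem ofDigits_div_mod (e b : ℕ) : ofDigits e (fun j => b / 3 ^ j % 3) = b % 3 ^ e := by
  induction e with
  | zero => simp [ofDigits, Nat.mod_one]
  | succ e ih =>
    rw [ofDigits] at ih
    rw [ofDigits, Finset.sum_range_succ, ih, pow_succ, Nat.mod_mul, mul_comm]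

open Classical in
/-- The partial results of the computations along the row `x` before the cell `j`. -/
noncomputable def rowState (x : ℕ → Cell) (s : Fam → Fq) (sel : Fq) (slot : ℕ → Fin 4 → Fin 3)
    (j : ℕ) : RowState where
  sel := ∑ i ∈ Finset.range j, (x i).mark * (x i).seed
  carry := decide (∀ i < j, (x i).digit = 2)
  cmp k := cmpDigits (fun i => slot i k) (fun i => (x i).digit.val) j
  fp o := ∑ i ∈ Finset.range j,
    (x i).proj * ((x i).acc (.inr o) + sel * (x i).pow (.inr o) + s (.inr o) * (x i).mark)

theorem rowState_succ {x : ℕ → Cell} {s : Fam → Fq} {slot : ℕ → Fin 4 → Fin 3} {l : CellLabel}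
    {j : ℕ} (hcur : l.cur = x j) (hslot : l.slot = slot j)
    (hstate : l.state = rowState x s l.info.sel slot j) :
    l.update s = rowState x s l.info.sel slot (j + 1) := by
  simp only [CellLabel.update, rowState, hstate, hcur, hslot, CellLabel.absorbed,
    Finset.sum_range_succ, cmpDigits, RowState.mk.injEq, true_and, and_true]
  rw [Bool.eq_iff_iff]
  simp only [Bool.and_eq_true, decide_eq_true_eq]
  constructor
  · rintro ⟨h1, h2⟩ i hi
    rcases Nat.lt_succ_iff_lt_or_eq.1 hi with h | rfl
    exacts [h1 i h, h2]
  · exact fun h => ⟨fun i hi => h i (by omega), h j (by omega)⟩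

/-! ### What the local tests of a row enforce -/

section RowOK

variable {e : ℕ} {s : Fam → Fq} {lab : ℕ → CellLabel}

theorem RowOK.info_eq (h : RowOK e s lab) {j : ℕ} (hj : j < e) : (lab j).info = (lab 0).info := by
  induction j with
  | zero => rfl
  | succ j ih => exact (h.inRow j hj).1.trans (ih (by omega))

theorem RowOK.state_eq (h : RowOK e s lab) {j : ℕ} (hj : j < e) :
    (lab j).state = rowState (fun j => (lab j).cur) s (lab j).info.sel (fun j => (lab j).slot) j := by
  induction j with
  | zero => rw [h.first.1]; simp [rowState, cmpDigits]
  | succ j ih =>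
    rw [(h.inRow j hj).2.1, (h.inRow j hj).1]
    exact rowState_succ rfl rfl (ih (by omega))

theorem RowOK.update_last (h : RowOK e s lab) (he : 0 < e) : (lab (e - 1)).update s =
    rowState (fun j => (lab j).cur) s (lab 0).info.sel (fun j => (lab j).slot) e := by
  have := rowState_succ (x := fun j => (lab j).cur) (slot := fun j => (lab j).slot) rfl rfl
    (h.state_eq (j := e - 1) (by omega))
  rw [h.info_eq (by omega), Nat.sub_add_cancel he] at this
  exact this

/-- The claimed value is shared by all cells through `info` and compared at the last cell with the
total accumulated in `state`. The same scheme certifies `top`, `dir` and `fp`. -/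
theorem RowOK.sel_eq (h : RowOK e s lab) (he : 0 < e) :
    (lab 0).info.sel = ∑ i ∈ Finset.range e, (lab i).cur.mark * (lab i).cur.seed := by
  have := h.last.2.2.1
  rwa [h.update_last he, h.info_eq (by omega)] at this

theorem RowOK.absorbed_eq (h : RowOK e s lab) (he : 0 < e) {j : ℕ} (hj : j < e) (f : Fam) :
    (lab j).absorbed s f = absorb e (fun j => (lab j).cur) s f j := by
  rw [CellLabel.absorbed, absorb, h.info_eq hj, h.sel_eq he]

theorem RowOK.top_iff (h : RowOK e s lab) (he : 0 < e) :
    (lab 0).info.top = true ↔ RowTop e fun j => (lab j).cur := by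
  have := h.last.2.2.2.1
  rw [h.update_last he, h.info_eq (by omega)] at this
  rw [this, rowState]
  exact decide_eq_true_iff

theorem RowOK.nxt_eq (h : RowOK e s lab) (he : 0 < e) {j : ℕ} (hj : j < e) :
    (lab j).nxt = nextRow e (fun j => (lab j).cur) s j := by
  have hw1 : (lab 0).info.wrapMark = (lab (e - 1)).cur.mark := by
    rw [← h.last.1, h.info_eq (j := e - 1) (by omega)]
  have hw2 : (lab 0).info.wrapPow = (lab (e - 1)).cur.pow := by
    rw [← h.last.2.1, h.info_eq (j := e - 1) (by omega)]
  have hc : (lab j).state.carry = true ↔ ∀ i < j, (lab i).cur.digit = 2 := by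
    rw [h.state_eq hj, rowState]
    exact decide_eq_true_iff
  have key : ∀ mark pow, (lab j).NextOK s mark pow →
      mark = (if j = 0 then (lab (e - 1)).cur.mark else (lab (j - 1)).cur.mark) →
      (∀ f, pow f = if j = 0 then 2 * (lab (e - 1)).cur.pow f else (lab (j - 1)).cur.pow f) →
      (lab j).nxt = nextRow e (fun j => (lab j).cur) s j := by
    intro mark pow hn hm hp
    rw [hn.1, nextRow]
    by_cases ht : RowTop e fun j => (lab j).cur
    · simp only [h.absorbed_eq he hj, h.info_eq hj, (h.top_iff he).2 ht, hc, ht, if_true]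
      simp only [hw1, hm]
    · have ht' : (lab 0).info.top = false := by
        rw [← Bool.not_eq_true, h.top_iff he]; exact ht
      simp only [h.absorbed_eq he hj, h.info_eq hj, ht', hc, hw1, hm, hp, ht, if_false,
        Bool.false_eq_true]
  rcases j with _ | j
  · exact key _ _ h.first.2 (by simp [hw1]) (by simp [hw2])
  · exact key _ _ (h.inRow j hj).2.2 (by simp) (by simp)

theorem RowOK.ret_eq (h : RowOK e s lab) (he : 0 < e) (ht : RowTop e fun j => (lab j).cur) {j : ℕ}
    (hj : j < e) : absorb e (fun j => (lab j).cur) s (.inl false) j = (lab j).cur.ret := by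
  rw [← h.absorbed_eq he hj]
  have ht' : (lab j).info.top = true := by rw [h.info_eq hj, h.top_iff he]; exact ht
  rcases j with _ | j
  · exact h.first.2.2 ht'
  · exact (h.inRow j hj).2.2.2 ht'

theorem RowOK.fp_eq (h : RowOK e s lab) (he : 0 < e) (ht : RowTop e fun j => (lab j).cur)
    (o : Option (Fin 4)) : (lab 0).info.fp o =
      ∑ i ∈ Finset.range e, (lab i).cur.proj * absorb e (fun j => (lab j).cur) s (.inr o) i := by
  have := h.last.2.2.2.2.2 (by rw [h.info_eq (by omega), h.top_iff he]; exact ht)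
  rw [h.update_last he, h.info_eq (by omega)] at this
  rw [this, rowState]
  simp only [absorb, h.sel_eq he]

theorem RowOK.dir_eq (h : RowOK e s lab) (he : 0 < e) (k : Fin 4) : (lab 0).info.dir k =
    cmpDigits (fun i => (lab i).slot k) (fun i => (lab i).cur.digit.val) e := by
  have := h.last.2.2.2.2.1
  rw [h.update_last he, h.info_eq (by omega)] at this
  rw [this, rowState]

end RowOK

open Classical in
/-- The correct labels of the row `x`. -/
noncomputable def rowLabel (e : ℕ) (x : ℕ → Cell) (s : Fam → Fq) (slot : ℕ → Fin 4 → Fin 3)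
    (first : Bool) (color : Fin 9) (slotColor : Fin 4 → Fin 9) (fp : Option (Fin 4) → Fq) (j : ℕ) :
    CellLabel where
  cur := x j
  nxt := nextRow e x s j
  slot := slot j
  info :=
    { sel := ∑ i ∈ Finset.range e, (x i).mark * (x i).seed
      wrapMark := (x (e - 1)).mark
      wrapPow := (x (e - 1)).pow
      top := decide (RowTop e x)
      first := first
      color := color
      slotColor := slotColor
      dir := fun k => cmpDigits (fun i => slot i k) (fun i => (x i).digit.val) e
      fp := fp }
  state := rowState x s (∑ i ∈ Finset.range e, (x i).mark * (x i).seed) slot j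

open Classical in
-- All tests hold by construction except the two at the end of a parent row, on the stored hash and
-- on the fingerprints, which are therefore hypotheses.
theorem rowOK_rowLabel {e : ℕ} (he : 0 < e) {x : ℕ → Cell} {s : Fam → Fq}
    {slot : ℕ → Fin 4 → Fin 3} {first : Bool} {color : Fin 9} {slotColor : Fin 4 → Fin 9}
    {fp : Option (Fin 4) → Fq}
    (hret : RowTop e x → ∀ j < e, absorb e x s (.inl false) j = (x j).ret)
    (hfp : RowTop e x → ∀ o, fp o = ∑ i ∈ Finset.range e, (x i).proj * absorb e x s (.inr o) i) :
    RowOK e s (rowLabel e x s slot first color slotColor fp) := by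
  have hnext : ∀ j < e, ∀ mark pow,
      mark = (if j = 0 then (x (e - 1)).mark else (x (j - 1)).mark) →
      (∀ f, pow f = if j = 0 then 2 * (x (e - 1)).pow f else (x (j - 1)).pow f) →
      (rowLabel e x s slot first color slotColor fp j).NextOK s mark pow := by
    intro j hj mark pow hm hp
    refine ⟨?_, fun ht => hret (of_decide_eq_true ht) j hj⟩
    by_cases ht : RowTop e x
    · simp only [rowLabel, nextRow, rowState, hm, hp, decide_eq_true_eq, CellLabel.absorbed, absorb,
        ht, if_true]
    · simp only [rowLabel, nextRow, rowState, hm, hp, decide_eq_true_eq, CellLabel.absorbed, absorb,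
        ht, if_false]
  have hupd : ∀ j, (rowLabel e x s slot first color slotColor fp j).update s =
      rowState x s (∑ i ∈ Finset.range e, (x i).mark * (x i).seed) slot (j + 1) :=
    fun j => rowState_succ (l := rowLabel e x s slot first color slotColor fp j) rfl rfl rfl
  refine ⟨⟨?_, hnext 0 he _ _ (by simp [rowLabel]) (by simp [rowLabel])⟩, fun j hj => ⟨rfl, ?_, ?_⟩, ?_⟩
  · simp [rowLabel, rowState, cmpDigits]
  · rw [hupd]; rfl
  · exact hnext (j + 1) hj _ _ (by simp [rowLabel]) (by simp [rowLabel])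
  · rw [CellLabel.Last, hupd, Nat.sub_add_cancel he]
    refine ⟨rfl, rfl, rfl, ?_, rfl, fun ht => ?_⟩
    · rw [Bool.eq_iff_iff]
      refine Iff.trans (b := RowTop e x) ?_ ?_
      · exact @decide_eq_true_iff _ _
      · exact ⟨fun h => decide_eq_true (p := ∀ i < e, (x i).digit = 2) h,
          fun h => of_decide_eq_true (p := ∀ i < e, (x i).digit = 2) h⟩
    ext1 o
    rw [show (rowLabel e x s slot first color slotColor fp (e - 1)).info.fp = fp from rfl,
      hfp (of_decide_eq_true ht) o]
    rfl

/-! ### Verification along the path -/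

/-! ### Cells as strings of symbols -/

section Serial

/-- A cell has 19 entries, five single ones and two for each of the seven streams; the string
repeats some of them to reach length `27`, a power of `3`. -/
theorem exists_cellTag : ∃ f : Fin 27 → Fin 5 ⊕ Bool × Fam, Function.Surjective f := by
  obtain ⟨g⟩ := Function.Embedding.nonempty_of_card_le
    (show Fintype.card (Fin 5 ⊕ Bool × Fam) ≤ Fintype.card (Fin 27) by simp [Fam])
  exact ⟨Function.invFun g, Function.invFun_surjective g.injective⟩

/-- A list of all entries of a cell. -/
noncomputable def cellTag : Fin 27 → Fin 5 ⊕ Bool × Fam := exists_cellTag.choose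

/-- The entry with the given name. -/
def Cell.entry (c : Cell) : Fin 5 ⊕ Bool × Fam → Fq
  | .inl 0 => c.seed
  | .inl 1 => c.proj
  | .inl 2 => c.mark
  | .inl 3 => c.ret
  | .inl 4 => c.digit
  | .inr (false, f) => c.pow f
  | .inr (true, f) => c.acc f

/-- The content of a cell as a string of `27` symbols. -/
noncomputable def Cell.serial (c : Cell) (t : Fin 27) : Fq := c.entry (cellTag t)

theorem Cell.serial_injective {c c' : Cell} (h : ∀ t, c.serial t = c'.serial t) : c = c' := by
  have h' : ∀ a, c.entry a = c'.entry a := fun a => by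
    obtain ⟨t, rfl⟩ := exists_cellTag.choose_spec a
    exact h t
  have h0 := h' (.inl 0)
  have h1 := h' (.inl 1)
  have h2 := h' (.inl 2)
  have h3 := h' (.inl 3)
  have h4 := h' (.inl 4)
  have h5 := fun f => h' (.inr (false, f))
  have h6 := fun f => h' (.inr (true, f))
  cases c; cases c'
  simp only [Cell.entry] at h0 h1 h2 h3 h4 h5 h6
  simp only [Cell.mk.injEq]
  exact ⟨h0, h1, h2, h3, h4, funext h5, funext h6⟩

end Serial

/-! ### The local tests -/

section Verifier

/-- The symbols that a label hands to the level below. -/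
noncomputable def Label.symbol (l : Label) : Fam → Fq
  | .inl false => (l.cells 0).cur.serial l.io
  | .inl true => (l.cells 0).nxt.serial l.io
  | .inr none => (l.cells 0).cur.digit
  | .inr (some k) => (((l.cells 0).slot k : ℕ) : Fq)

/-- The cell of a level other than `0`. -/
def levelCell (L : ℕ → Label) (i : ℕ) : CellLabel := (L i).cells 0

/-- The symbols that are absorbed by level `i`, if `J` is the highest level. -/
noncomputable def levelSymbol (J : ℕ) (L : ℕ → Label) (i : ℕ) (f : Fam) : Fq :=
  if i < J then (L (i + 1)).symbol f else 0

/-- The node is the last one of its row of level `i`. -/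
def RowEnd (L : ℕ → Label) (i : ℕ) : Prop := ∀ i' < i, (levelCell L i').info.top = true

/-- The content of the cell is initial, with random entries given by the coins `c`. -/
def Cell.Fresh (x : Cell) (first : Prop) (c : Bool → Fq) : Prop :=
  x.IsInitial first ∧ x.seed = c false ∧ x.proj = c true

/-- The conditions on the labels of one node. -/
structure NodeOK (J : ℕ) (L : ℕ → Label) : Prop where
  row : RowOK 9 (levelSymbol J L 0) fun j => (L 0).cells (Fin.ofNat 9 j)
  last : ∀ i < J, RowEnd L (i + 1) →
    (levelCell L (i + 1)).Last (levelSymbol J L (i + 1))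

/-- The conditions on the labels of two consecutive nodes, where `c` is given by the coins of the
second. -/
structure StepOK (J : ℕ) (L L' : ℕ → Label) (c : ℕ → ℕ → Bool → Fq) : Prop where
  next : ∀ j, ((L' 0).cells j).cur = ((L 0).cells j).nxt
  notEnd : ¬ RowEnd L (J + 1)
  fp : ∀ i ≤ J, RowEnd L i → ¬ RowEnd L (i + 1) →
    (levelCell L' i).info.fp = (levelCell L i).info.fp
  keep : ∀ i < J, ¬ RowEnd L i → L' (i + 1) = L (i + 1)
  same : ∀ i < J, RowEnd L i → ¬ RowEnd L (i + 1) → ((L (i + 1)).io : ℕ) < 26 →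
    levelCell L' (i + 1) = levelCell L (i + 1) ∧ ((L' (i + 1)).io : ℕ) = (L (i + 1)).io + 1
  inRow : ∀ i < J, RowEnd L i → ¬ RowEnd L (i + 1) → ¬ ((L (i + 1)).io : ℕ) < 26 →
    (levelCell L (i + 1)).InRow (levelSymbol J L (i + 1)) (levelCell L' (i + 1)) ∧
      (L' (i + 1)).io = 0 ∧ ((levelCell L' (i + 1)).info.first = true →
        (levelCell L' (i + 1)).cur.Fresh False (c (i + 1) 0))
  first : ∀ i < J, RowEnd L (i + 1) →
    (levelCell L' (i + 1)).First (levelSymbol J L' (i + 1)) ∧ (L' (i + 1)).io = 0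

/-- The conditions on the labels of the first node, where `c` is given by its coins. -/
structure InitOK (J : ℕ) (L : ℕ → Label) (c : ℕ → ℕ → Bool → Fq) : Prop where
  first : ∀ i ≤ J, (levelCell L i).info.first = true
  zero : ∀ j : Fin 9, ((L 0).cells j).cur.Fresh (j = 0) (c 0 j)
  succ : ∀ i < J, (levelCell L (i + 1)).First (levelSymbol J L (i + 1)) ∧ (L (i + 1)).io = 0 ∧
    (levelCell L (i + 1)).cur.Fresh True (c (i + 1) 0)

/-- A name of the row of level `i` in its parent row: its color together with its counter (level
`0`) or the fingerprint of its counter. -/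
def rowCode (L : ℕ → Label) : ℕ → Fin 9 × (Fin 9 → Fq)
  | 0 => ((levelCell L 0).info.color, fun j => ((L 0).cells j).cur.digit)
  | i + 1 => ((levelCell L (i + 1)).info.color, fun _ => (levelCell L i).info.fp none)

/-- The name of a row of level `i` that is stored in a slot. -/
def slotCode (L : ℕ → Label) (k : Fin 4) : ℕ → Fin 9 × (Fin 9 → Fq)
  | 0 => ((levelCell L 0).info.slotColor k, fun j => ((((L 0).cells j).slot k : ℕ) : Fq))
  | i + 1 => ((levelCell L (i + 1)).info.slotColor k, fun _ => (levelCell L i).info.fp (some k))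

/-- The test of an edge that leads from a node labelled `L` to a node labelled `L'`; `r` and `r'`
tell whether these nodes repeat the labels of their predecessors. -/
def EdgeOK (J : ℕ) (L L' : ℕ → Label) (r r' : Bool) : Prop :=
  (∃ i ≤ J, (∀ i' ≤ J, i < i' → rowCode L i' = rowCode L' i') ∧ rowCode L i ≠ rowCode L' i ∧
    ((∃ k, (levelCell L i).info.dir k = .gt ∧ slotCode L k i = rowCode L' i) ∨
      ∃ k, (levelCell L' i).info.dir k = .lt ∧ slotCode L' k i = rowCode L i)) ∨
  ((∀ i ≤ J, rowCode L i = rowCode L' i) ∧ r = false ∧ r' = true)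

/-- A path of `N` nodes whose labels pass all tests but those of the other edges. -/
structure PathOK (J N : ℕ) (vl : ℕ → ℕ → Label) (c : ℕ → ℕ → ℕ → Bool → Fq) : Prop where
  pos : 0 < N
  node : ∀ v < N, NodeOK J (vl v)
  step : ∀ v, v + 1 < N → StepOK J (vl v) (vl (v + 1)) (c (v + 1))
  init : InitOK J (vl 0) (c 0)
  last : RowEnd (vl (N - 1)) J

end Verifier

/-! ### Alignment of the rows -/

section Structure

/-- The label of the cell `j` in row `b` of level `i`. -/
def cellAt (vl : ℕ → ℕ → Label) : ℕ → ℕ → ℕ → CellLabel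
  | 0, b, j => (vl b 0).cells (Fin.ofNat 9 j)
  | i + 1, b, j => levelCell (vl (b * span (i + 1) + j * (27 * span i))) (i + 1)

/-- The symbols that are absorbed by row `b` of level `i`. -/
noncomputable def symbolAt (J : ℕ) (vl : ℕ → ℕ → Label) (i b : ℕ) : Fam → Fq :=
  levelSymbol J (vl (b * span i)) i

/-- The coins for the cell `j` of level `i`. -/
def coinAt (c : ℕ → ℕ → ℕ → Bool → Fq) : ℕ → ℕ → Bool → Fq
  | 0, j => c 0 0 j
  | i + 1, j => c (j * (27 * span i)) (i + 1) 0

theorem eq_floor_of_forall_succ {α : Type*} {g : ℕ → α} {N s : ℕ}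
    (hg : ∀ v, v + 1 < N → ¬ s ∣ v + 1 → g (v + 1) = g v) {v : ℕ} (hv : v < N) :
    g v = g (v / s * s) := by
  induction v with
  | zero => simp
  | succ v ih =>
    by_cases hd : s ∣ v + 1
    · rw [Nat.div_mul_cancel hd]
    · rw [hg v hv hd, ih (by omega), Nat.succ_div_of_not_dvd hd]

/-- The rows of level `i` are correctly aligned and labelled. -/
structure LevelOK (J N : ℕ) (vl : ℕ → ℕ → Label) (c : ℕ → ℕ → ℕ → Bool → Fq) (i : ℕ) : Prop where
  ends : ∀ v < N, RowEnd (vl v) i ↔ span i ∣ v + 1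
  rows : ∀ b, (b + 1) * span i ≤ N → RowOK (width i) (symbolAt J vl i b) (cellAt vl i b)
  info : ∀ v < N, (levelCell (vl v) i).info = (cellAt vl i (v / span i) 0).info
  init : ∀ j < width i, (cellAt vl i 0 j).cur.Fresh (j = 0) (coinAt c i j)

/-- The next contents of the rows of level `i` are the contents of the next rows. -/
def Linked (N : ℕ) (vl : ℕ → ℕ → Label) (i : ℕ) : Prop :=
  ∀ b, (b + 2) * span i ≤ N → ∀ j < width i, (cellAt vl i (b + 1) j).cur = (cellAt vl i b j).nxt

variable {J N : ℕ} {vl : ℕ → ℕ → Label} {c : ℕ → ℕ → ℕ → Bool → Fq}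

theorem LevelOK.runs {i : ℕ} (h : LevelOK J N vl c i) (hl : Linked N vl i) :
    RowRun (width i) (N / span i) (fun b j => (cellAt vl i b j).cur) (symbolAt J vl i) := by
  refine ⟨fun j hj => (h.init j hj).1, fun b hb j hj => ?_⟩
  have h2 : (b + 2) * span i ≤ N := (Nat.le_div_iff_mul_le (span_pos i)).1 hb
  rw [hl b h2 j hj]
  exact (h.rows b ((Nat.mul_le_mul_right _ (by omega)).trans h2)).nxt_eq (width_pos i) hj

/-- The last node must end a row of every level up to `J`. -/
theorem PathOK.span_dvd (h : PathOK J N vl c) {i : ℕ} (hi : i ≤ J)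
    (he : ∀ v < N, RowEnd (vl v) i ↔ span i ∣ v + 1) : span i ∣ N := by
  have h1 := (he (N - 1) (by have := h.pos; omega)).1 fun i' hi' => h.last i' (by omega)
  rwa [Nat.sub_add_cancel h.pos] at h1

theorem succ_mul_span_le {i : ℕ} (hd : span i ∣ N) {v : ℕ} (hv : v < N) :
    (v / span i + 1) * span i ≤ N := by
  obtain ⟨m, rfl⟩ := hd
  rw [mul_comm]
  exact Nat.mul_le_mul_left _ (Nat.div_lt_of_lt_mul hv)

/-- The claimed end of a parent row is the overflow of the counter below it; this counter is
correct, so it overflows exactly after every `3 ^ width i` rows. -/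
theorem PathOK.ends_succ (h : PathOK J N vl c) {i : ℕ} (hi : i ≤ J) (hL : LevelOK J N vl c i)
    (hl : Linked N vl i) : ∀ v < N, RowEnd (vl v) (i + 1) ↔ span (i + 1) ∣ v + 1 := by
  intro v hv
  have hsplit : RowEnd (vl v) (i + 1) ↔ RowEnd (vl v) i ∧ (levelCell (vl v) i).info.top = true :=
    Nat.forall_lt_succ_right
  have hle := succ_mul_span_le (h.span_dvd hi hL.ends) hv
  rw [hsplit, hL.ends v hv, hL.info v hv, (hL.rows _ hle).top_iff (width_pos i),
    (hL.runs hl).rowTop_iff ((Nat.le_div_iff_mul_le (span_pos i)).2 hle)]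
  constructor
  · rintro ⟨⟨m, hm⟩, h2⟩
    have : v / span i + 1 = m := by
      have := Nat.succ_div_of_dvd ⟨m, hm⟩
      rw [← this, hm, Nat.mul_div_cancel_left _ (span_pos i)]
    rw [span_succ, hm, mul_comm (span i), ← this]
    exact Nat.mul_dvd_mul_right h2 _
  · intro h3
    have h4 := (span_dvd_succ i).trans h3
    refine ⟨h4, ?_⟩
    rw [← Nat.succ_div_of_dvd h4]
    rw [span_succ, mul_comm] at h3
    exact (Nat.dvd_div_iff_mul_dvd h4).2 h3

/-- The labels of level `i + 1` are constant on the rows of level `i`. -/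
theorem PathOK.label_eq (h : PathOK J N vl c) {i : ℕ} (hi : i < J)
    (he : ∀ v < N, RowEnd (vl v) i ↔ span i ∣ v + 1) {v : ℕ} (hv : v < N) :
    vl v (i + 1) = vl (v / span i * span i) (i + 1) :=
  eq_floor_of_forall_succ (g := fun v => vl v (i + 1)) (fun v hv hd =>
    (h.step v hv).keep i hi fun hc => hd ((he v (by omega)).1 hc)) hv

theorem PathOK.levelSymbol_eq (h : PathOK J N vl c) {i : ℕ}
    (he : ∀ v < N, RowEnd (vl v) i ↔ span i ∣ v + 1) {v : ℕ} (hv : v < N) :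
    levelSymbol J (vl v) i = symbolAt J vl i (v / span i) := by
  ext1 f
  rw [symbolAt, levelSymbol, levelSymbol]
  split_ifs with hi
  · rw [h.label_eq hi he hv]
  · rfl

theorem PathOK.levelOK_zero (h : PathOK J N vl c) : LevelOK J N vl c 0 where
  ends v _ := by simp [RowEnd, span]
  rows b hb := by
    have := (h.node b (by simpa [span] using hb)).row
    rw [symbolAt, show b * span 0 = b from Nat.mul_one b]
    exact this
  info v _ := by simp [span, cellAt, levelCell]
  init j hj := by
    have := h.init.zero (Fin.ofNat 9 j)
    have hj : j < 9 := hj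
    have e1 : (Fin.ofNat 9 j : ℕ) = j := Nat.mod_eq_of_lt hj
    have e2 : Fin.ofNat 9 j = 0 ↔ j = 0 := by rw [Fin.ext_iff, e1]; rfl
    simp only [e1, e2] at this
    exact this

/-- The node of level `i + 1` that carries the symbol `t` of the row `B`. -/
theorem PathOK.cell_eq (h : PathOK J N vl c) {i : ℕ} (hi : i < J) (hL : LevelOK J N vl c i)
    (he : ∀ v < N, RowEnd (vl v) (i + 1) ↔ span (i + 1) ∣ v + 1) {B : ℕ}
    (hB : (B + 1) * span (i + 1) ≤ N) {t : ℕ} (ht : t < 3 ^ width i) :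
    ((vl ((B * 3 ^ width i + t) * span i) (i + 1)).io : ℕ) = t % 27 ∧
      levelCell (vl ((B * 3 ^ width i + t) * span i)) (i + 1) = cellAt vl (i + 1) B (t / 27) ∧
      ∀ j, t = j * 27 + 26 → t + 1 < 3 ^ width i →
        (cellAt vl (i + 1) B j).InRow (symbolAt J vl (i + 1) B) (cellAt vl (i + 1) B (j + 1)) ∧
        ((cellAt vl (i + 1) B (j + 1)).info.first = true → (cellAt vl (i + 1) B (j + 1)).cur.Fresh
          False (c ((B * 3 ^ width i + t + 1) * span i) (i + 1) 0)) := by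
  have hpos : ∀ j, (B * 3 ^ width i + j * 27) * span i = B * span (i + 1) + j * (27 * span i) := by
    intro j; rw [span_succ]; ring
  -- the step from the symbol `t` to the next one
  have hstep : ∀ t, t + 1 < 3 ^ width i → ∃ w, w + 1 < N ∧ RowEnd (vl w) i ∧
      ¬ RowEnd (vl w) (i + 1) ∧ vl w (i + 1) = vl ((B * 3 ^ width i + t) * span i) (i + 1) ∧
      w + 1 = (B * 3 ^ width i + (t + 1)) * span i ∧ w / span (i + 1) = B := by
    intro t ht
    have hs := span_pos i
    have e1 : (B * 3 ^ width i + (t + 1)) * span i = (B * 3 ^ width i + t) * span i + span i := by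
      ring
    have hlt : (B * 3 ^ width i + (t + 1)) * span i < N := by
      refine lt_of_lt_of_le (Nat.mul_lt_mul_of_pos_right (m := (B + 1) * 3 ^ width i) ?_ hs) ?_
      · rw [Nat.succ_mul]; omega
      · rw [mul_assoc, ← span_succ]; exact hB
    have hw : (B * 3 ^ width i + (t + 1)) * span i - 1 + 1 = (B * 3 ^ width i + (t + 1)) * span i :=
      Nat.sub_add_cancel (by omega)
    refine ⟨(B * 3 ^ width i + (t + 1)) * span i - 1, by omega, ?_, ?_, ?_, hw, ?_⟩
    · rw [hL.ends _ (by omega), hw]; exact dvd_mul_left _ _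
    · rw [he _ (by omega), hw, span_succ]
      intro hd
      have := Nat.dvd_of_mul_dvd_mul_right hs hd
      rw [Nat.dvd_add_right (dvd_mul_left _ _)] at this
      exact absurd (Nat.le_of_dvd (by omega) this) (by omega)
    · rw [h.label_eq hi hL.ends (by omega)]
      congr 2
      exact Nat.div_eq_of_lt_le (by omega) (by rw [Nat.succ_mul]; omega)
    · have e2 : B * span (i + 1) = B * 3 ^ width i * span i := by rw [span_succ]; ring
      have e3 : (t + 1) * span i ≤ 3 ^ width i * span i := Nat.mul_le_mul_right _ ht.le
      have e4 : (B * 3 ^ width i + (t + 1)) * span i =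
        B * 3 ^ width i * span i + (t + 1) * span i := by ring
      have e5 : span i ≤ (t + 1) * span i := Nat.le_mul_of_pos_left _ (by omega)
      refine Nat.div_eq_of_lt_le (by omega) ?_
      rw [Nat.succ_mul, e2, span_succ]
      omega
  -- The index `io` counts symbols modulo `27`, and the cell advances when the index wraps.
  have key : ∀ t < 3 ^ width i,
      ((vl ((B * 3 ^ width i + t) * span i) (i + 1)).io : ℕ) = t % 27 ∧
      levelCell (vl ((B * 3 ^ width i + t) * span i)) (i + 1) = cellAt vl (i + 1) B (t / 27) := by
    intro t
    induction t with
    | zero =>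
      intro _
      have e0 : (B * 3 ^ width i + 0) * span i = B * span (i + 1) := by rw [span_succ]; ring
      refine ⟨?_, by rw [e0]; simp [cellAt]⟩
      rw [e0]
      rcases B with _ | B
      · rw [zero_mul, (h.init.succ i hi).2.1]; rfl
      · have hs := span_pos (i + 1)
        have e1 : (B + 1) * span (i + 1) = B * span (i + 1) + span (i + 1) := by ring
        have e2 : (B + 1 + 1) * span (i + 1) = B * span (i + 1) + span (i + 1) + span (i + 1) := by
          ring
        have hw : (B + 1) * span (i + 1) - 1 + 1 = (B + 1) * span (i + 1) := by omega
        have := (h.step ((B + 1) * span (i + 1) - 1) (by omega)).first i hi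
          ((he _ (by omega)).2 (by rw [hw]; exact dvd_mul_left _ _))
        rw [hw] at this
        rw [this.2]; rfl
    | succ t ih =>
      intro ht
      obtain ⟨ih1, ih2⟩ := ih (by omega)
      obtain ⟨w, hwN, hw1, hw2, hw3, hw4, -⟩ := hstep t ht
      by_cases h26 : t % 27 < 26
      · obtain ⟨h3, h4⟩ := (h.step w hwN).same i hi hw1 hw2 (by rw [hw3, ih1]; exact h26)
        rw [hw4] at h3 h4
        rw [h3, h4, hw3, ih1, levelCell, hw3]
        refine ⟨by omega, ?_⟩
        rw [show (t + 1) / 27 = t / 27 by omega, ← ih2, levelCell]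
      · obtain ⟨-, h3, -⟩ := (h.step w hwN).inRow i hi hw1 hw2 (by rw [hw3, ih1]; exact h26)
        rw [hw4] at h3
        rw [h3]
        refine ⟨by simp; omega, ?_⟩
        rw [cellAt, ← hpos, show (t + 1) / 27 * 27 = t + 1 by omega]
  refine ⟨(key t ht).1, (key t ht).2, fun j hj ht1 => ?_⟩
  obtain ⟨w, hwN, hw1, hw2, hw3, hw4, hw5⟩ := hstep t ht1
  obtain ⟨k1, k2⟩ := key t ht
  obtain ⟨h3, -, h5⟩ := (h.step w hwN).inRow i hi hw1 hw2 (by rw [hw3, k1]; omega)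
  obtain ⟨-, k3⟩ := key (t + 1) ht1
  rw [h.levelSymbol_eq he (by omega), hw5, levelCell, hw3, hw4] at h3
  rw [levelCell, show t / 27 = j by omega] at k2
  rw [show (t + 1) / 27 = j + 1 by omega] at k3
  rw [k2, k3] at h3
  rw [hw4, k3] at h5
  exact ⟨h3, h5⟩

/-- The counters of level `i` fix where the cells of level `i + 1` begin and end, and the tests at
these places are the conditions on a correctly labelled row. Only the transitions between rows of
level `i + 1` are left for the hash of level `i`. -/
theorem PathOK.levelOK_succ (h : PathOK J N vl c) {i : ℕ} (hi : i < J) (hL : LevelOK J N vl c i)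
    (hl : Linked N vl i) : LevelOK J N vl c (i + 1) := by
  have he := h.ends_succ hi.le hL hl
  have hs := span_pos (i + 1)
  have hrows : ∀ b, (b + 1) * span (i + 1) ≤ N →
      RowOK (width (i + 1)) (symbolAt J vl (i + 1) b) (cellAt vl (i + 1) b) := by
    intro B hB
    have e2 : (B + 1) * span (i + 1) = B * span (i + 1) + span (i + 1) := by ring
    refine ⟨?_, fun j hj => ?_, ?_⟩
    · rcases B with _ | B
      · simpa [cellAt, symbolAt] using (h.init.succ i hi).1
      · have e1 : (B + 1) * span (i + 1) = B * span (i + 1) + span (i + 1) := by ring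
        have hw : (B + 1) * span (i + 1) - 1 + 1 = (B + 1) * span (i + 1) := by omega
        have := (h.step ((B + 1) * span (i + 1) - 1) (by omega)).first i hi
          ((he _ (by omega)).2 (by rw [hw]; exact dvd_mul_left _ _))
        rw [hw] at this
        simpa [cellAt, symbolAt] using this.1
    · have ht : j * 27 + 26 + 1 < 3 ^ width i := by rw [three_pow_width]; omega
      exact ((h.cell_eq hi hL he hB (t := j * 27 + 26) (by omega)).2.2 j rfl ht).1
    · have hw : (B + 1) * span (i + 1) - 1 + 1 = (B + 1) * span (i + 1) := by omega
      have hwN : (B + 1) * span (i + 1) - 1 < N := by omega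
      have := (h.node _ hwN).last i hi ((he _ hwN).2 (by rw [hw]; exact dvd_mul_left _ _))
      have hq : ((B + 1) * span (i + 1) - 1) / span (i + 1) = B :=
        Nat.div_eq_of_lt_le (by omega) (by rw [Nat.succ_mul]; omega)
      rw [h.levelSymbol_eq he hwN, hq, levelCell, h.label_eq hi hL.ends hwN] at this
      have h3 : 0 < 3 ^ width i := by positivity
      have hcell := (h.cell_eq hi hL he hB (t := 3 ^ width i - 1) (by omega)).2.1
      have hidx : ((B + 1) * span (i + 1) - 1) / span i = B * 3 ^ width i + (3 ^ width i - 1) := by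
        have e3 : (B + 1) * span (i + 1) = (B * 3 ^ width i + (3 ^ width i - 1)) * span i + span i
            := by
          rw [span_succ, ← Nat.succ_mul, Nat.succ_eq_add_one, add_assoc, Nat.sub_add_cancel h3]
          ring
        have := span_pos i
        exact Nat.div_eq_of_lt_le (by omega) (by rw [Nat.succ_mul (_ + _)]; omega)
      have hlast : (3 ^ width i - 1) / 27 = width (i + 1) - 1 := by
        have := width_pos (i + 1)
        rw [three_pow_width]; omega
      rw [hidx] at this
      rw [hlast, levelCell] at hcell
      rwa [hcell] at this
  refine ⟨he, hrows, fun v hv => ?_, fun j hj => ?_⟩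
  · have hB := succ_mul_span_le (h.span_dvd (i := i + 1) hi he) hv
    have ht : v / span i % 3 ^ width i < 3 ^ width i := Nat.mod_lt _ (by positivity)
    have hcell := (h.cell_eq hi hL he hB ht).2.1
    have hidx : v / span (i + 1) * 3 ^ width i + v / span i % 3 ^ width i = v / span i := by
      rw [span_succ, mul_comm (3 ^ width i) (span i), ← Nat.div_div_eq_div_mul, Nat.div_add_mod']
    rw [hidx] at hcell
    rw [levelCell, h.label_eq hi hL.ends hv]
    rw [levelCell] at hcell
    rw [hcell]
    refine (hrows _ hB).info_eq ?_
    rw [Nat.div_lt_iff_lt_mul (by norm_num), ← three_pow_width]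
    exact ht
  · have hB : (0 + 1) * span (i + 1) ≤ N := by
      rw [zero_add, one_mul]
      exact Nat.le_of_dvd h.pos (h.span_dvd hi he)
    rcases j with _ | j
    · simpa [cellAt, coinAt] using (h.init.succ i hi).2.2
    · have ht : j * 27 + 26 + 1 < 3 ^ width i := by rw [three_pow_width]; omega
      have := ((h.cell_eq hi hL he hB (t := j * 27 + 26) (by omega)).2.2 j rfl ht).2 (by
        rw [(hrows 0 hB).info_eq hj]
        simpa [cellAt] using h.init.first (i + 1) hi)
      simp only [Nat.succ_ne_zero, coinAt]
      rwa [zero_mul, zero_add, show (j * 27 + 26 + 1) * span i = (j + 1) * (27 * span i) by ring]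
        at this

end Structure

/-! ### Hash functions of the levels and their collisions -/

section Hash

/-- The field in which level `i` hashes. -/
def HashField (i : ℕ) : Type := (exists_hashField (widthExp i)).choose

noncomputable instance HashField.instField (i : ℕ) : Field (HashField i) :=
  (exists_hashField (widthExp i)).choose_spec.choose

noncomputable instance HashField.instAlgebra (i : ℕ) : Algebra Fq (HashField i) :=
  (exists_hashField (widthExp i)).choose_spec.choose_spec.choose

/-- The generator of the hash field. -/
noncomputable def hashRoot (i : ℕ) : HashField i :=
  (exists_hashField (widthExp i)).choose_spec.choose_spec.choose_spec.choose

theorem hashRoot_pow (i : ℕ) : hashRoot i ^ width i = 2 :=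
  (exists_hashField (widthExp i)).choose_spec.choose_spec.choose_spec.choose_spec.1

theorem rowVal_hashRoot_eq_zero (i : ℕ) (v : ℕ → Fq) (h : rowVal (width i) (hashRoot i) v = 0) :
    ∀ j < width i, v j = 0 :=
  (exists_hashField (widthExp i)).choose_spec.choose_spec.choose_spec.choose_spec.2 v h

theorem rowVal_hashRoot_inj {i : ℕ} {v w : ℕ → Fq}
    (h : rowVal (width i) (hashRoot i) v = rowVal (width i) (hashRoot i) w) :
    ∀ j < width i, v j = w j := fun j hj =>
  sub_eq_zero.1 (rowVal_hashRoot_eq_zero i (fun j => v j - w j)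
    (by rw [rowVal_sub]; exact sub_eq_zero.2 h) j hj)

/-- The hash of a stream of `3 ^ width i` symbols at the point with the coordinates `a`. -/
noncomputable def streamHash (i : ℕ) (a : ℕ → Fq) (S : ℕ → Fq) : HashField i :=
  horner (width i) (hashRoot i) (rowVal (width i) (hashRoot i) a) S (3 ^ width i / width i)

theorem streamHash_congr {i : ℕ} {a a' S S' : ℕ → Fq} (ha : ∀ j < width i, a j = a' j)
    (hS : ∀ t < 3 ^ width i, S t = S' t) : streamHash i a S = streamHash i a' S' := by
  rw [streamHash, streamHash, rowVal_congr ha]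
  exact horner_congr fun t ht => hS t (by rwa [Nat.div_mul_cancel (width_dvd i)] at ht)

/-- The first pair of different streams is not separated by the hash. -/
def StreamCollision (i : ℕ) (a : ℕ → Fq) (S S' : ℕ → ℕ → Fq) : Prop :=
  ∃ B, (∀ B' < B, ∀ t < 3 ^ width i, S B' t = S' B' t) ∧ (∃ t < 3 ^ width i, S B t ≠ S' B t) ∧
    streamHash i a (S B) = streamHash i a (S' B)

/-- The fingerprints of two different streams coincide. -/
def CodeCollision (i : ℕ) (a p : ℕ → Fq) (S S' : ℕ → Fq) : Prop :=
  FingerprintCollision (width i) (hashRoot i) (3 ^ width i / width i) S S' a p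

/-- The stream of symbols `f` that row `B` of level `i + 1` hands to level `i`. -/
noncomputable def stream (vl : ℕ → ℕ → Label) (i B : ℕ) (f : Fam) (t : ℕ) : Fq :=
  (vl ((B * 3 ^ width i + t) * span i) (i + 1)).symbol f

end Hash

/-! ### Linking the rows of a level through the hashes of the level below -/

section Streams

variable {J N : ℕ} {vl : ℕ → ℕ → Label} {c : ℕ → ℕ → ℕ → Bool → Fq}

theorem symbolAt_eq_stream {i : ℕ} (hi : i < J) (B t : ℕ) (f : Fam) :
    symbolAt J vl i (B * 3 ^ width i + t) f = stream vl i B f t := by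
  rw [symbolAt, levelSymbol, if_pos hi, stream]

theorem succ_mul_three_pow_le {i B : ℕ} (hB : (B + 1) * span (i + 1) ≤ N) :
    (B + 1) * 3 ^ width i ≤ N / span i := by
  rw [Nat.le_div_iff_mul_le (span_pos i), mul_assoc, ← span_succ]
  exact hB

/-- The accumulators at the end of a parent row hold the hash of the streams of this row. -/
theorem LevelOK.rowVal_absorb {i : ℕ} (hL : LevelOK J N vl c i)
    (hl : Linked N vl i) (hi : i < J) {B : ℕ}
    (hB : (B + 1) * span (i + 1) ≤ N) (f : Fam) {b : ℕ} (hb : b + 1 = (B + 1) * 3 ^ width i) :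
    rowVal (width i) (hashRoot i)
      (absorb (width i) (fun j => (cellAt vl i b j).cur) (symbolAt J vl i b) f) =
        streamHash i (fun j => coinAt c i j false) (stream vl i B f) := by
  have := succ_mul_three_pow_le hB
  rw [(hL.runs hl).rowVal_absorb_top (hashRoot_pow i) (width_pos i) (width_dvd i) f
    (by omega) hb, streamHash, rowVal_congr fun j hj => (hL.init j hj).2.1]
  exact horner_congr fun t _ => symbolAt_eq_stream hi B t f

/-- The left side is stored in `ret` when row `B` ends and kept during row `B + 1`, at whose end it
is compared with the hash of the current content. -/
theorem LevelOK.hash_next {i : ℕ} (hL : LevelOK J N vl c i)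
    (hl : Linked N vl i) (hi : i < J) {B : ℕ}
    (hB : (B + 2) * span (i + 1) ≤ N) :
    streamHash i (fun j => coinAt c i j false) (stream vl i B (.inl true)) =
      streamHash i (fun j => coinAt c i j false) (stream vl i (B + 1) (.inl false)) := by
  have h3 : 0 < 3 ^ width i := by positivity
  have hs := span_pos (i + 1)
  have hB1 : (B + 1) * span (i + 1) ≤ N := (Nat.mul_le_mul_right _ (by omega)).trans hB
  have hB' := succ_mul_three_pow_le (N := N) (B := B + 1) hB
  have e1 : (B + 1 + 1) * 3 ^ width i = (B + 1) * 3 ^ width i + 3 ^ width i := by ring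
  have e2 : (B + 1) * 3 ^ width i = B * 3 ^ width i + 3 ^ width i := by ring
  have hb : (B + 1) * 3 ^ width i - 1 + 1 = (B + 1) * 3 ^ width i := by omega
  rw [← hL.rowVal_absorb hl hi hB1 _ hb, ← hL.rowVal_absorb hl hi hB _
    (b := (B + 1) * 3 ^ width i + (3 ^ width i - 1)) (by omega)]
  refine rowVal_congr fun j hj => ?_
  have hT : (B + 1) * 3 ^ width i + (3 ^ width i - 1) < N / span i := by omega
  have hle : ((B + 1) * 3 ^ width i + (3 ^ width i - 1) + 1) * span i ≤ N :=
    (Nat.le_div_iff_mul_le (span_pos i)).1 hT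
  have htop : RowTop (width i)
      fun j => (cellAt vl i ((B + 1) * 3 ^ width i + (3 ^ width i - 1)) j).cur :=
    ((hL.runs hl).rowTop_iff hT).2 ⟨B + 2, by rw [add_assoc, Nat.sub_add_cancel h3]; ring⟩
  rw [(hL.rows _ hle).ret_eq (width_pos i) htop hj]
  exact ((hL.runs hl).ret_eq (by omega) hT hb hj).symm

theorem PathOK.linked_zero (h : PathOK J N vl c) : Linked N vl 0 := by
  intro b hb j _
  exact (h.step b (by rw [show span 0 = 1 from rfl] at hb; omega)).next _

theorem PathOK.stream_content (h : PathOK J N vl c) {i : ℕ} (hi : i < J) (hL : LevelOK J N vl c i)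
    (he : ∀ v < N, RowEnd (vl v) (i + 1) ↔ span (i + 1) ∣ v + 1) {B : ℕ}
    (hB : (B + 1) * span (i + 1) ≤ N) {j : ℕ} (hj : j < width (i + 1)) (τ : Fin 27) :
    stream vl i B (.inl false) (j * 27 + τ) = (cellAt vl (i + 1) B j).cur.serial τ ∧
    stream vl i B (.inl true) (j * 27 + τ) = (cellAt vl (i + 1) B j).nxt.serial τ ∧
    stream vl i B (.inr none) (j * 27 + τ) = (cellAt vl (i + 1) B j).cur.digit ∧
    ∀ k, stream vl i B (.inr (some k)) (j * 27 + τ) = ((cellAt vl (i + 1) B j).slot k : ℕ) := by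
  have hτ := τ.2
  obtain ⟨h1, h2, -⟩ := h.cell_eq hi hL he hB (t := j * 27 + τ) (by rw [three_pow_width]; omega)
  have h3 : (vl ((B * 3 ^ width i + (j * 27 + τ)) * span i) (i + 1)).io = τ := by
    ext; omega
  rw [levelCell, show (j * 27 + (τ : ℕ)) / 27 = j by omega] at h2
  refine ⟨?_, ?_, ?_, fun k => ?_⟩ <;> rw [stream, Label.symbol, h2] <;> rw [h3]

/-- If a transition is wrong, the first wrong one satisfies the equation of hashes and is a
collision. Singling out the first one ties the event to a single pair of streams, so that no union
over the rows is needed. -/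
theorem PathOK.linked_succ (h : PathOK J N vl c) {i : ℕ} (hi : i < J) (hL : LevelOK J N vl c i)
    (hl : Linked N vl i) (hc : ¬ StreamCollision i (fun j => coinAt c i j false)
      (fun B => stream vl i B (.inl true)) fun B => stream vl i (B + 1) (.inl false)) :
    Linked N vl (i + 1) := by
  classical
  have he := h.ends_succ hi.le hL hl
  intro b hb j hj
  by_contra hne
  have hb1 : (b + 1) * span (i + 1) ≤ N := (Nat.mul_le_mul_right _ (by omega)).trans hb
  have hex : ∃ B, ∃ t < 3 ^ width i,
      stream vl i B (.inl true) t ≠ stream vl i (B + 1) (.inl false) t := by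
    refine ⟨b, ?_⟩
    by_contra hall
    push Not at hall
    refine hne (Cell.serial_injective fun τ => ?_)
    have hτ := τ.2
    rw [← (h.stream_content hi hL he hb1 hj τ).2.1, ← (h.stream_content hi hL he hb hj τ).1,
      hall _ (by rw [three_pow_width]; omega)]
  have hle : Nat.find hex ≤ b := by
    by_contra hlt
    have hmin := Nat.find_min hex (not_le.1 hlt)
    push Not at hmin
    refine hne (Cell.serial_injective fun τ => ?_)
    have hτ := τ.2
    rw [← (h.stream_content hi hL he hb1 hj τ).2.1, ← (h.stream_content hi hL he hb hj τ).1,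
      hmin _ (by rw [three_pow_width]; omega)]
  refine hc ⟨Nat.find hex, fun B' hB' => ?_, Nat.find_spec hex, ?_⟩
  · have := Nat.find_min hex hB'
    push Not at this
    exact this
  · exact hL.hash_next hl hi ((Nat.mul_le_mul_right _ (by omega)).trans hb)

/-- Without collisions of hashes, all levels are aligned and linked. -/
theorem PathOK.levels (h : PathOK J N vl c)
    (hc : ∀ i < J, span i ≤ N → ¬ StreamCollision i (fun j => coinAt c i j false)
      (fun B => stream vl i B (.inl true)) fun B => stream vl i (B + 1) (.inl false))
    {i : ℕ} (hi : i ≤ J) : LevelOK J N vl c i ∧ Linked N vl i := by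
  induction i with
  | zero => exact ⟨h.levelOK_zero, h.linked_zero⟩
  | succ i ih =>
    obtain ⟨h1, h2⟩ := ih (by omega)
    exact ⟨h.levelOK_succ hi h1 h2, h.linked_succ hi h1 h2
      (hc i hi (Nat.le_of_dvd h.pos (h.span_dvd (by omega) h1.ends)))⟩

/-- The counter of the top level must not overflow before the last group, so all groups fit into one
row of level `J + 1`. -/
theorem PathOK.le_span (h : PathOK J N vl c) (hL : LevelOK J N vl c J) (hl : Linked N vl J) :
    N ≤ span (J + 1) := by
  by_contra hlt
  have hs := span_pos (J + 1)
  have hw : span (J + 1) - 1 + 1 = span (J + 1) := by omega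
  exact (h.step (span (J + 1) - 1) (by omega)).notEnd
    ((h.ends_succ le_rfl hL hl _ (by omega)).2 (by rw [hw]))

/-- The fingerprints are linear forms in the accumulators at the end of the parent row. -/
theorem PathOK.fp_eq (h : PathOK J N vl c) {i : ℕ} (hi : i ≤ J) (hL : LevelOK J N vl c i)
    (hl : Linked N vl i) {v b : ℕ} (hv : v < N)
    (hb : b + 1 = (v / span (i + 1) + 1) * 3 ^ width i)
    (hB : (v / span (i + 1) + 1) * span (i + 1) ≤ N) (o : Option (Fin 4)) :
    (levelCell (vl v) i).info.fp o = ∑ j ∈ Finset.range (width i), coinAt c i j true *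
      absorb (width i) (fun j => (cellAt vl i b j).cur) (symbolAt J vl i b) (.inr o) j := by
  have he := h.ends_succ hi hL hl
  have hs := span_pos i
  have hs1 := span_pos (i + 1)
  have hd := h.span_dvd hi hL.ends
  have hT : b < N / span i := by have := succ_mul_three_pow_le hB; omega
  have hle : (b + 1) * span i ≤ N := (Nat.le_div_iff_mul_le hs).1 hT
  have hconst : ∀ {v}, v < N → (levelCell (vl v) i).info.fp =
      (levelCell (vl (v / span (i + 1) * span (i + 1))) i).info.fp := by
    refine eq_floor_of_forall_succ (g := fun v => (levelCell (vl v) i).info.fp) fun v hv hnd => ?_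
    by_cases hdv : span i ∣ v + 1
    · exact (h.step v hv).fp i hi ((hL.ends v (by omega)).2 hdv)
        fun hc => hnd ((he v (by omega)).1 hc)
    · simp only [hL.info _ hv, hL.info v (by omega : v < N)]
      rw [Nat.succ_div_of_not_dvd hdv]
  have hb1 : (b + 1) * span i = (v / span (i + 1) + 1) * span (i + 1) := by
    rw [hb, mul_assoc, ← span_succ]
  have hw : b * span i < N := by
    have : (b + 1) * span i = b * span i + span i := by ring
    omega
  have hq : b * span i / span (i + 1) = v / span (i + 1) := by
    have e1 : (b + 1) * span i = b * span i + span i := by ring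
    refine Nat.div_eq_of_lt_le ?_ (by omega)
    have e2 : (v / span (i + 1) + 1) * span (i + 1) = v / span (i + 1) * span (i + 1) +
      span (i + 1) := by ring
    have e3 : span i ≤ span (i + 1) := Nat.le_of_dvd hs1 (span_dvd_succ i)
    omega
  rw [hconst hv, ← hq, ← hconst hw, hL.info _ hw, Nat.mul_div_cancel _ hs]
  have htop : RowTop (width i) fun j => (cellAt vl i b j).cur :=
    ((hL.runs hl).rowTop_iff hT).2 ⟨v / span (i + 1) + 1, by rw [hb, mul_comm]⟩
  rw [(hL.rows b hle).fp_eq (width_pos i) htop]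
  refine Finset.sum_congr rfl fun j hj => ?_
  rw [← (hL.init j (Finset.mem_range.1 hj)).2.2]
  exact congrArg (· * _) ((hL.runs hl).proj_eq hT (Finset.mem_range.1 hj))

end Streams

/-! ### The test of an edge -/

section Edges

variable {J N : ℕ} {vl : ℕ → ℕ → Label} {c : ℕ → ℕ → ℕ → Bool → Fq}

/-- The digit of the counter or of a slot that is held by a cell. -/
def CellLabel.digitOf (l : CellLabel) : Option (Fin 4) → Fq
  | none => l.cur.digit
  | some k => ((l.slot k : ℕ) : Fq)

/-- The digits (level `0`) or the fingerprint of the counter or of a slot. -/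
def codeString (L : ℕ → Label) (o : Option (Fin 4)) : ℕ → Fin 9 → Fq
  | 0 => fun j => ((L 0).cells j).digitOf o
  | i + 1 => fun _ => (levelCell L i).info.fp o

theorem rowCode_snd (L : ℕ → Label) (i : ℕ) : (rowCode L i).2 = codeString L none i := by
  cases i <;> rfl

theorem slotCode_snd (L : ℕ → Label) (k : Fin 4) (i : ℕ) :
    (slotCode L k i).2 = codeString L (some k) i := by
  cases i <;> rfl

theorem rowCode_fst (L : ℕ → Label) (i : ℕ) : (rowCode L i).1 = (levelCell L i).info.color := by
  cases i <;> rfl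

theorem slotCode_fst (L : ℕ → Label) (k : Fin 4) (i : ℕ) :
    (slotCode L k i).1 = (levelCell L i).info.slotColor k := by
  cases i <;> rfl

/-- Equal codes have equal digits, unless there is a collision. -/
theorem PathOK.digitOf_eq (h : PathOK J N vl c)
    (hlev : ∀ i ≤ J, LevelOK J N vl c i ∧ Linked N vl i) {k : ℕ} (hk : k ≤ J) {u v : ℕ}
    (hu : u < N) (hv : v < N) {o o' : Option (Fin 4)}
    (hnc : ∀ i, k = i + 1 → ¬ CodeCollision i (fun j => coinAt c i j false)
      (fun j => coinAt c i j true) (stream vl i (u / span k) (.inr o))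
      (stream vl i (v / span k) (.inr o')))
    (hcode : codeString (vl u) o k = codeString (vl v) o' k) :
    ∀ j < width k, (cellAt vl k (u / span k) j).digitOf o =
      (cellAt vl k (v / span k) j).digitOf o' := by
  intro j hj
  rcases k with _ | i
  · have := congrFun hcode (Fin.ofNat 9 j)
    rw [show span 0 = 1 from rfl, Nat.div_one, Nat.div_one]
    exact this
  · have hfp : (levelCell (vl u) i).info.fp o = (levelCell (vl v) i).info.fp o' :=
      congrFun hcode 0
    obtain ⟨hL, hl⟩ := hlev i (by omega)
    have he := (hlev (i + 1) hk).1.ends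
    have hd := h.span_dvd hk he
    have h3 : 0 < 3 ^ width i := by positivity
    have hBu := succ_mul_span_le hd hu
    have hBv := succ_mul_span_le hd hv
    have hb : ∀ B, (B + 1) * 3 ^ width i - 1 + 1 = (B + 1) * 3 ^ width i := fun B =>
      Nat.sub_add_cancel (Nat.mul_pos (Nat.succ_pos _) h3)
    rw [h.fp_eq (by omega) hL hl hu (hb _) hBu, h.fp_eq (by omega) hL hl hv (hb _) hBv] at hfp
    have hru := hL.rowVal_absorb hl hk hBu (.inr o) (hb _)
    have hrv := hL.rowVal_absorb hl hk hBv (.inr o') (hb _)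
    -- The linear forms take equal values. If the streams differed, then either their hashes would
    -- coincide or the form would fail to separate distinct hashes, and both are collisions.
    have hS : ∀ t < 3 ^ width i, stream vl i (u / span (i + 1)) (.inr o) t =
        stream vl i (v / span (i + 1)) (.inr o') t := by
      by_contra hne
      push Not at hne
      refine hnc i rfl ⟨by rwa [Nat.div_mul_cancel (width_dvd i)], ?_⟩
      rw [or_iff_not_imp_left]
      intro hh
      refine ⟨_, _, hru, hrv, ?_, hfp⟩
      by_contra hall
      push Not at hall
      exact hh (hru.symm.trans ((rowVal_congr hall).trans hrv))
    have ht := hS (j * 27 + (0 : Fin 27)) (by rw [three_pow_width]; simp; omega)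
    have su := h.stream_content hk hL he hBu hj 0
    have sv := h.stream_content hk hL he hBv hj 0
    rcases o with _ | o <;> rcases o' with _ | o'
    · rwa [su.2.2.1, sv.2.2.1] at ht
    · rwa [su.2.2.1, sv.2.2.2] at ht
    · rwa [su.2.2.2, sv.2.2.1] at ht
    · rwa [su.2.2.2, sv.2.2.2] at ht

theorem natCast_inj_of_lt_three {a b : ℕ} (ha : a < 3) (hb : b < 3) (h : (a : Fq) = b) : a = b := by
  have := (ZMod.natCast_eq_natCast_iff' a b 139).1 h
  omega

theorem LevelOK.digit_eq {i : ℕ} (hL : LevelOK J N vl c i) (hl : Linked N vl i) {b : ℕ}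
    (hb : (b + 1) * span i ≤ N) {j : ℕ} (hj : j < width i) :
    (cellAt vl i b j).cur.digit = ((b / 3 ^ j % 3 : ℕ) : Fq) :=
  (hL.runs hl).digit_eq ((Nat.le_div_iff_mul_le (span_pos i)).2 hb) hj

theorem ofDigits_congr {e : ℕ} {a b : ℕ → ℕ} (h : ∀ j < e, a j = b j) :
    ofDigits e a = ofDigits e b :=
  Finset.sum_congr rfl fun j hj => by rw [h j (Finset.mem_range.1 hj)]

theorem val_natCast_of_lt_three {a : ℕ} (ha : a < 3) : (a : Fq).val = a :=
  ZMod.val_natCast_of_lt (by omega)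

/-- The recorded comparison of a slot with the counter. -/
theorem LevelOK.dir_eq {i : ℕ} (hL : LevelOK J N vl c i) (hl : Linked N vl i) {v : ℕ} (hv : v < N)
    (hb : (v / span i + 1) * span i ≤ N) (k : Fin 4) :
    (levelCell (vl v) i).info.dir k = compare
      (ofDigits (width i) fun j => (cellAt vl i (v / span i) j).slot k)
      (v / span i % 3 ^ width i) := by
  have hdig : ∀ j < width i, (cellAt vl i (v / span i) j).cur.digit.val =
      v / span i / 3 ^ j % 3 := fun j hj => by
    rw [hL.digit_eq hl hb hj, val_natCast_of_lt_three (Nat.mod_lt _ (by norm_num))]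
  rw [hL.info v hv, (hL.rows _ hb).dir_eq (width_pos i), cmpDigits_eq (fun j _ => Fin.is_lt _)
    (fun j hj => by rw [hdig j hj]; exact Nat.mod_lt _ (by norm_num)), ofDigits_congr hdig,
    ofDigits_div_mod]

theorem div_lt_div_of_mod_lt {a b m : ℕ} (h : a / m = b / m) (hlt : a % m < b % m) : a < b := by
  rw [← Nat.div_add_mod a m, ← Nat.div_add_mod b m, h]; omega

/-- In the absence of collisions, an edge that passes its test leads forward along the path. -/
theorem PathOK.lt_of_edgeOK (h : PathOK J N vl c)
    (hlev : ∀ i ≤ J, LevelOK J N vl c i ∧ Linked N vl i) {k : ℕ} (hk : k ≤ J) {u v : ℕ}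
    (hu : u < N) (hv : v < N) (hne : u / span k ≠ v / span k)
    (heq : u / span (k + 1) = v / span (k + 1))
    (hnc : ∀ i, k = i + 1 → ∀ o, ¬ CodeCollision i (fun j => coinAt c i j false)
        (fun j => coinAt c i j true) (stream vl i (u / span k) (.inr o))
        (stream vl i (v / span k) (.inr none)) ∧
      ¬ CodeCollision i (fun j => coinAt c i j false)
        (fun j => coinAt c i j true) (stream vl i (v / span k) (.inr o))
        (stream vl i (u / span k) (.inr none)))
    {r r' : Bool} (hedge : EdgeOK J (vl u) (vl v) r r') : u / span k < v / span k := by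
  obtain ⟨hL, hl⟩ := hlev k hk
  have hd := h.span_dvd hk hL.ends
  have hBu := succ_mul_span_le hd hu
  have hBv := succ_mul_span_le hd hv
  have hpar : u / span k / 3 ^ width k = v / span k / 3 ^ width k := by
    rw [Nat.div_div_eq_div_mul, Nat.div_div_eq_div_mul, mul_comm, ← span_succ, heq]
  have habove : ∀ i ≤ J, k < i → rowCode (vl u) i = rowCode (vl v) i := by
    intro i hi hki
    have hi' : u / span i = v / span i := by
      obtain ⟨m, hm⟩ := _root_.span_dvd (show k + 1 ≤ i from hki)
      rw [hm, ← Nat.div_div_eq_div_mul, heq, Nat.div_div_eq_div_mul]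
    obtain ⟨i, rfl⟩ : ∃ i', i = i' + 1 := ⟨i - 1, by omega⟩
    obtain ⟨hL', hl'⟩ := hlev i (by omega)
    have hL1 := (hlev (i + 1) hi).1
    have hd1 := h.span_dvd hi hL1.ends
    have h3 : 0 < 3 ^ width i := by positivity
    have hb : (u / span (i + 1) + 1) * 3 ^ width i - 1 + 1 = (u / span (i + 1) + 1) * 3 ^ width i :=
      Nat.sub_add_cancel (Nat.mul_pos (Nat.succ_pos _) h3)
    refine Prod.ext ?_ ?_
    · rw [rowCode_fst, rowCode_fst, hL1.info u hu, hL1.info v hv, hi']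
    · rw [rowCode_snd, rowCode_snd]
      funext _
      show (levelCell (vl u) i).info.fp none = (levelCell (vl v) i).info.fp none
      rw [h.fp_eq (by omega) hL' hl' hu hb (succ_mul_span_le hd1 hu),
        h.fp_eq (by omega) hL' hl' hv (by rw [← hi']; exact hb) (succ_mul_span_le hd1 hv)]
  -- equality with the digits of a counter
  have hcounter : ∀ w < N, (w / span k + 1) * span k ≤ N → ∀ w' < N,
      (w' / span k + 1) * span k ≤ N → ∀ l,
      (∀ j < width k, (cellAt vl k (w / span k) j).digitOf (some l) =
        (cellAt vl k (w' / span k) j).digitOf none) →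
      (levelCell (vl w) k).info.dir l = compare (w' / span k % 3 ^ width k)
        (w / span k % 3 ^ width k) := by
    intro w hw hBw w' hw' hBw' l hall
    rw [hL.dir_eq hl hw hBw, ← ofDigits_div_mod _ (w' / span k)]
    congr 1
    refine ofDigits_congr fun j hj => ?_
    have := hall j hj
    rw [CellLabel.digitOf, CellLabel.digitOf, hL.digit_eq hl hBw' hj] at this
    exact natCast_inj_of_lt_three (Fin.is_lt _) (Nat.mod_lt _ (by norm_num)) this
  have hself : rowCode (vl u) k ≠ rowCode (vl v) k := by
    intro hc
    have hc2 := congrArg Prod.snd hc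
    rw [rowCode_snd, rowCode_snd] at hc2
    have hdig := h.digitOf_eq hlev hk hu hv (fun i hi => (hnc i hi none).1) hc2
    have hmod : u / span k % 3 ^ width k = v / span k % 3 ^ width k := by
      rw [← ofDigits_div_mod, ← ofDigits_div_mod _ (v / span k)]
      refine ofDigits_congr fun j hj => ?_
      have := hdig j hj
      rw [CellLabel.digitOf, CellLabel.digitOf, hL.digit_eq hl hBu hj,
        hL.digit_eq hl hBv hj] at this
      exact natCast_inj_of_lt_three (Nat.mod_lt _ (by norm_num)) (Nat.mod_lt _ (by norm_num)) this
    exact hne (by rw [← Nat.div_add_mod (u / span k) (3 ^ width k), hpar, hmod, Nat.div_add_mod])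
  rcases hedge with ⟨i, hi, h1, h2, h3⟩ | ⟨h1, -⟩
  swap
  · exact absurd (h1 k hk) hself
  -- The test names the highest level at which the names differ. They differ at `k`, and above `k`
  -- both nodes lie in the same row and share their names.
  obtain rfl : i = k := by
    rcases lt_trichotomy i k with hlt | rfl | hlt
    · exact absurd (h1 k hk hlt) hself
    · rfl
    · exact absurd (habove i hi hlt) h2
  rcases h3 with ⟨l, hdir, hcode⟩ | ⟨l, hdir, hcode⟩
  · have hc2 := congrArg Prod.snd hcode
    rw [rowCode_snd, slotCode_snd] at hc2
    have hdig := h.digitOf_eq hlev hk hu hv (fun i hi => (hnc i hi (some l)).1) hc2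
    rw [hcounter u hu hBu v hv hBv l hdig, Nat.compare_eq_gt] at hdir
    exact div_lt_div_of_mod_lt hpar hdir
  · have hc2 := congrArg Prod.snd hcode
    rw [rowCode_snd, slotCode_snd] at hc2
    have hdig := h.digitOf_eq hlev hk hv hu (fun i hi => (hnc i hi (some l)).2) hc2
    rw [hcounter v hv hBv u hu hBu l hdig, Nat.compare_eq_lt] at hdir
    exact div_lt_div_of_mod_lt hpar hdir

end Edges

/-! ### The protocol -/

/-! ### Groups of nodes with common labels -/

section Groups

/-- The conditions on the labels of two consecutive nodes, where `r` and `r'` tell whether the nodes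
repeat the labels of their predecessors. -/
def PathStep (J : ℕ) (L L' : ℕ → Label) (r r' : Bool) (c : ℕ → ℕ → Bool → Fq) : Prop :=
  if r' then r = false ∧ L' = L else StepOK J L L' c

/-- The labels of `n` nodes, with edges `E`, pass all tests. -/
structure RunOK (J n : ℕ) (L : ℕ → ℕ → Label) (r : ℕ → Bool) (c : ℕ → ℕ → ℕ → Bool → Fq)
    (E : ℕ → ℕ → Prop) : Prop where
  node : ∀ p < n, NodeOK J (L p)
  step : ∀ p, p + 1 < n → PathStep J (L p) (L (p + 1)) (r p) (r (p + 1)) (c (p + 1))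
  init : InitOK J (L 0) (c 0) ∧ r 0 = false
  last : RowEnd (L (n - 1)) J
  edge : ∀ p < n, ∀ q < n, E p q → EdgeOK J (L p) (L q) (r p) (r q)

/-- The first node of the group `g`. -/
noncomputable def groupHead (r : ℕ → Bool) (g : ℕ) : ℕ := Nat.nth (fun p => r p = false) g

/-- The index of the group of the node `p`. -/
def groupIndex (r : ℕ → Bool) (p : ℕ) : ℕ := Nat.count (fun p => r p = false) (p + 1) - 1

theorem exists_count_eq {P : ℕ → Prop} [DecidablePred P] {n g : ℕ} (h : g < Nat.count P n) :
    ∃ p < n, P p ∧ Nat.count P p = g := by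
  induction n with
  | zero => simp at h
  | succ n ih =>
    rw [Nat.count_succ] at h
    by_cases hg : g < Nat.count P n
    · obtain ⟨p, h1, h2⟩ := ih hg
      exact ⟨p, by omega, h2⟩
    · split_ifs at h with hP
      · exact ⟨n, by omega, hP, by omega⟩
      · omega

variable {J n : ℕ} {L : ℕ → ℕ → Label} {r : ℕ → Bool} {c : ℕ → ℕ → ℕ → Bool → Fq}
  {E : ℕ → ℕ → Prop}

theorem groupIndex_of_head {p : ℕ} (hp : r p = false) :
    groupIndex r p = Nat.count (fun p => r p = false) p := by
  rw [groupIndex, Nat.count_succ, if_pos hp, Nat.add_sub_cancel]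

theorem groupHead_groupIndex {p : ℕ} (hp : r p = false) : groupHead r (groupIndex r p) = p := by
  rw [groupIndex_of_head hp, groupHead]
  exact Nat.nth_count (p := fun p => r p = false) hp

theorem groupIndex_of_repeat {p : ℕ} (hp : r (p + 1) = true) :
    groupIndex r (p + 1) = groupIndex r p := by
  rw [groupIndex, Nat.count_succ, if_neg (by simp [hp]), add_zero, groupIndex]

theorem RunOK.head_cases (h : RunOK J n L r c E) {p : ℕ} (hp : p < n) (hr : r p = true) :
    ∃ q, p = q + 1 ∧ r q = false ∧ L p = L q ∧ groupIndex r p = groupIndex r q := by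
  rcases p with _ | p
  · rw [h.init.2] at hr; exact absurd hr (by simp)
  · have := h.step p hp
    rw [PathStep, if_pos hr] at this
    exact ⟨p, rfl, this.1, this.2, groupIndex_of_repeat hr⟩

theorem RunOK.label_groupHead (h : RunOK J n L r c E) {p : ℕ} (hp : p < n) :
    L (groupHead r (groupIndex r p)) = L p := by
  cases hr : r p with
  | false => rw [groupHead_groupIndex hr]
  | true =>
    obtain ⟨q, rfl, h1, h2, h3⟩ := h.head_cases hp hr
    rw [h3, groupHead_groupIndex h1, h2]

theorem RunOK.groupIndex_lt (h : RunOK J n L r c E) {p : ℕ} (hp : p < n) :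
    groupIndex r p < Nat.count (fun p => r p = false) n := by
  have key : ∀ {p}, p < n → r p = false → groupIndex r p < Nat.count (fun p => r p = false) n := by
    intro p hp hr
    rw [groupIndex_of_head hr]
    exact Nat.count_strict_mono hr hp
  cases hr : r p with
  | false => exact key hp hr
  | true =>
    obtain ⟨q, rfl, h1, h2, h3⟩ := h.head_cases hp hr
    rw [h3]
    exact key (by omega) h1

theorem RunOK.exists_head {g : ℕ} (hg : g < Nat.count (fun p => r p = false) n) :
    ∃ p < n, r p = false ∧ groupIndex r p = g ∧ groupHead r g = p := by
  obtain ⟨p, h1, h2, h3⟩ := exists_count_eq hg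
  have h4 := groupIndex_of_head h2
  exact ⟨p, h1, h2, h4.trans h3, by rw [← h3, ← h4, groupHead_groupIndex h2]⟩

theorem groupIndex_mono {p q : ℕ} (h : p ≤ q) : groupIndex r p ≤ groupIndex r q :=
  Nat.sub_le_sub_right (Nat.count_monotone _ (by omega)) 1

/-- The groups form a correctly labelled path. -/
theorem RunOK.pathOK (h : RunOK J n L r c E) (hn : 0 < n) :
    PathOK J (Nat.count (fun p => r p = false) n) (fun g => L (groupHead r g))
      fun g => c (groupHead r g) := by
  have h0 : groupIndex r 0 = 0 := by rw [groupIndex_of_head h.init.2, Nat.count_zero]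
  have hh0 : groupHead r 0 = 0 := by
    have := groupHead_groupIndex h.init.2
    rwa [h0] at this
  have hpos : 0 < Nat.count (fun p => r p = false) n := by
    have := h.groupIndex_lt hn
    omega
  refine ⟨hpos, fun g hg => ?_, fun g hg => ?_, ?_, ?_⟩
  · obtain ⟨p, h1, -, -, h4⟩ := RunOK.exists_head hg
    rw [h4]; exact h.node p h1
  · obtain ⟨p, h1, h2, h3, h4⟩ := RunOK.exists_head hg
    rcases p with _ | p
    · omega
    · have hs := h.step p h1
      rw [PathStep, if_neg (by simp [h2])] at hs
      have hg' : groupIndex r p = g := by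
        rw [groupIndex_of_head h2] at h3
        rw [groupIndex, h3, Nat.add_sub_cancel]
      have h5 := h.label_groupHead (p := p) (by omega)
      rw [hg'] at h5
      simp only [h4, h5]
      exact hs
  · simp only [hh0]; exact h.init.1
  · have h5 := h.label_groupHead (p := n - 1) (by omega)
    have : groupIndex r (n - 1) = Nat.count (fun p => r p = false) n - 1 := by
      rw [groupIndex, Nat.sub_add_cancel hn]
    rw [this] at h5
    simp only [h5]
    exact h.last

theorem exists_level_ne {u v M : ℕ} (hne : u ≠ v) (hM : u / span M = v / span M) :
    ∃ k < M, u / span k ≠ v / span k ∧ u / span (k + 1) = v / span (k + 1) := by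
  induction M with
  | zero =>
    rw [show span 0 = 1 from rfl, Nat.div_one, Nat.div_one] at hM
    exact absurd hM hne
  | succ M ih =>
    by_cases h : u / span M = v / span M
    · obtain ⟨k, hk, h'⟩ := ih h
      exact ⟨k, by omega, h'⟩
    · exact ⟨M, by omega, h, hM⟩

/-- The labels of the groups. -/
noncomputable def groupLabel (L : ℕ → ℕ → Label) (r : ℕ → Bool) (g : ℕ) : ℕ → Label :=
  L (groupHead r g)

/-- The coins of the groups. -/
noncomputable def groupCoin (c : ℕ → ℕ → ℕ → Bool → Fq) (r : ℕ → Bool) (g : ℕ) :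
    ℕ → ℕ → Bool → Fq :=
  c (groupHead r g)

/-- The hashes of level `i` do not detect an incorrect transition of level `i + 1`. -/
def TransitionFailure (L : ℕ → ℕ → Label) (r : ℕ → Bool) (c : ℕ → ℕ → ℕ → Bool → Fq) (i : ℕ) :
    Prop :=
  StreamCollision i (fun j => coinAt (groupCoin c r) i j false)
    (fun B => stream (groupLabel L r) i B (.inl true))
    fun B => stream (groupLabel L r) i (B + 1) (.inl false)

/-- The fingerprints of the rows `b` and `b'` of level `i + 1`, or of a slot of one and the counter
of the other, coincide without reason. -/
def FingerprintFailure (L : ℕ → ℕ → Label) (r : ℕ → Bool) (c : ℕ → ℕ → ℕ → Bool → Fq)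
    (i b b' : ℕ) : Prop :=
  ∃ o, CodeCollision i (fun j => coinAt (groupCoin c r) i j false)
      (fun j => coinAt (groupCoin c r) i j true) (stream (groupLabel L r) i b (.inr o))
      (stream (groupLabel L r) i b' (.inr none)) ∨
    CodeCollision i (fun j => coinAt (groupCoin c r) i j false)
      (fun j => coinAt (groupCoin c r) i j true) (stream (groupLabel L r) i b' (.inr o))
      (stream (groupLabel L r) i b (.inr none))

/-- If no hash fails, then all edges lead forward. -/
theorem RunOK.lt_of_edge (h : RunOK J n L r c E)
    (hT : ∀ i < J, span i ≤ Nat.count (fun p => r p = false) n → ¬ TransitionFailure L r c i)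
    {p q : ℕ} (hp : p < n) (hq : q < n)
    (hF : ∀ i < J, span i ≤ Nat.count (fun p => r p = false) n →
      groupIndex r p / span (i + 1) ≠ groupIndex r q / span (i + 1) →
      groupIndex r p / span (i + 2) = groupIndex r q / span (i + 2) →
      ¬ FingerprintFailure L r c i (groupIndex r p / span (i + 1)) (groupIndex r q / span (i + 1)))
    (hpq : p ≠ q) (hE : E p q) : p < q := by
  have hP := h.pathOK (by omega)
  have hlev := fun i (hi : i ≤ J) => hP.levels hT hi
  have hNle := hP.le_span (hlev J le_rfl).1 (hlev J le_rfl).2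
  have hu := h.groupIndex_lt hp
  have hv := h.groupIndex_lt hq
  have hedge := h.edge p hp q hq hE
  -- Within a group the labels coincide, so no level separates the ends. The other alternative of
  -- the test makes `p` the first node of the group and `q` the second.
  by_cases hne : groupIndex r p = groupIndex r q
  · have hLL : L p = L q := by rw [← h.label_groupHead hp, hne, h.label_groupHead hq]
    rw [hLL] at hedge
    rcases hedge with ⟨i, -, -, h2, -⟩ | ⟨-, h1, h2⟩
    · exact absurd rfl h2
    · obtain ⟨q, rfl, h3, -, h4⟩ := h.head_cases hq h2
      rw [h4] at hne
      have : p = q := by rw [← groupHead_groupIndex h1, hne, groupHead_groupIndex h3]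
      omega
  · obtain ⟨k, hk, h1, h2⟩ := exists_level_ne hne (M := J + 1) (by
      rw [Nat.div_eq_of_lt (by omega), Nat.div_eq_of_lt (by omega)])
    rw [← h.label_groupHead hp, ← h.label_groupHead hq] at hedge
    have hlt := hP.lt_of_edgeOK hlev (Nat.lt_succ_iff.1 hk) hu hv h1 h2 (fun i hi o => by
      subst hi
      have hs := Nat.le_of_dvd hP.pos (hP.span_dvd (by omega) (hlev i (by omega)).1.ends)
      exact ⟨fun hc => hF i (by omega) hs h1 h2 ⟨o, .inl hc⟩, fun hc =>
        hF i (by omega) hs h1 h2 ⟨o, .inr hc⟩⟩) hedge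
    by_contra hle
    exact absurd (Nat.div_le_div_right (c := span k) (groupIndex_mono (r := r) (not_lt.1 hle)))
      (not_le.2 hlt)

end Groups

/-! ### Messages, rounds, and the verifier -/

section Protocol

/-- `Label` is a fixed finite type, so even a unary code has constant length. -/
theorem exists_labelCode : ∃ f : Label → List Bool, Function.Injective f ∧
    ∀ l, (f l).length ≤ Nat.card Label := by
  refine ⟨fun l => List.replicate (Finite.equivFin Label l) true, fun a b hab => ?_, fun l => ?_⟩
  · have := congrArg List.length hab
    simp only [List.length_replicate] at this
    exact (Finite.equivFin Label).injective (Fin.ext this)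
  · rw [List.length_replicate]
    exact (Finite.equivFin Label l).2.le

/-- The labels as bitstrings. -/
noncomputable def labelCode : Label → List Bool := exists_labelCode.choose

instance Label.nonempty : Nonempty Label :=
  ⟨⟨fun _ => ⟨⟨0, 0, 0, 0, 0, 0, 0⟩, ⟨0, 0, 0, 0, 0, 0, 0⟩, 0,
    ⟨0, 0, 0, false, false, 0, 0, fun _ => .eq, 0⟩, ⟨0, false, fun _ => .eq, 0⟩⟩, 0, false⟩⟩

/-- The label that a bitstring encodes. -/
noncomputable def labelOf : List Bool → Label := Function.invFun labelCode

theorem labelOf_labelCode (l : Label) : labelOf (labelCode l) = l :=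
  Function.leftInverse_invFun exists_labelCode.choose_spec.1 l

/-- The round in which the labels of level `i` are sent. -/
def levelRound (J i : ℕ) : Fin (J + 2) := ⟨J - i + 1, by omega⟩

/-- The labels of all levels. -/
noncomputable def labelsOf {J : ℕ} (m : Fin (J + 2) → List Bool) (i : ℕ) : Label :=
  labelOf (m (levelRound J i))

/-- Whether the node repeats the labels of its predecessor. -/
noncomputable def repeatsOf {J : ℕ} (m : Fin (J + 2) → List Bool) : Bool := (labelOf (m 0)).stut

/-- The number of coins per round. -/
def coinCount (J : ℕ) (i : Fin (J + 2)) : ℕ := if (i : ℕ) = 0 then 0 else 126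

/-- The values of the coins drawn before the labels of level `i` are sent. -/
noncomputable def coinsOf {J : ℕ} (ω : (i : Fin (J + 2)) → Fin (coinCount J i) → Bool)
    (i j : ℕ) (a : Bool) : Fq :=
  coinVal fun β : Fin 7 =>
    if h : (j * 2 + a.toNat) * 7 + β < coinCount J (levelRound J i) then
      ω (levelRound J i) ⟨(j * 2 + a.toNat) * 7 + β, h⟩
    else false

/-- The verification at one node. -/
structure AcceptOK {J : ℕ} (w : LocalView (J + 2) (coinCount J) EdgeMark) : Prop where
  node : NodeOK J (labelsOf w.labels)
  step : ∀ b ∈ w.nbrs, b.1.incomingPath = true → PathStep J (labelsOf b.2) (labelsOf w.labels)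
    (repeatsOf b.2) (repeatsOf w.labels) (coinsOf w.coins)
  init : (∀ b ∈ w.nbrs, b.1.incomingPath = false) →
    InitOK J (labelsOf w.labels) (coinsOf w.coins) ∧ repeatsOf w.labels = false
  last : (∀ b ∈ w.nbrs, b.1.outgoingPath = false) → RowEnd (labelsOf w.labels) J
  edge : ∀ b ∈ w.nbrs, b.1.outgoing = true → b.1.outgoingPath = false →
    EdgeOK J (labelsOf w.labels) (labelsOf b.2) (repeatsOf w.labels) (repeatsOf b.2)

open Classical in
/-- The protocol with the levels `0, …, J`. -/
noncomputable def sortProtocol (J : ℕ) : DIP EdgeMark where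
  proverRounds := J + 2
  proverRounds_pos := by omega
  coinLen := coinCount J
  accept w := decide (AcceptOK w)

theorem sortProtocol_rounds (J : ℕ) : (sortProtocol J).rounds = 2 * J + 3 := by
  rw [DIP.rounds, if_pos (by rfl)]
  show 2 * (J + 2) - 1 = _
  omega

variable {V : Type} {n : ℕ}

/-- The node at position `p`. -/
def LRInstance.nodeAt (I : LRInstance V n) (hn : 0 < n) (p : ℕ) : V :=
  I.pos.symm ⟨p % n, Nat.mod_lt _ hn⟩

theorem LRInstance.pos_nodeAt (I : LRInstance V n) (hn : 0 < n) {p : ℕ} (hp : p < n) :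
    (I.pos (I.nodeAt hn p) : ℕ) = p := by
  rw [LRInstance.nodeAt, Equiv.apply_symm_apply]
  exact Nat.mod_eq_of_lt hp

theorem LRInstance.nodeAt_pos (I : LRInstance V n) (hn : 0 < n) (v : V) :
    I.nodeAt hn (I.pos v) = v := by
  rw [LRInstance.nodeAt, Equiv.symm_apply_eq]
  exact Fin.ext (Nat.mod_eq_of_lt (I.pos v).2)

/-- The edges outside the path, as pairs of positions. -/
def LRInstance.Chord (I : LRInstance V n) (hn : 0 < n) (p q : ℕ) : Prop :=
  I.G.Adj (I.nodeAt hn p) (I.nodeAt hn q) ∧ p + 1 ≠ q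

theorem LRInstance.graph_adj (I : LRInstance V n) {u v : V} :
    I.graph.Adj u v ↔ I.G.Adj u v ∨ I.G.Adj v u := by
  rw [LRInstance.graph, Digraph.toSimpleGraphInclusive, SimpleGraph.fromRel_adj]
  constructor
  · exact fun h => h.2
  · intro h
    refine ⟨?_, h⟩
    rintro rfl
    exact I.loopless u (h.elim id id)

/-- The verifier accepts exactly if the labels pass all tests. -/
theorem accepts_iff {J : ℕ} [Fintype V] (I : LRInstance V n) (hn : 0 < n)
    (P : (sortProtocol J).Prover V) (ω : (sortProtocol J).Coins V) :
    DIP.Accepts I.network P ω ↔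
      RunOK J n (fun p => labelsOf (J := J) fun i => P.msg i ω (I.nodeAt hn p))
        (fun p => repeatsOf (J := J) fun i => P.msg i ω (I.nodeAt hn p))
        (fun p => coinsOf fun i => ω i (I.nodeAt hn p)) (I.Chord hn) := by
  classical
  have hmem : ∀ (v : V) (Q : EdgeMark × (Fin (J + 2) → List Bool) → Prop),
      (∀ b ∈ (DIP.view I.network P ω v).nbrs, Q b) ↔ ∀ u, I.graph.Adj v u →
        Q (I.network.mark v u, fun i => P.msg i ω u) := by
    intro v Q
    simp only [DIP.view, Multiset.mem_map, Finset.mem_val, Finset.mem_filter, Finset.mem_univ,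
      true_and]
    constructor
    · exact fun h u hu => h _ ⟨u, hu, rfl⟩
    · rintro h b ⟨u, hu, rfl⟩
      exact h u hu
  have hacc : DIP.Accepts I.network P ω ↔
      ∀ v, AcceptOK (J := J) (DIP.view I.network P ω v) :=
    forall_congr' fun v => decide_eq_true_iff
  have hadj : ∀ u v, I.PathEdge u v → I.graph.Adj u v ∧ I.graph.Adj v u := fun u v h =>
    ⟨I.graph_adj.2 (.inl (I.path_adj u v h)), I.graph_adj.2 (.inr (I.path_adj u v h))⟩
  rw [hacc]
  constructor
  · intro h
    refine ⟨fun p _ => (h _).node, fun p hp => ?_, ?_, ?_, fun p hp q hq hE => ?_⟩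
    · have hpe : I.PathEdge (I.nodeAt hn p) (I.nodeAt hn (p + 1)) := by
        rw [LRInstance.PathEdge, I.pos_nodeAt hn hp, I.pos_nodeAt hn (by omega)]
      exact (hmem _ _).1 (h (I.nodeAt hn (p + 1))).step _ (hadj _ _ hpe).2 (decide_eq_true hpe)
    · refine (h (I.nodeAt hn 0)).init ((hmem _ _).2 fun u _ => decide_eq_false ?_)
      rw [LRInstance.PathEdge, I.pos_nodeAt hn hn]
      omega
    · refine (h (I.nodeAt hn (n - 1))).last ((hmem _ _).2 fun u _ => decide_eq_false ?_)
      rw [LRInstance.PathEdge, I.pos_nodeAt hn (by omega)]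
      have := (I.pos u).2
      omega
    · refine (hmem _ _).1 (h (I.nodeAt hn p)).edge (I.nodeAt hn q) (I.graph_adj.2 (.inl hE.1))
        (decide_eq_true hE.1) (decide_eq_false ?_)
      rw [LRInstance.PathEdge, I.pos_nodeAt hn hp, I.pos_nodeAt hn hq]
      exact hE.2
  · intro h v
    have hv := (I.pos v).2
    have hvv := I.nodeAt_pos hn v
    refine ⟨?_, (hmem _ _).2 fun u hu hm => ?_, fun hno => ?_, fun hno => ?_,
      (hmem _ _).2 fun u hu hm hm' => ?_⟩
    · have := h.node _ hv
      rwa [hvv] at this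
    · have hpe : I.PathEdge u v := of_decide_eq_true hm
      rw [LRInstance.PathEdge] at hpe
      have := h.step (I.pos u) (by omega)
      rw [hpe] at this
      rwa [hvv, I.nodeAt_pos hn u] at this
    · have h0 : (I.pos v : ℕ) = 0 := by
        by_contra hne
        have hpe : I.PathEdge (I.nodeAt hn (I.pos v - 1)) v := by
          rw [LRInstance.PathEdge, I.pos_nodeAt hn (by omega)]
          omega
        have := (hmem _ _).1 hno _ (hadj _ _ hpe).2
        exact absurd hpe (of_decide_eq_false this)
      have := h.init
      rwa [← h0, hvv] at this
    · have h0 : (I.pos v : ℕ) = n - 1 := by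
        by_contra hne
        have hpe : I.PathEdge v (I.nodeAt hn (I.pos v + 1)) := by
          rw [LRInstance.PathEdge, I.pos_nodeAt hn (by omega)]
        have := (hmem _ _).1 hno _ (hadj _ _ hpe).1
        exact absurd hpe (of_decide_eq_false this)
      have := h.last
      rwa [← h0, hvv] at this
    · have := h.edge _ hv _ (I.pos u).2 ⟨by
        rw [hvv, I.nodeAt_pos hn u]; exact of_decide_eq_true hm,
        of_decide_eq_false (p := I.PathEdge v u) hm'⟩
      rwa [hvv, I.nodeAt_pos hn u] at this

end Protocol

/-! ### Soundness -/

/-! ### Conditioning on all but a few coins -/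

section Flip

variable {M : Type} {𝒟 : DIP M} {V ι : Type}

/-- The outcome of the coin tosses with the coins at the places `κ` flipped according to `y`. -/
noncomputable def flipCoins (κ : ι → Σ i, V × Fin (𝒟.coinLen i)) (y : ι → Bool) (ω : 𝒟.Coins V) :
    𝒟.Coins V :=
  fun i v x => xor (ω i v x) (Function.extend κ y (fun _ => false) ⟨i, v, x⟩)

theorem flipCoins_involutive (κ : ι → Σ i, V × Fin (𝒟.coinLen i)) (y : ι → Bool) :
    Function.Involutive (flipCoins κ y) := by
  intro ω
  funext i v x
  simp [flipCoins]

theorem flipCoins_apply {κ : ι → Σ i, V × Fin (𝒟.coinLen i)} (hκ : Function.Injective κ)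
    (y : ι → Bool) (ω : 𝒟.Coins V) {t : ι} {i v x} (h : κ t = ⟨i, v, x⟩) :
    flipCoins κ y ω i v x = xor (ω i v x) (y t) := by
  rw [flipCoins, ← h, hκ.extend_apply]

theorem flipCoins_of_ne {κ : ι → Σ i, V × Fin (𝒟.coinLen i)} (y : ι → Bool) (ω : 𝒟.Coins V) {i}
    (h : ∀ t, (κ t).1 ≠ i) : flipCoins κ y ω i = ω i := by
  funext v x
  rw [flipCoins, Function.extend_apply', Bool.xor_false]
  rintro ⟨t, ht⟩
  exact h t (by rw [ht])

/-- An event has probability at most `δ` if it has conditional probability at most `δ` for any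
outcome of the coins other than those at the places `κ`. -/
theorem card_event_le [Finite V] [Fintype ι] (κ : ι → Σ i, V × Fin (𝒟.coinLen i))
    (A : 𝒟.Coins V → Prop) {δ : ℝ}
    (h : ∀ ω, (Nat.card {y : ι → Bool // A (flipCoins κ y ω)} : ℝ) ≤ δ * Nat.card (ι → Bool)) :
    (Nat.card {ω // A ω} : ℝ) ≤ δ * Nat.card (𝒟.Coins V) := by
  classical
  have := Fintype.ofFinite V
  -- Double counting of the pairs of an outcome and a flip that lead into the event; for every fixed
  -- flip the map on outcomes is a bijection.
  have e1 : (Σ ω, {y : ι → Bool // A (flipCoins κ y ω)}) ≃ (ι → Bool) × {ω // A ω} :=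
    { toFun := fun t => ⟨t.2.1, flipCoins κ t.2.1 t.1, t.2.2⟩
      invFun := fun t => ⟨flipCoins κ t.1 t.2.1, t.1, by
        rw [flipCoins_involutive κ]; exact t.2.2⟩
      left_inv := by
        rintro ⟨ω, y, hy⟩
        exact Sigma.subtype_ext (flipCoins_involutive κ y ω) rfl
      right_inv := by
        rintro ⟨y, ω, hω⟩
        simp only [Prod.mk.injEq, Subtype.mk.injEq, true_and]
        exact flipCoins_involutive κ y ω }
  have e2 := Nat.card_congr e1
  rw [Nat.card_sigma, Nat.card_prod] at e2
  have hpos : (0 : ℝ) < Nat.card (ι → Bool) := by exact_mod_cast Nat.card_pos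
  have e3 : (Nat.card (ι → Bool) : ℝ) * Nat.card {ω // A ω} ≤
      Nat.card (𝒟.Coins V) * (δ * Nat.card (ι → Bool)) := by
    rw [← Nat.cast_mul, ← e2, Nat.cast_sum]
    refine (Finset.sum_le_sum fun ω _ => h ω).trans ?_
    rw [Finset.sum_const, nsmul_eq_mul, Finset.card_univ, ← Nat.card_eq_fintype_card]
  nlinarith [e3, hpos]

end Flip

/-! ### Collision probabilities -/

section Counting

/-- The number of pairs of coin rows with a given property does not change under flips. -/
theorem card_flip_le {e : ℕ} (w : Fin e × Bool × Fin 7 → Bool)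
    (Q : (Fin e → Fin 7 → Bool) × (Fin e → Fin 7 → Bool) → Prop) :
    Nat.card {y : Fin e × Bool × Fin 7 → Bool // Q (fun j β => xor (w (j, false, β)) (y (j, false, β)),
      fun j β => xor (w (j, true, β)) (y (j, true, β)))} ≤ Nat.card {x // Q x} := by
  refine Nat.card_le_card_of_injective (fun y => ⟨_, y.2⟩) ?_
  rintro ⟨y, hy⟩ ⟨y', hy'⟩ h
  simp only [Subtype.mk.injEq, Prod.mk.injEq] at h
  simp only [Subtype.mk.injEq]
  funext ⟨j, a, β⟩
  cases a
  · simpa using congrFun (congrFun h.1 j) β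
  · simpa using congrFun (congrFun h.2 j) β

theorem card_coinBlock (e : ℕ) : Nat.card (Fin e → Fin 7 → Bool) = 128 ^ e := by
  simp

theorem card_coinBlocks (e : ℕ) : (Nat.card (Fin e × Bool × Fin 7 → Bool) : ℝ) =
    128 ^ e * 128 ^ e := by
  simp only [Nat.card_eq_fintype_card, Fintype.card_fun, Fintype.card_bool, Fintype.card_prod,
    Fintype.card_fin]
  rw [← mul_pow, mul_comm, pow_mul]
  norm_num

/-- The degree is below `3 ^ width i ≤ 64 ^ width i`, among `128 ^ width i` points. The ratio is at
most `(1 / 2) ^ width i`, and `9 + i ≤ width i` makes these errors summable over the levels. -/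
theorem hashLength_le (i : ℕ) : ((3 ^ width i / width i : ℕ) : ℝ) ≤ 128 ^ width i * (1 / 2) ^ (9 + i) := by
  have h1 : ((3 ^ width i / width i : ℕ) : ℝ) ≤ 64 ^ width i := by
    calc ((3 ^ width i / width i : ℕ) : ℝ) ≤ ((3 ^ width i : ℕ) : ℝ) := by
          exact_mod_cast Nat.div_le_self _ _
      _ = 3 ^ width i := by push_cast; rfl
      _ ≤ 64 ^ width i := pow_le_pow_left₀ (by norm_num) (by norm_num) _
  refine h1.trans ?_
  have h2 : ((1 : ℝ) / 2) ^ width i ≤ (1 / 2) ^ (9 + i) :=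
    pow_le_pow_of_le_one (by norm_num) (by norm_num) (nine_add_le_width i)
  calc (64 : ℝ) ^ width i = 128 ^ width i * (1 / 2) ^ width i := by rw [← mul_pow]; norm_num
    _ ≤ _ := by gcongr

/-- The first index at which the streams differ does not depend on the multiplier, so only one pair
of streams counts. -/
theorem card_streamCollision_le (i : ℕ) (S S' : ℕ → ℕ → Fq) :
    Nat.card {a : Fin (width i) → Fin 7 → Bool // StreamCollision i (coinRow a) S S'} ≤
      3 ^ width i / width i := by
  classical
  rw [Nat.card_eq_fintype_card, Fintype.card_subtype]
  by_cases hex : ∃ B, (∀ B' < B, ∀ t < 3 ^ width i, S B' t = S' B' t) ∧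
      ∃ t < 3 ^ width i, S B t ≠ S' B t
  · obtain ⟨B, h1, h2⟩ := hex
    have hdvd := Nat.div_mul_cancel (width_dvd i)
    refine card_horner_collision_le (z := hashRoot i) (rowVal_hashRoot_eq_zero i)
      (S := S B) (S' := S' B) (by rwa [hdvd]) _
      (rowVal_coinRow_injective (rowVal_hashRoot_eq_zero i)) ?_
    intro a ha
    obtain ⟨B', h3, h4, h5⟩ := (Finset.mem_filter.1 ha).2
    obtain rfl : B' = B := by
      obtain ⟨t, ht, hne⟩ := h2
      obtain ⟨t', ht', hne'⟩ := h4
      rcases lt_trichotomy B' B with hlt | h | hlt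
      · exact absurd (h1 _ hlt _ ht') hne'
      · exact h
      · exact absurd (h3 _ hlt _ ht) hne
    exact h5
  · rw [Finset.filter_eq_empty_iff.2]
    · exact Nat.zero_le _
    · rintro a - ⟨B, h1, h2, -⟩
      exact hex ⟨B, h1, h2⟩

theorem card_streamCollision_pair_le (i : ℕ) (S S' : ℕ → ℕ → Fq) :
    (Nat.card {x : (Fin (width i) → Fin 7 → Bool) × (Fin (width i) → Fin 7 → Bool) //
      StreamCollision i (coinRow x.1) S S'} : ℝ) ≤
        (1 / 2) ^ (9 + i) * (128 ^ width i * 128 ^ width i) := by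
  have h1 : Nat.card {x : (Fin (width i) → Fin 7 → Bool) × (Fin (width i) → Fin 7 → Bool) //
      StreamCollision i (coinRow x.1) S S'} ≤ (3 ^ width i / width i) * 128 ^ width i := by
    rw [← card_coinBlock (width i)]
    refine le_trans ?_ (Nat.mul_le_mul_right _ (card_streamCollision_le i S S'))
    rw [← Nat.card_prod]
    refine Nat.card_le_card_of_injective (fun x => (⟨x.1.1, x.2⟩, x.1.2)) ?_
    rintro ⟨⟨a, b⟩, h⟩ ⟨⟨a', b'⟩, h'⟩ hh
    simpa using hh
  have h2 := hashLength_le i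
  calc _ ≤ (((3 ^ width i / width i) * 128 ^ width i : ℕ) : ℝ) := by exact_mod_cast h1
    _ = ((3 ^ width i / width i : ℕ) : ℝ) * 128 ^ width i := by push_cast; rfl
    _ ≤ (128 ^ width i * (1 / 2) ^ (9 + i)) * 128 ^ width i := by gcongr
    _ = _ := by ring

theorem card_codeCollision_le (i : ℕ) (S S' : ℕ → Fq) :
    (Nat.card {x : (Fin (width i) → Fin 7 → Bool) × (Fin (width i) → Fin 7 → Bool) //
      CodeCollision i (coinRow x.1) (coinRow x.2) S S'} : ℝ) ≤
        (1 / 128 + (1 / 2) ^ (9 + i)) * (128 ^ width i * 128 ^ width i) := by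
  classical
  have h := card_fingerprintCollision_le (rowVal_hashRoot_eq_zero i) (3 ^ width i / width i) S S'
  have e : Nat.card {x : (Fin (width i) → Fin 7 → Bool) × (Fin (width i) → Fin 7 → Bool) //
      CodeCollision i (coinRow x.1) (coinRow x.2) S S'} = (Finset.univ.filter
        fun c : (Fin (width i) → Fin 7 → Bool) × (Fin (width i) → Fin 7 → Bool) =>
      FingerprintCollision (width i) (hashRoot i) (3 ^ width i / width i) S S'
        (coinRow c.1) (coinRow c.2)).card := by
    rw [Nat.card_eq_fintype_card, Fintype.card_subtype]
    rfl
  rw [e]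
  have h' : (((Finset.univ.filter
        fun c : (Fin (width i) → Fin 7 → Bool) × (Fin (width i) → Fin 7 → Bool) =>
      FingerprintCollision (width i) (hashRoot i) (3 ^ width i / width i) S S'
        (coinRow c.1) (coinRow c.2)).card : ℕ) : ℝ) * 128 ≤
      (128 * ((3 ^ width i / width i : ℕ) : ℝ) + 128 ^ width i) * 128 ^ width i := by
    exact_mod_cast h
  have h2 := hashLength_le i
  have h3 : (128 * ((3 ^ width i / width i : ℕ) : ℝ) + 128 ^ width i) * 128 ^ width i ≤
      (128 * (128 ^ width i * (1 / 2) ^ (9 + i)) + 128 ^ width i) * 128 ^ width i := by gcongr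
  have h4 : ((128 : ℝ) * (128 ^ width i * (1 / 2) ^ (9 + i)) + 128 ^ width i) * 128 ^ width i =
      ((1 / 128 + (1 / 2) ^ (9 + i)) * (128 ^ width i * 128 ^ width i)) * 128 := by ring
  linarith

end Counting

/-! ### The error probability -/

section Soundness

theorem StreamCollision.congr {i : ℕ} {a a' : ℕ → Fq} {S S' : ℕ → ℕ → Fq}
    (ha : ∀ j < width i, a j = a' j) (h : StreamCollision i a S S') : StreamCollision i a' S S' := by
  obtain ⟨B, h1, h2, h3⟩ := h
  refine ⟨B, h1, h2, ?_⟩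
  rwa [streamHash_congr ha fun _ _ => rfl, streamHash_congr ha fun _ _ => rfl] at h3

theorem CodeCollision.congr {i : ℕ} {a a' p p' : ℕ → Fq} {S S' : ℕ → Fq}
    (ha : ∀ j < width i, a j = a' j) (hp : ∀ j < width i, p j = p' j)
    (h : CodeCollision i a p S S') : CodeCollision i a' p' S S' := by
  have hs : ∀ w : ℕ → Fq, ∑ j ∈ Finset.range (width i), p j * w j =
      ∑ j ∈ Finset.range (width i), p' j * w j := fun w =>
    Finset.sum_congr rfl fun j hj => by rw [hp j (Finset.mem_range.1 hj)]
  simp only [CodeCollision, FingerprintCollision, rowVal_congr ha, hs] at h ⊢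
  exact h

/-- The group and the component that provide the coins for the cell `j` of level `i`. -/
def cellSource : ℕ → ℕ → ℕ × ℕ
  | 0, j => (0, j)
  | i + 1, j => (j * (27 * span i), 0)

theorem coinAt_eq (c : ℕ → ℕ → ℕ → Bool → Fq) (i j : ℕ) :
    coinAt c i j = c (cellSource i j).1 i (cellSource i j).2 := by
  cases i <;> rfl

theorem cellSource_lt {i j : ℕ} (hj : j < width i) :
    (cellSource i j).1 < span i ∧ (cellSource i j).2 < 9 := by
  rcases i with _ | i
  · exact ⟨Nat.one_pos, hj⟩
  · refine ⟨?_, by norm_num [cellSource]⟩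
    rw [span_succ']
    exact Nat.mul_lt_mul_of_pos_right hj (Nat.mul_pos (by norm_num) (span_pos i))

theorem cellSource_injective (i : ℕ) : Function.Injective (cellSource i) := by
  intro j j' h
  rcases i with _ | i
  · exact congrArg Prod.snd h
  · exact Nat.eq_of_mul_eq_mul_right (Nat.mul_pos (by norm_num) (span_pos i)) (congrArg Prod.fst h)

variable {V : Type} {n J : ℕ}

/-- An event that depends on the coins of level `i` has small probability if it has small
conditional probability for any streams. -/
theorem card_level_event_le [Fintype V] (I : LRInstance V n) (hn : 0 < n)
    (P : (sortProtocol J).Prover V) {r : ℕ → Bool} {i : ℕ} (hi : i < J)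
    (hs : span i ≤ Nat.count (fun p => r p = false) n)
    {Q : (ℕ → Fq) → (ℕ → Fq) → (ℕ → Fam → ℕ → Fq) → Prop} {δ : ℝ}
    (hQ : ∀ a a' p p' S, (∀ j < width i, a j = a' j) → (∀ j < width i, p j = p' j) →
      Q a p S → Q a' p' S)
    (hδ : ∀ S, (Nat.card {x : (Fin (width i) → Fin 7 → Bool) × (Fin (width i) → Fin 7 → Bool) //
      Q (coinRow x.1) (coinRow x.2) S} : ℝ) ≤ δ * (128 ^ width i * 128 ^ width i)) :
    (Nat.card {ω : (sortProtocol J).Coins V //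
      Q (fun j => coinAt (groupCoin (fun p => coinsOf fun i => ω i (I.nodeAt hn p)) r) i j false)
        (fun j => coinAt (groupCoin (fun p => coinsOf fun i => ω i (I.nodeAt hn p)) r) i j true)
        (stream (groupLabel (fun p => labelsOf (J := J) fun i => P.msg i ω (I.nodeAt hn p)) r) i)}
      : ℝ) ≤ δ * Nat.card ((sortProtocol J).Coins V) := by
  have hround : ((levelRound J i : Fin (J + 2)) : ℕ) = J - i + 1 := rfl
  -- `126 = 9 * 2 * 7`: up to nine cells per node (level `0`), a multiplier and a linear form for
  -- each, seven coins per field element.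
  have hcount : coinCount J (levelRound J i) = 126 := if_neg (by rw [hround]; omega)
  have hoff : ∀ t : Fin (width i) × Bool × Fin 7,
      ((cellSource i t.1).2 * 2 + t.2.1.toNat) * 7 + t.2.2 < coinCount J (levelRound J i) := by
    rintro ⟨j, a, β⟩
    have := (cellSource_lt j.2).2
    have := a.toNat_le
    have := β.2
    rw [hcount]
    dsimp only
    omega
  let κ : Fin (width i) × Bool × Fin 7 → Σ i, V × Fin ((sortProtocol J).coinLen i) := fun t =>
    ⟨levelRound J i, I.nodeAt hn (groupHead r (cellSource i t.1).1), ⟨_, hoff t⟩⟩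
  -- By `hs` all source groups exist; their heads are distinct nodes, so distinct cells use disjoint
  -- blocks of coins.
  have hκ : Function.Injective κ := by
    rintro ⟨j, a, β⟩ ⟨j', a', β'⟩ h
    have h' := eq_of_heq (Sigma.mk.inj h).2
    obtain ⟨h1, h2⟩ := Prod.mk.inj h'
    have h2 : ((cellSource i j).2 * 2 + a.toNat) * 7 + (β : ℕ) =
      ((cellSource i j').2 * 2 + a'.toNat) * 7 + β' := congrArg Fin.val h2
    have hβ := β.2
    have hβ' := β'.2
    have ha := a.toNat_le
    have ha' := a'.toNat_le
    obtain ⟨q, hq, -, hq2, hq3⟩ := RunOK.exists_head ((cellSource_lt j.2).1.trans_le hs)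
    obtain ⟨q', hq', -, hq2', hq3'⟩ := RunOK.exists_head ((cellSource_lt j'.2).1.trans_le hs)
    rw [hq3, hq3'] at h1
    have h3 : q = q' := by rw [← I.pos_nodeAt hn hq, h1, I.pos_nodeAt hn hq']
    have h4 : (cellSource i j).1 = (cellSource i j').1 := by rw [← hq2, h3, hq2']
    have h5 : j = j' := Fin.ext (cellSource_injective i (Prod.ext h4 (by omega)))
    subst h5
    have h6 : a = a' := by
      have : a.toNat = a'.toNat := by omega
      cases a <;> cases a' <;> simp_all
    have h7 : β = β' := Fin.ext (by omega)
    rw [h6, h7]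
  refine card_event_le κ _ fun ω => ?_
  have hblocks := card_coinBlocks (width i)
  rw [hblocks]
  set S := stream (groupLabel (fun p => labelsOf (J := J) fun i => P.msg i ω (I.nodeAt hn p)) r) i
    with hS
  refine le_trans ?_ (hδ S)
  rw [Nat.cast_le]
  refine le_trans ?_ (card_flip_le (fun t => ω (κ t).1 (κ t).2.1 (κ t).2.2) _)
  have hcoin : ∀ (y : Fin (width i) × Bool × Fin 7 → Bool) (a : Bool) (j : ℕ), (hj : j < width i) →
      coinAt (groupCoin (fun p => coinsOf fun i => flipCoins κ y ω i (I.nodeAt hn p)) r) i j a =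
        coinRow (fun j β => xor (ω (κ (j, a, β)).1 (κ (j, a, β)).2.1 (κ (j, a, β)).2.2)
          (y (j, a, β))) j := by
    intro y a j hj
    rw [coinAt_eq, coinRow, dif_pos hj]
    simp only [groupCoin, coinsOf]
    congr 1
    funext β
    rw [dif_pos (hoff (⟨j, hj⟩, a, β))]
    exact flipCoins_apply hκ y ω (t := (⟨j, hj⟩, a, β)) rfl
  have hstream : ∀ y, stream (groupLabel (fun p => labelsOf (J := J) fun i =>
      P.msg i (flipCoins κ y ω) (I.nodeAt hn p)) r) i = S := by
    intro y
    -- The labels of level `i + 1` are sent one round before those of level `i`, hence before the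
    -- flipped coins are drawn, and causality keeps them unchanged.
    have hmsg : P.msg (levelRound J (i + 1)) (flipCoins κ y ω) = P.msg (levelRound J (i + 1)) ω := by
      refine P.causal _ _ _ fun ρ hρ => flipCoins_of_ne y ω fun t ht => ?_
      have h1 : (ρ : ℕ) ≤ J - (i + 1) + 1 := hρ
      have h2 : (ρ : ℕ) = J - i + 1 := by rw [← ht]; exact hround
      omega
    rw [hS]
    funext B f t
    simp only [stream, groupLabel, labelsOf]
    rw [hmsg]
  refine Nat.card_le_card_of_injective (fun y => ⟨y.1, ?_⟩) ?_
  · have := y.2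
    rw [hstream] at this
    exact hQ _ _ _ _ _ (fun j hj => hcoin y.1 false j hj) (fun j hj => hcoin y.1 true j hj) this
  · rintro ⟨y, hy⟩ ⟨y', hy'⟩ h
    simpa using h

theorem natCard_exists_le {Ω ι : Type} [Finite Ω] (s : Finset ι) (A : ι → Ω → Prop) {δ : ι → ℝ}
    (h : ∀ i ∈ s, (Nat.card {ω // A i ω} : ℝ) ≤ δ i * Nat.card Ω) :
    (Nat.card {ω // ∃ i ∈ s, A i ω} : ℝ) ≤ (∑ i ∈ s, δ i) * Nat.card Ω := by
  classical
  have := Fintype.ofFinite Ω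
  have e : ∀ Q : Ω → Prop, Nat.card {ω // Q ω} = (Finset.univ.filter Q).card := fun Q => by
    rw [Nat.card_eq_fintype_card, Fintype.card_subtype]
  have h1 : Nat.card {ω // ∃ i ∈ s, A i ω} ≤ ∑ i ∈ s, Nat.card {ω // A i ω} := by
    simp only [e]
    refine le_trans (Finset.card_le_card ?_) Finset.card_biUnion_le
    intro ω hω
    simpa using hω
  calc (Nat.card {ω // ∃ i ∈ s, A i ω} : ℝ) ≤ ((∑ i ∈ s, Nat.card {ω // A i ω} : ℕ) : ℝ) := by
        exact_mod_cast h1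
    _ = ∑ i ∈ s, (Nat.card {ω // A i ω} : ℝ) := by push_cast; rfl
    _ ≤ ∑ i ∈ s, δ i * Nat.card Ω := Finset.sum_le_sum h
    _ = _ := (Finset.sum_mul _ _ _).symm

theorem natCard_or_le {Ω : Type} [Finite Ω] {A B : Ω → Prop} {a b : ℝ}
    (hA : (Nat.card {ω // A ω} : ℝ) ≤ a * Nat.card Ω)
    (hB : (Nat.card {ω // B ω} : ℝ) ≤ b * Nat.card Ω) :
    (Nat.card {ω // A ω ∨ B ω} : ℝ) ≤ (a + b) * Nat.card Ω := by
  have := natCard_exists_le (Finset.univ : Finset Bool) (fun i => if i then A else B)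
    (δ := fun i => if i then a else b) (by rintro (_ | _) _ <;> simpa)
  simpa [Bool.exists_bool, or_comm] using this

theorem natCard_mono {Ω : Type} [Finite Ω] {A B : Ω → Prop} (h : ∀ ω, A ω → B ω) :
    (Nat.card {ω // A ω} : ℝ) ≤ Nat.card {ω // B ω} := by
  rw [Nat.cast_le]
  exact Nat.card_le_card_of_injective (fun x => ⟨x.1, h _ x.2⟩)
    fun x y hxy => by simpa [Subtype.ext_iff] using hxy

theorem sum_half_pow_le (J : ℕ) : ∑ i ∈ Finset.range J, ((1 : ℝ) / 2) ^ (9 + i) ≤ 1 / 256 := by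
  have : ∀ J : ℕ, ∑ i ∈ Finset.range J, ((1 : ℝ) / 2) ^ (9 + i) = 1 / 256 - (1 / 2) ^ (8 + J) := by
    intro J
    induction J with
    | zero => norm_num
    | succ J ih => rw [Finset.sum_range_succ, ih]; ring
  rw [this]
  have : (0 : ℝ) ≤ (1 / 2) ^ (8 + J) := by positivity
  linarith

theorem sortProtocol_sound [Fintype V] (I : LRInstance V n) (hno : ¬ I.IsYes)
    (P : (sortProtocol J).Prover V) : DIP.acceptProb I.network P ≤ 1 / 8 := by
  simp only [LRInstance.IsYes, not_forall] at hno
  obtain ⟨u, v, huv, hnp, hlt⟩ := hno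
  have hn : 0 < n := (Nat.zero_le _).trans_lt (I.pos u).2
  have hposne : (I.pos u : ℕ) ≠ I.pos v := fun h => by
    have : u = v := I.pos.injective (Fin.ext h)
    subst this
    exact I.loopless u huv
  have hchord : I.Chord hn (I.pos u) (I.pos v) := by
    rw [LRInstance.Chord, I.nodeAt_pos, I.nodeAt_pos]
    exact ⟨huv, hnp⟩
  -- the grouping of the nodes does not depend on the coins
  obtain ⟨r, hr⟩ : ∃ r : ℕ → Bool, ∀ ω, (fun p => repeatsOf (J := J) fun i =>
      P.msg i ω (I.nodeAt hn p)) = r := by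
    refine ⟨fun p => repeatsOf (J := J) fun i => P.msg i (fun _ _ _ => false) (I.nodeAt hn p),
      fun ω => ?_⟩
    funext p
    simp only [repeatsOf]
    rw [P.causal (0 : Fin (J + 2)) ω (fun _ _ _ => false)]
    intro ρ hρ
    have hρ0 : ρ = (0 : Fin (J + 2)) := Fin.le_zero_iff.1 hρ
    subst hρ0
    funext w x
    exact x.elim0
  set N := Nat.count (fun p => r p = false) n with hN
  set g := groupIndex r (I.pos u)
  set g' := groupIndex r (I.pos v)
  let L : (sortProtocol J).Coins V → ℕ → ℕ → Label := fun ω p =>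
    labelsOf (J := J) fun i => P.msg i ω (I.nodeAt hn p)
  let c : (sortProtocol J).Coins V → ℕ → ℕ → ℕ → Bool → Fq := fun ω p =>
    coinsOf fun i => ω i (I.nodeAt hn p)
  have hcover : ∀ ω, DIP.Accepts I.network P ω →
      (∃ i ∈ Finset.range J, span i ≤ N ∧ TransitionFailure (L ω) r (c ω) i) ∨
      ∃ i < J, span i ≤ N ∧ g / span (i + 1) ≠ g' / span (i + 1) ∧
        g / span (i + 2) = g' / span (i + 2) ∧
        FingerprintFailure (L ω) r (c ω) i (g / span (i + 1)) (g' / span (i + 1)) := by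
    intro ω hω
    have hrun := (accepts_iff I hn P ω).1 hω
    rw [hr ω] at hrun
    by_contra hcon
    push Not at hcon
    obtain ⟨h1, h2⟩ := hcon
    exact hlt (hrun.lt_of_edge (fun i hi => h1 i (Finset.mem_range.2 hi)) (I.pos u).2 (I.pos v).2
      h2 hposne hchord)
  have hfin : Finite ((sortProtocol J).Coins V) := inferInstance
  have hT : (Nat.card {ω // ∃ i ∈ Finset.range J, span i ≤ N ∧
      TransitionFailure (L ω) r (c ω) i} : ℝ) ≤ (∑ i ∈ Finset.range J, ((1 : ℝ) / 2) ^ (9 + i)) *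
        Nat.card ((sortProtocol J).Coins V) := by
    refine natCard_exists_le _ _ fun i hi => ?_
    by_cases hs : span i ≤ N
    · simp only [hs, true_and]
      exact card_level_event_le I hn P (Finset.mem_range.1 hi) hs
        (Q := fun a _ S => StreamCollision i a (fun B => S B (.inl true))
          fun B => S (B + 1) (.inl false))
        (fun a a' p p' S ha _ h => h.congr ha) fun S => card_streamCollision_pair_le i _ _
    · simp only [hs, false_and, Nat.card_of_isEmpty, Nat.cast_zero]
      positivity
  -- The factor `10` counts five streams of one row against the counter of the other, in both
  -- orders.
  have hF : (Nat.card {ω // ∃ i < J, span i ≤ N ∧ g / span (i + 1) ≠ g' / span (i + 1) ∧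
        g / span (i + 2) = g' / span (i + 2) ∧
        FingerprintFailure (L ω) r (c ω) i (g / span (i + 1)) (g' / span (i + 1))} : ℝ) ≤
      (10 * (1 / 128 + (1 / 2) ^ 9)) * Nat.card ((sortProtocol J).Coins V) := by
    by_cases hex : ∃ i < J, span i ≤ N ∧ g / span (i + 1) ≠ g' / span (i + 1) ∧
        g / span (i + 2) = g' / span (i + 2)
    · obtain ⟨i, hi, hs, hd1, hd2⟩ := hex
      let A : ℕ → ℕ → Option (Fin 4) → (sortProtocol J).Coins V → Prop := fun b b' o ω =>
        CodeCollision i (fun j => coinAt (groupCoin (c ω) r) i j false)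
          (fun j => coinAt (groupCoin (c ω) r) i j true)
          (stream (groupLabel (L ω) r) i b (.inr o)) (stream (groupLabel (L ω) r) i b' (.inr none))
      refine (natCard_mono (B := fun ω => ∃ o ∈ (Finset.univ : Finset (Option (Fin 4))),
        A (g / span (i + 1)) (g' / span (i + 1)) o ω ∨
          A (g' / span (i + 1)) (g / span (i + 1)) o ω) ?_).trans ?_
      · rintro ω ⟨i', -, -, h1, h2, o, ho⟩
        -- The two groups are separated below a common parent row at only one level, so no union
        -- over the levels is taken here.
        obtain rfl : i' = i := by
          have key : ∀ {a b : ℕ}, a < b → g / span (a + 2) = g' / span (a + 2) →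
              g / span (b + 1) = g' / span (b + 1) := by
            intro a b hab h
            obtain ⟨m, hm⟩ := span_dvd (show a + 2 ≤ b + 1 by omega)
            rw [hm, ← Nat.div_div_eq_div_mul, h, Nat.div_div_eq_div_mul]
          rcases lt_trichotomy i' i with h | h | h
          · exact absurd (key h h2) hd1
          · exact h
          · exact absurd (key h hd2) h1
        exact ⟨o, Finset.mem_univ _, ho⟩
      · have hpow : ((1 : ℝ) / 2) ^ (9 + i) ≤ (1 / 2) ^ 9 :=
          pow_le_pow_of_le_one (by norm_num) (by norm_num) (by omega)
        refine (natCard_exists_le Finset.univ _ (δ := fun _ => (1 / 128 + (1 / 2) ^ (9 + i)) +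
          (1 / 128 + (1 / 2) ^ (9 + i))) fun o _ => ?_).trans ?_
        · refine natCard_or_le ?_ ?_
          · exact card_level_event_le I hn P hi hs
              (Q := fun a p S => CodeCollision i a p (S _ _) (S _ _))
              (fun a a' p p' S ha hp h => h.congr ha hp) fun S => card_codeCollision_le i _ _
          · exact card_level_event_le I hn P hi hs
              (Q := fun a p S => CodeCollision i a p (S _ _) (S _ _))
              (fun a a' p p' S ha hp h => h.congr ha hp) fun S => card_codeCollision_le i _ _
        · refine mul_le_mul_of_nonneg_right ?_ (Nat.cast_nonneg _)
          simp only [Finset.sum_const, Finset.card_univ, Fintype.card_option, Fintype.card_fin,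
            nsmul_eq_mul]
          push_cast
          linarith
    · have : IsEmpty {ω // ∃ i < J, span i ≤ N ∧ g / span (i + 1) ≠ g' / span (i + 1) ∧
          g / span (i + 2) = g' / span (i + 2) ∧
          FingerprintFailure (L ω) r (c ω) i (g / span (i + 1)) (g' / span (i + 1))} :=
        ⟨fun ⟨ω, i, h1, h2, h3, h4, _⟩ => hex ⟨i, h1, h2, h3, h4⟩⟩
      rw [Nat.card_of_isEmpty, Nat.cast_zero]
      positivity
  have hall := (natCard_mono hcover).trans (natCard_or_le hT hF)
  rw [DIP.acceptProb, div_le_iff₀ (by exact_mod_cast Nat.card_pos)]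
  refine hall.trans (mul_le_mul_of_nonneg_right ?_ (Nat.cast_nonneg _))
  -- `1 / 256 + 10 * (1 / 128 + 1 / 512) = 13 / 128`.
  have := sum_half_pow_le J
  norm_num at this ⊢
  linarith

end Soundness

/-! ### Completeness -/

/-! ### Honest rows of one level -/

section HonestRows

variable {e T : ℕ}

theorem RowRun.ret_eq_first {x : ℕ → ℕ → Cell} {s : ℕ → Fam → Fq} (h : RowRun e T x s) {t : ℕ}
    (ht : t < 3 ^ e) (hT : t < T) {j : ℕ} (hj : j < e) : (x t j).ret = (x 0 j).ret := by
  induction t with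
  | zero => rfl
  | succ t ih =>
    rw [h.step t hT j hj, ← ih (by omega) (by omega)]
    refine if_neg fun hc => ?_
    have := Nat.le_of_dvd (by omega) ((h.rowTop_iff (by omega)).1 hc)
    omega

/-- The rows that follow from the coins `a`, the hash `G` of the first parent row, and the
symbols `s`. -/
noncomputable def runRows (e : ℕ) (a : ℕ → Bool → Fq) (G : ℕ → Fq) (s : ℕ → Fam → Fq) :
    ℕ → ℕ → Cell
  | 0 => fun j => ⟨a j false, a j true, if j = 0 then 1 else 0, G j, 0, 0, 0⟩
  | b + 1 => nextRow e (runRows e a G s b) (s b)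

variable {a : ℕ → Bool → Fq} {G G' : ℕ → Fq} {s : ℕ → Fam → Fq}

theorem rowRun_runRows (T : ℕ) : RowRun e T (runRows e a G s) s :=
  ⟨fun _ _ => ⟨fun h => if_pos h, fun h => if_neg h, rfl, fun _ => rfl, fun _ => rfl⟩,
    fun _ _ _ _ => rfl⟩

/-- The index of the last row with the parent row `B`. -/
def lastChild (i B : ℕ) : ℕ := (B + 1) * 3 ^ width i - 1

theorem lastChild_add_one (i B : ℕ) : lastChild i B + 1 = (B + 1) * 3 ^ width i :=
  Nat.sub_add_cancel (Nat.mul_pos (Nat.succ_pos _) (by positivity))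

theorem lastChild_eq (i B : ℕ) : lastChild i B = B * 3 ^ width i + (3 ^ width i - 1) := by
  have h : 0 < 3 ^ width i := by positivity
  rw [lastChild, Nat.succ_mul]
  omega

/-- At the end of a parent row the accumulators are the coordinates of a hash that depends only on
the absorbed stream, neither on the position of the parent row nor on the initial `ret`. The initial
`ret` can therefore be defined through this hash without circularity. -/
theorem absorb_lastChild_congr {i B B' : ℕ} {f f' : Fam}
    (h : ∀ t < 3 ^ width i, s (B * 3 ^ width i + t) f = s (B' * 3 ^ width i + t) f') :
    ∀ j < width i,
      absorb (width i) (runRows (width i) a G s (lastChild i B)) (s (lastChild i B)) f j =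
      absorb (width i) (runRows (width i) a G' s (lastChild i B')) (s (lastChild i B')) f' j := by
  refine rowVal_hashRoot_inj ?_
  have h1 := (rowRun_runRows (e := width i) (a := a) (G := G) (s := s) (lastChild i B + 1)
    ).rowVal_absorb_top (hashRoot_pow i) (width_pos i) (width_dvd i) f (Nat.lt_succ_self _)
      (lastChild_add_one i B)
  have h2 := (rowRun_runRows (e := width i) (a := a) (G := G') (s := s) (lastChild i B' + 1)
    ).rowVal_absorb_top (hashRoot_pow i) (width_pos i) (width_dvd i) f' (Nat.lt_succ_self _)
      (lastChild_add_one i B')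
  refine h1.trans (Eq.trans ?_ h2.symm)
  exact horner_congr fun t ht => h t (by rwa [Nat.div_mul_cancel (width_dvd i)] at ht)

/-- The rows of level `i`. -/
noncomputable def honestRows (i : ℕ) (a : ℕ → Bool → Fq) (s : ℕ → Fam → Fq) : ℕ → ℕ → Cell :=
  runRows (width i) a (absorb (width i) (runRows (width i) a 0 s (lastChild i 0))
    (s (lastChild i 0)) (.inl false)) s

/-- The fingerprints of the streams of the parent row `B`. -/
noncomputable def honestPrint (i : ℕ) (a : ℕ → Bool → Fq) (s : ℕ → Fam → Fq) (B : ℕ)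
    (o : Option (Fin 4)) : Fq :=
  ∑ j ∈ Finset.range (width i), a j true *
    absorb (width i) (honestRows i a s (lastChild i B)) (s (lastChild i B)) (.inr o) j

/-- The labels of level `i`, where `tgt b k` is the row stored in slot `k` of the row `b`, and `col`
is a coloring of the rows. -/
noncomputable def honestLabels (i : ℕ) (a : ℕ → Bool → Fq) (tgt : ℕ → Fin 4 → ℕ) (col : ℕ → Fin 9)
    (s : ℕ → Fam → Fq) (b : ℕ) : ℕ → CellLabel :=
  rowLabel (width i) (honestRows i a s b) (s b) (fun j k => Fin.ofNat 3 (tgt b k / 3 ^ j))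
    (decide (b = 0)) (col b) (fun k => col (tgt b k)) (honestPrint i a s (b / 3 ^ width i))

theorem rowRun_honestRows (i T : ℕ) : RowRun (width i) T (honestRows i a s) s := rowRun_runRows T

theorem rowTop_honestRows {i b : ℕ} :
    RowTop (width i) (honestRows i a s b) ↔ 3 ^ width i ∣ b + 1 :=
  (rowRun_honestRows i (b + 1)).rowTop_iff (Nat.lt_succ_self b)

theorem honestRows_fresh {i j : ℕ} : (honestRows i a s 0 j).Fresh (j = 0) (a j) :=
  ⟨⟨fun h => if_pos h, fun h => if_neg h, rfl, fun _ => rfl, fun _ => rfl⟩, rfl, rfl⟩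

/-- For the first parent row the stored hash was chosen to be its own. For a later one it is the
hash of the next content of the predecessor, which is the same stream by `hs`. -/
theorem rowOK_honestLabels {i : ℕ} {tgt : ℕ → Fin 4 → ℕ} {col : ℕ → Fin 9}
    (hs : ∀ B, ∀ t < 3 ^ width i,
      s ((B + 1) * 3 ^ width i + t) (.inl false) = s (B * 3 ^ width i + t) (.inl true)) (b : ℕ) :
    RowOK (width i) (s b) (honestLabels i a tgt col s b) := by
  have h3 : 0 < 3 ^ width i := by positivity
  have hlast : RowTop (width i) (honestRows i a s b) → b = lastChild i (b / 3 ^ width i) := by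
    intro ht
    rw [rowTop_honestRows] at ht
    have h1 := Nat.div_mul_cancel ht
    rw [Nat.succ_div_of_dvd ht] at h1
    rw [lastChild, h1, Nat.add_sub_cancel]
  refine rowOK_rowLabel (width_pos i) (fun ht j hj => ?_) fun ht o => ?_
  · have hb := hlast ht
    rcases hB : b / 3 ^ width i with _ | B
    · rw [hB] at hb
      have hlt : lastChild i 0 < 3 ^ width i := by
        rw [lastChild, zero_add, one_mul]; omega
      rw [(rowRun_honestRows i (b + 1)).ret_eq_first (by omega) (Nat.lt_succ_self b) hj, hb]
      exact absorb_lastChild_congr (fun _ _ => rfl) j hj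
    · rw [hB] at hb
      have hr := (rowRun_honestRows (a := a) (s := s) i (b + 1)).ret_eq (t := 3 ^ width i - 1) (by omega)
        (by rw [hb, ← lastChild_eq]; omega) (lastChild_add_one i B) hj
      rw [← lastChild_eq, ← hb] at hr
      rw [hr, hb]
      exact absorb_lastChild_congr (hs B) j hj
  · have hb := hlast ht
    refine Finset.sum_congr rfl fun j hj => ?_
    rw [← hb, (rowRun_honestRows i (b + 1)).proj_eq (Nat.lt_succ_self b) (Finset.mem_range.1 hj)]
    rfl

theorem honestPrint_congr {i B B' : ℕ} {o o' : Option (Fin 4)}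
    (h : ∀ t < 3 ^ width i, s (B * 3 ^ width i + t) (.inr o) = s (B' * 3 ^ width i + t) (.inr o')) :
    honestPrint i a s B o = honestPrint i a s B' o' :=
  Finset.sum_congr rfl fun j hj => by
    rw [honestRows, absorb_lastChild_congr h j (Finset.mem_range.1 hj)]

end HonestRows

/-! ### Honest labels, from the top level down -/

section HonestLevels

/-- The symbol number `t` of a cell. -/
noncomputable def CellLabel.symbol (l : CellLabel) (t : Fin 27) : Fam → Fq
  | .inl false => l.cur.serial t
  | .inl true => l.nxt.serial t
  | .inr none => l.cur.digit
  | .inr (some k) => ((l.slot k : ℕ) : Fq)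

theorem Label.symbol_eq (l : Label) : l.symbol = (l.cells 0).symbol l.io := by
  funext f
  rcases f with (_ | _) | (_ | _) <;> rfl

/-- The symbols that the rows `par` of the parent level hand to the rows of level `i`. -/
noncomputable def parentSymbol (i : ℕ) (par : ℕ → ℕ → CellLabel) (b : ℕ) : Fam → Fq :=
  (par (b / 3 ^ width i) (b % 3 ^ width i / 27)).symbol (Fin.ofNat 27 (b % 3 ^ width i))

/-- The instance, as seen by the honest prover: the rows stored in the slots, the colors, and the
coins of the groups. -/
structure HonestData where
  tgt : ℕ → ℕ → Fin 4 → ℕ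
  col : ℕ → ℕ → Fin 9
  coin : ℕ → ℕ → ℕ → Bool → Fq

variable (D : HonestData) (J : ℕ)

/-- The labels of the level `J - q`. -/
noncomputable def HonestData.downLabels : ℕ → ℕ → ℕ → CellLabel
  | 0 => honestLabels J (coinAt D.coin J) (D.tgt J) (D.col J) 0
  | q + 1 => honestLabels (J - (q + 1)) (coinAt D.coin (J - (q + 1))) (D.tgt (J - (q + 1)))
      (D.col (J - (q + 1))) (parentSymbol (J - (q + 1)) (HonestData.downLabels q))

/-- The labels of the level `i`. -/
noncomputable def HonestData.cells (i : ℕ) : ℕ → ℕ → CellLabel := D.downLabels J (J - i)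

/-- The symbols that are absorbed by the rows of level `i`. -/
noncomputable def HonestData.symbols (i b : ℕ) : Fam → Fq :=
  if i < J then parentSymbol i (D.cells J (i + 1)) b else 0

variable {D J}

theorem HonestData.cells_eq {i : ℕ} (hi : i ≤ J) : D.cells J i =
    honestLabels i (coinAt D.coin i) (D.tgt i) (D.col i) (D.symbols J i) := by
  rcases hi.lt_or_eq with h | rfl
  · have h1 : J - i = J - (i + 1) + 1 := by omega
    have h2 : D.symbols J i = parentSymbol i (D.downLabels J (J - (i + 1))) := by
      funext b
      rw [HonestData.symbols, if_pos h]
      rfl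
    rw [HonestData.cells, h1, HonestData.downLabels, h2, ← h1, Nat.sub_sub_self hi]
  · have h2 : D.symbols i i = 0 := by
      funext b
      exact if_neg (lt_irrefl i)
    rw [HonestData.cells, Nat.sub_self, HonestData.downLabels, h2]

theorem HonestData.nxt_eq {i : ℕ} (hi : i ≤ J) (b j : ℕ) :
    (D.cells J i b j).nxt = (D.cells J i (b + 1) j).cur := by
  rw [D.cells_eq hi]; rfl

theorem HonestData.symbols_succ (i B : ℕ) {t : ℕ} (ht : t < 3 ^ width i) :
    D.symbols J i ((B + 1) * 3 ^ width i + t) (.inl false) =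
      D.symbols J i (B * 3 ^ width i + t) (.inl true) := by
  have h3 : 0 < 3 ^ width i := by positivity
  rw [HonestData.symbols, HonestData.symbols]
  split_ifs with h
  · have hd : ∀ B, (B * 3 ^ width i + t) / 3 ^ width i = B := fun B => by
      rw [add_comm, Nat.add_mul_div_right _ _ h3, Nat.div_eq_of_lt ht, zero_add]
    have hm : ∀ B, (B * 3 ^ width i + t) % 3 ^ width i = t := fun B => by
      rw [add_comm, Nat.add_mul_mod_self_right, Nat.mod_eq_of_lt ht]
    rw [parentSymbol, parentSymbol, hd, hd, hm, hm]
    show (Cell.serial _ _) = Cell.serial _ _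
    rw [D.nxt_eq h]
  · rfl

theorem HonestData.rowOK {i : ℕ} (hi : i ≤ J) (b : ℕ) :
    RowOK (width i) (D.symbols J i b) (D.cells J i b) := by
  rw [D.cells_eq hi]
  exact rowOK_honestLabels (fun B t ht => D.symbols_succ i B ht) b

theorem HonestData.top_iff {i : ℕ} (hi : i ≤ J) (b j : ℕ) :
    (D.cells J i b j).info.top = true ↔ 3 ^ width i ∣ b + 1 := by
  rw [D.cells_eq hi, ← rowTop_honestRows (a := coinAt D.coin i) (s := D.symbols J i)]
  exact @decide_eq_true_iff _ (Classical.propDecidable _)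

theorem HonestData.digit_eq {i : ℕ} (hi : i ≤ J) (b : ℕ) {j : ℕ} (hj : j < width i) :
    (D.cells J i b j).cur.digit = ((b / 3 ^ j % 3 : ℕ) : Fq) := by
  rw [D.cells_eq hi]
  exact (rowRun_honestRows i (b + 1)).digit_eq (Nat.lt_succ_self b) hj

theorem HonestData.slot_eq {i : ℕ} (hi : i ≤ J) (b j : ℕ) (k : Fin 4) :
    ((D.cells J i b j).slot k : ℕ) = D.tgt i b k / 3 ^ j % 3 := by
  rw [D.cells_eq hi]; rfl

theorem HonestData.dir_eq {i : ℕ} (hi : i ≤ J) (b j : ℕ) (k : Fin 4) :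
    (D.cells J i b j).info.dir k =
      compare (D.tgt i b k % 3 ^ width i) (b % 3 ^ width i) := by
  have h : (D.cells J i b j).info = (D.cells J i b 0).info := by rw [D.cells_eq hi]; rfl
  have hdig : ∀ j < width i, (D.cells J i b j).cur.digit.val = b / 3 ^ j % 3 := fun j hj => by
    rw [D.digit_eq hi b hj, val_natCast_of_lt_three (Nat.mod_lt _ (by norm_num))]
  rw [h, (D.rowOK hi b).dir_eq (width_pos i), cmpDigits_eq (fun j _ => Fin.is_lt _)
    (fun j hj => by rw [hdig j hj]; exact Nat.mod_lt _ (by norm_num)), ofDigits_congr hdig,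
    ofDigits_congr fun j _ => D.slot_eq hi b j k, ofDigits_div_mod, ofDigits_div_mod]

theorem HonestData.color_eq {i : ℕ} (hi : i ≤ J) (b j : ℕ) :
    (D.cells J i b j).info.color = D.col i b := by
  rw [D.cells_eq hi]; rfl

theorem HonestData.slotColor_eq {i : ℕ} (hi : i ≤ J) (b j : ℕ) (k : Fin 4) :
    (D.cells J i b j).info.slotColor k = D.col i (D.tgt i b k) := by
  rw [D.cells_eq hi]; rfl

theorem HonestData.first_eq {i : ℕ} (hi : i ≤ J) (b j : ℕ) :
    (D.cells J i b j).info.first = decide (b = 0) := by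
  rw [D.cells_eq hi]; rfl

theorem HonestData.fp_eq {i : ℕ} (hi : i ≤ J) (b j : ℕ) :
    (D.cells J i b j).info.fp =
      honestPrint i (coinAt D.coin i) (D.symbols J i) (b / 3 ^ width i) := by
  rw [D.cells_eq hi]; rfl

theorem HonestData.fresh {i : ℕ} (hi : i ≤ J) (j : ℕ) :
    (D.cells J i 0 j).cur.Fresh (j = 0) (coinAt D.coin i j) := by
  rw [D.cells_eq hi]
  exact honestRows_fresh

end HonestLevels

/-! ### The honest labels pass the tests along the path -/

section HonestPath

variable (D : HonestData) (J : ℕ)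

/-- The cell of level `i` that a node carries. -/
def cellIndex : ℕ → ℕ → ℕ
  | 0, _ => 0
  | i + 1, v => v / span i % 3 ^ width i / 27

/-- The label of the group `v` for the level `i`. -/
noncomputable def HonestData.label (v : ℕ) : ℕ → Label
  | 0 => ⟨fun j => D.cells J 0 v j, 0, false⟩
  | i + 1 => ⟨fun _ => D.cells J (i + 1) (v / span (i + 1)) (cellIndex (i + 1) v),
      Fin.ofNat 27 (v / span i % 3 ^ width i), false⟩

/-- The labels of the group `v` for all levels. -/
noncomputable def HonestData.tower (v i : ℕ) : Label := D.label J v (J - (J - i))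

variable {D J}

theorem HonestData.tower_eq {i : ℕ} (hi : i ≤ J) (v : ℕ) : D.tower J v i = D.label J v i := by
  rw [HonestData.tower, Nat.sub_sub_self hi]

theorem HonestData.levelCell_eq {i : ℕ} (hi : i ≤ J) (v : ℕ) :
    levelCell (D.tower J v) i = D.cells J i (v / span i) (cellIndex i v) := by
  rw [levelCell, D.tower_eq hi]
  rcases i with _ | i
  · rw [show span 0 = 1 from rfl, Nat.div_one]; rfl
  · rfl

theorem div_span_succ (v i : ℕ) : v / span i / 3 ^ width i = v / span (i + 1) := by
  rw [Nat.div_div_eq_div_mul, mul_comm, ← span_succ]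

theorem span_succ_dvd_iff {v i : ℕ} (h : span i ∣ v + 1) :
    span (i + 1) ∣ v + 1 ↔ 3 ^ width i ∣ v / span i + 1 := by
  rw [← Nat.succ_div_of_dvd h, Nat.dvd_div_iff_mul_dvd h, mul_comm, ← span_succ]

theorem HonestData.rowEnd_iff {i : ℕ} (hi : i ≤ J + 1) (v : ℕ) :
    RowEnd (D.tower J v) i ↔ span i ∣ v + 1 := by
  induction i with
  | zero => simp [RowEnd, span]
  | succ i ih =>
    have hsplit : RowEnd (D.tower J v) (i + 1) ↔
        RowEnd (D.tower J v) i ∧ (levelCell (D.tower J v) i).info.top = true :=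
      Nat.forall_lt_succ_right
    rw [hsplit, ih (by omega), D.levelCell_eq (by omega), D.top_iff (by omega)]
    constructor
    · rintro ⟨h1, h2⟩
      exact (span_succ_dvd_iff h1).2 h2
    · intro h
      have h1 := (span_dvd_succ i).trans h
      exact ⟨h1, (span_succ_dvd_iff h1).1 h⟩

theorem HonestData.levelSymbol_eq (i v : ℕ) :
    levelSymbol J (D.tower J v) i = D.symbols J i (v / span i) := by
  funext f
  rw [levelSymbol, HonestData.symbols]
  split_ifs with h
  · rw [D.tower_eq h, Label.symbol_eq, parentSymbol, div_span_succ]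
    rfl
  · rfl

theorem RowOK.congr {e : ℕ} {s : Fam → Fq} {lab lab' : ℕ → CellLabel} (he : 0 < e)
    (h : ∀ j < e, lab j = lab' j) (hr : RowOK e s lab) : RowOK e s lab' where
  first := h 0 he ▸ hr.first
  inRow j hj := by
    rw [← h j (by omega), ← h (j + 1) hj]
    exact hr.inRow j hj
  last := h (e - 1) (by omega) ▸ hr.last

theorem HonestData.nodeOK (v : ℕ) : NodeOK J (D.tower J v) := by
  refine ⟨?_, fun i hi he => ?_⟩
  · rw [D.levelSymbol_eq, D.tower_eq (Nat.zero_le J), show span 0 = 1 from rfl,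
      Nat.div_one]
    refine RowOK.congr (by norm_num) (fun j hj => ?_) (D.rowOK (Nat.zero_le J) v)
    show _ = D.cells J 0 v (j % 9)
    rw [Nat.mod_eq_of_lt hj]
  · rw [D.rowEnd_iff (by omega)] at he
    have h1 := (span_dvd_succ i).trans he
    have h2 := (span_succ_dvd_iff h1).1 he
    have h3 : 0 < 3 ^ width i := by positivity
    have hw := width_pos (i + 1)
    have hidx : cellIndex (i + 1) v = width (i + 1) - 1 := by
      have h4 : v / span i % 3 ^ width i = 3 ^ width i - 1 := by
        obtain ⟨m, hm⟩ := h2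
        have hmpos : 0 < m := Nat.pos_of_ne_zero (by rintro rfl; simp at hm)
        obtain ⟨m, rfl⟩ : ∃ m', m = m' + 1 := ⟨m - 1, by omega⟩
        have : v / span i = 3 ^ width i - 1 + 3 ^ width i * m := by
          rw [mul_add, mul_one] at hm; omega
        rw [this, Nat.add_mul_mod_self_left, Nat.mod_eq_of_lt (by omega)]
      rw [cellIndex, h4, three_pow_width]
      omega
    rw [D.levelSymbol_eq, D.levelCell_eq hi, hidx]
    exact (D.rowOK hi _).last

/-- The position in the parent row, one step later. -/
theorem succ_mod_of_not_dvd {b m : ℕ} (h : ¬ m ∣ b + 1) (hm : 0 < m) :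
    (b + 1) / m = b / m ∧ (b + 1) % m = b % m + 1 ∧ b % m + 1 < m := by
  have h1 := Nat.succ_div_of_not_dvd h
  have h2 := Nat.div_add_mod b m
  have h3 := Nat.div_add_mod (b + 1) m
  have h4 := Nat.mod_lt b hm
  have h5 := Nat.mod_lt (b + 1) hm
  rw [h1] at h3
  exact ⟨h1, by omega, by omega⟩

theorem HonestData.stepOK {v : ℕ} (hv : v + 1 < span (J + 1)) :
    StepOK J (D.tower J v) (D.tower J (v + 1)) (D.coin (v + 1)) := by
  have hdiv : ∀ {i}, span i ∣ v + 1 → (v + 1) / span i = v / span i + 1 := fun h =>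
    Nat.succ_div_of_dvd h
  have h3 : ∀ i, 0 < 3 ^ width i := fun i => by positivity
  refine ⟨fun j => ?_, ?_, fun i hi he hne => ?_, fun i hi he => ?_, fun i hi he hne hio => ?_,
    fun i hi he hne hio => ?_, fun i hi he => ?_⟩
  · rw [D.tower_eq (Nat.zero_le J), D.tower_eq (Nat.zero_le J)]
    exact (D.nxt_eq (Nat.zero_le J) v j).symm
  · rw [D.rowEnd_iff le_rfl]
    exact fun h => absurd (Nat.le_of_dvd (Nat.succ_pos v) h) (by omega)
  · rw [D.rowEnd_iff (by omega)] at hne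
    rw [D.levelCell_eq hi, D.levelCell_eq hi, D.fp_eq hi, D.fp_eq hi, div_span_succ, div_span_succ,
      Nat.succ_div_of_not_dvd hne]
  · rw [D.rowEnd_iff (by omega)] at he
    have hne : ¬ span (i + 1) ∣ v + 1 := fun h => he ((span_dvd_succ i).trans h)
    rw [D.tower_eq hi, D.tower_eq hi]
    simp only [HonestData.label, cellIndex]
    rw [Nat.succ_div_of_not_dvd hne, Nat.succ_div_of_not_dvd he]
  · rw [D.rowEnd_iff (by omega)] at he hne
    have hd := hdiv he
    obtain ⟨h4, h5, h6⟩ := succ_mod_of_not_dvd (fun h => hne ((span_succ_dvd_iff he).2 h)) (h3 i)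
    rw [D.levelCell_eq hi, D.levelCell_eq hi, D.tower_eq hi, D.tower_eq hi]
    rw [D.tower_eq hi] at hio
    have hio' : v / span i % 3 ^ width i % 27 < 26 := hio
    refine ⟨?_, ?_⟩
    · rw [Nat.succ_div_of_not_dvd hne, cellIndex, cellIndex, hd, h5]
      congr 1
      omega
    · show (v + 1) / span i % 3 ^ width i % 27 = v / span i % 3 ^ width i % 27 + 1
      rw [hd, h5]
      omega
  · rw [D.rowEnd_iff (by omega)] at he hne
    have hd := hdiv he
    obtain ⟨h4, h5, h6⟩ := succ_mod_of_not_dvd (fun h => hne ((span_succ_dvd_iff he).2 h)) (h3 i)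
    rw [D.tower_eq hi] at hio
    have hio' : ¬ v / span i % 3 ^ width i % 27 < 26 := hio
    have hidx : cellIndex (i + 1) (v + 1) = cellIndex (i + 1) v + 1 := by
      rw [cellIndex, cellIndex, hd, h5]
      omega
    have hlt : cellIndex (i + 1) v + 1 < width (i + 1) := by
      have := three_pow_width i
      rw [cellIndex]
      omega
    rw [D.levelCell_eq hi, D.levelCell_eq hi, D.tower_eq hi, D.levelSymbol_eq,
      Nat.succ_div_of_not_dvd hne, hidx]
    refine ⟨(D.rowOK hi _).inRow _ hlt, ?_, fun hf => ?_⟩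
    · refine Fin.ext ?_
      show (v + 1) / span i % 3 ^ width i % 27 = 0
      rw [hd, h5]
      omega
    · rw [D.first_eq hi, decide_eq_true_eq] at hf
      rw [hf]
      have hfresh := D.fresh hi (cellIndex (i + 1) v + 1)
      rw [coinAt] at hfresh
      have hv1 : (cellIndex (i + 1) v + 1) * (27 * span i) = v + 1 := by
        have h7 : v / span i % 3 ^ width i = v / span i := by
          have := Nat.div_add_mod (v / span i) (3 ^ width i)
          rw [div_span_succ, hf] at this
          omega
        have h8 : (v / span i + 1) * span i = v + 1 := by
          rw [← hd, Nat.div_mul_cancel he]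
        rw [← h8, ← mul_assoc, cellIndex, h7]
        rw [h7] at hio'
        congr 1
        omega
      rw [hv1] at hfresh
      simpa using hfresh
  · rw [D.rowEnd_iff (by omega)] at he
    have h1 := (span_dvd_succ i).trans he
    have hmod : (v + 1) / span i % 3 ^ width i = 0 := by
      rw [hdiv h1]
      exact Nat.mod_eq_zero_of_dvd ((span_succ_dvd_iff h1).1 he)
    have hidx : cellIndex (i + 1) (v + 1) = 0 := by rw [cellIndex, hmod]
    rw [D.levelCell_eq hi, D.levelSymbol_eq, hidx, D.tower_eq hi]
    refine ⟨(D.rowOK hi _).first, Fin.ext ?_⟩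
    show (v + 1) / span i % 3 ^ width i % 27 = 0
    rw [hmod]

theorem HonestData.initOK : InitOK J (D.tower J 0) (D.coin 0) := by
  have hidx : ∀ i, cellIndex i 0 = 0 := fun i => by cases i <;> simp [cellIndex]
  refine ⟨fun i hi => ?_, fun j => ?_, fun i hi => ?_⟩
  · rw [D.levelCell_eq hi, D.first_eq hi, Nat.zero_div]; rfl
  · have := D.fresh (Nat.zero_le J) j
    rw [D.tower_eq (Nat.zero_le J)]
    have e : (j : ℕ) = 0 ↔ j = 0 := by rw [Fin.ext_iff]; rfl
    rw [e] at this
    exact this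
  · have := D.fresh hi 0
    rw [D.levelCell_eq hi, D.levelSymbol_eq, hidx, Nat.zero_div, D.tower_eq hi]
    refine ⟨(D.rowOK hi _).first, ?_, ?_⟩
    · refine Fin.ext ?_
      show 0 / span i % 3 ^ width i % 27 = 0
      simp
    · simpa [coinAt] using this

theorem HonestData.pathOK {N : ℕ} (hpos : 0 < N) (hd : span J ∣ N) (hN : N ≤ span (J + 1)) :
    PathOK J N (D.tower J) D.coin where
  pos := hpos
  node v _ := D.nodeOK v
  step v hv := D.stepOK (by omega)
  init := D.initOK
  last := by
    rw [D.rowEnd_iff (by omega), Nat.sub_add_cancel hpos]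
    exact hd

end HonestPath

/-! ### The honest labels pass the tests of the other edges -/

section HonestEdges

variable {D : HonestData} {J : ℕ}

/-- A slot that holds the row of another group has the name of this row. -/
theorem HonestData.slotCode_eq {i : ℕ} (hi : i ≤ J) {u v : ℕ} {k : Fin 4}
    (h : D.tgt i (u / span i) k = v / span i) :
    slotCode (D.tower J u) k i = rowCode (D.tower J v) i := by
  refine Prod.ext ?_ ?_
  · rw [slotCode_fst, rowCode_fst, D.levelCell_eq hi, D.levelCell_eq hi, D.slotColor_eq hi,
      D.color_eq hi, h]
  · rw [slotCode_snd, rowCode_snd]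
    rcases i with _ | i
    · rw [show span 0 = 1 from rfl, Nat.div_one, Nat.div_one] at h
      funext j
      simp only [codeString, CellLabel.digitOf]
      rw [D.tower_eq hi, D.tower_eq hi]
      show (((D.cells J 0 u j).slot k : ℕ) : Fq) = (D.cells J 0 v j).cur.digit
      rw [D.slot_eq hi, D.digit_eq hi v j.2, h]
    · funext _
      simp only [codeString]
      rw [D.levelCell_eq (by omega), D.levelCell_eq (by omega), D.fp_eq (by omega),
        D.fp_eq (by omega), div_span_succ, div_span_succ]
      refine honestPrint_congr fun t ht => ?_
      have h3 : 0 < 3 ^ width i := by positivity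
      have hdm : ∀ B, (B * 3 ^ width i + t) / 3 ^ width i = B := fun B => by
        rw [add_comm, Nat.add_mul_div_right _ _ h3, Nat.div_eq_of_lt ht, zero_add]
      have hm : ∀ B, (B * 3 ^ width i + t) % 3 ^ width i = t := fun B => by
        rw [add_comm, Nat.add_mul_mod_self_right, Nat.mod_eq_of_lt ht]
      have ht27 : t / 27 < width (i + 1) := by
        rw [Nat.div_lt_iff_lt_mul (by norm_num), ← three_pow_width]
        exact ht
      rw [HonestData.symbols, HonestData.symbols, if_pos (Nat.lt_of_succ_le hi), if_pos (Nat.lt_of_succ_le hi),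
        parentSymbol, parentSymbol,
        hdm, hdm, hm, hm]
      show (((D.cells J (i + 1) (u / span (i + 1)) (t / 27)).slot k : ℕ) : Fq) =
        (D.cells J (i + 1) (v / span (i + 1)) (t / 27)).cur.digit
      rw [D.slot_eq hi, D.digit_eq hi _ ht27, h]

theorem HonestData.rowCode_congr {i : ℕ} (hi : i ≤ J) {u v : ℕ} (h : u / span i = v / span i) :
    rowCode (D.tower J u) i = rowCode (D.tower J v) i := by
  refine Prod.ext ?_ ?_
  · rw [rowCode_fst, rowCode_fst, D.levelCell_eq hi, D.levelCell_eq hi, D.color_eq hi,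
      D.color_eq hi, h]
  · rw [rowCode_snd, rowCode_snd]
    rcases i with _ | i
    · rw [show span 0 = 1 from rfl, Nat.div_one, Nat.div_one] at h
      rw [h]
    · funext _
      simp only [codeString]
      rw [D.levelCell_eq (by omega), D.levelCell_eq (by omega), D.fp_eq (by omega),
        D.fp_eq (by omega), div_span_succ, div_span_succ, h]

theorem mod_lt_mod_of_div_eq {a b m : ℕ} (h : a / m = b / m) (hlt : a < b) : a % m < b % m := by
  have h1 := Nat.div_add_mod a m
  have h2 := Nat.div_add_mod b m
  rw [h] at h1
  omega

/-- The honest labels pass the test of an edge between two groups, in the right direction. -/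
theorem HonestData.edgeOK {u v : ℕ} (huv : u < v) (hv : v < span (J + 1))
    (hcol : ∀ i ≤ J, u / span i ≠ v / span i → D.col i (u / span i) ≠ D.col i (v / span i) ∧
      ((∃ k, D.tgt i (u / span i) k = v / span i) ∨ ∃ k, D.tgt i (v / span i) k = u / span i))
    (r r' : Bool) : EdgeOK J (D.tower J u) (D.tower J v) r r' := by
  -- At level `J + 1` both groups lie in row `0`, so some level separates them within a common
  -- parent row.
  obtain ⟨i, hi, h1, h2⟩ := exists_level_ne huv.ne (M := J + 1) (by
    rw [Nat.div_eq_of_lt (by omega), Nat.div_eq_of_lt (by omega)])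
  have hi := Nat.lt_succ_iff.1 hi
  have hlt : u / span i % 3 ^ width i < v / span i % 3 ^ width i := by
    refine mod_lt_mod_of_div_eq (by rw [div_span_succ, div_span_succ, h2]) ?_
    exact lt_of_le_of_ne (Nat.div_le_div_right huv.le) h1
  obtain ⟨hc, ht⟩ := hcol i hi h1
  refine .inl ⟨i, hi, fun i' hi' hlt' => D.rowCode_congr hi' ?_, fun he => hc ?_, ?_⟩
  · obtain ⟨m, hm⟩ := span_dvd (show i + 1 ≤ i' from hlt')
    rw [hm, ← Nat.div_div_eq_div_mul, h2, Nat.div_div_eq_div_mul]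
  -- The colors tell the two rows apart whatever the coins are; fingerprints alone could collide by
  -- accident and spoil perfect completeness.
  · have := congrArg Prod.fst he
    rwa [rowCode_fst, rowCode_fst, D.levelCell_eq hi, D.levelCell_eq hi, D.color_eq hi,
      D.color_eq hi] at this
  · rcases ht with ⟨k, hk⟩ | ⟨k, hk⟩
    · refine .inl ⟨k, ?_, D.slotCode_eq hi hk⟩
      rw [D.levelCell_eq hi, D.dir_eq hi, hk]
      exact Nat.compare_eq_gt.2 hlt
    · refine .inr ⟨k, ?_, D.slotCode_eq hi hk⟩
      rw [D.levelCell_eq hi, D.dir_eq hi, hk]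
      exact Nat.compare_eq_lt.2 hlt

end HonestEdges

/-! ### Pairing nodes to adjust the number of groups -/

section Grouping

/-- The group of the node `p`, if the first `2 * d` nodes form pairs. -/
def pairIndex (d p : ℕ) : ℕ := if p < 2 * d then p / 2 else p - d

/-- The node `p` is the second one of a pair. -/
def pairRepeat (d p : ℕ) : Bool := decide (p < 2 * d ∧ p % 2 = 1)

/-- The first node of the group `g`. -/
def pairHead (d g : ℕ) : ℕ := if g < d then 2 * g else g + d

theorem pairRepeat_eq_true {d p : ℕ} : pairRepeat d p = true ↔ p < 2 * d ∧ p % 2 = 1 :=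
  decide_eq_true_iff

theorem pairRepeat_eq_false {d p : ℕ} : pairRepeat d p = false ↔ ¬ (p < 2 * d ∧ p % 2 = 1) :=
  decide_eq_false_iff_not

theorem pairIndex_mono (d : ℕ) : Monotone (pairIndex d) := by
  intro p q h
  rw [pairIndex, pairIndex]
  split_ifs <;> omega

theorem pairIndex_succ_of_repeat {d p : ℕ} (h : pairRepeat d (p + 1) = true) :
    pairRepeat d p = false ∧ pairIndex d (p + 1) = pairIndex d p := by
  rw [pairRepeat_eq_true] at h
  rw [pairRepeat_eq_false, pairIndex, pairIndex, if_pos h.1, if_pos (by omega)]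
  omega

theorem pairIndex_succ {d p : ℕ} (h : pairRepeat d (p + 1) = false) :
    pairIndex d (p + 1) = pairIndex d p + 1 := by
  rw [pairRepeat_eq_false] at h
  rw [pairIndex, pairIndex]
  split_ifs <;> omega

theorem pairHead_pairIndex {d p : ℕ} (h : pairRepeat d p = false) :
    pairHead d (pairIndex d p) = p := by
  rw [pairRepeat_eq_false] at h
  rw [pairHead, pairIndex]
  split_ifs <;> omega

theorem pairRepeat_of_pairIndex_eq {d p q : ℕ} (hpq : p < q) (h : pairIndex d p = pairIndex d q) :
    pairRepeat d p = false ∧ pairRepeat d q = true := by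
  rw [pairRepeat_eq_false, pairRepeat_eq_true]
  rw [pairIndex, pairIndex] at h
  split_ifs at h <;> omega

theorem pairIndex_lt {d N p : ℕ} (hd : d < N) (hp : p < N + d) : pairIndex d p < N := by
  rw [pairIndex]
  split_ifs <;> omega

theorem HonestData.runOK {D : HonestData} {J N d n : ℕ} {L : ℕ → ℕ → Label} {r : ℕ → Bool}
    {c : ℕ → ℕ → ℕ → Bool → Fq} {E : ℕ → ℕ → Prop} (hd : d < N) (hn : n = N + d)
    (hW : span J ∣ N) (hN : N ≤ span (J + 1))
    (hL : ∀ p < n, L p = D.tower J (pairIndex d p)) (hr : ∀ p < n, r p = pairRepeat d p)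
    (hc : ∀ g, D.coin g = c (pairHead d g)) (hE : ∀ p < n, ∀ q < n, E p q → p < q ∧
      ∀ i ≤ J, pairIndex d p / span i ≠ pairIndex d q / span i →
        D.col i (pairIndex d p / span i) ≠ D.col i (pairIndex d q / span i) ∧
        ((∃ k, D.tgt i (pairIndex d p / span i) k = pairIndex d q / span i) ∨
          ∃ k, D.tgt i (pairIndex d q / span i) k = pairIndex d p / span i)) :
    RunOK J n L r c E := by
  have hP := D.pathOK (J := J) (N := N) (by omega) hW hN
  have hlt : ∀ p < n, pairIndex d p < N := fun p hp => pairIndex_lt hd (by omega)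
  have h0 : pairIndex d 0 = 0 := by
    rw [pairIndex]; split_ifs <;> omega
  have hr0 : pairRepeat d 0 = false := pairRepeat_eq_false.2 (by omega)
  refine ⟨fun p hp => ?_, fun p hp => ?_, ⟨?_, ?_⟩, ?_, fun p hp q hq he => ?_⟩
  · rw [hL p hp]
    exact hP.node _ (hlt p hp)
  · rw [hL p (by omega), hL _ hp, hr p (by omega), hr _ hp, PathStep]
    split_ifs with h
    · obtain ⟨h1, h2⟩ := pairIndex_succ_of_repeat h
      exact ⟨h1, by rw [h2]⟩
    · rw [Bool.not_eq_true] at h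
      have h1 := pairIndex_succ h
      have h2 := hP.step (pairIndex d p) (by rw [← h1]; exact hlt _ hp)
      rw [← h1, hc, pairHead_pairIndex h] at h2
      exact h2
  · have := hP.init
    rw [hc, ← h0, pairHead_pairIndex hr0] at this
    rwa [hL 0 (by omega)]
  · rw [hr 0 (by omega), hr0]
  · have h1 : pairIndex d (n - 1) = N - 1 := by
      rw [pairIndex]; split_ifs <;> omega
    rw [hL _ (by omega), h1]
    exact hP.last
  · obtain ⟨hpq, h1⟩ := hE p hp q hq he
    rw [hL p hp, hL q hq, hr p hp, hr q hq]
    rcases (pairIndex_mono d hpq.le).lt_or_eq with h | h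
    · exact D.edgeOK h ((hlt q hq).trans_le hN) h1 _ _
    · obtain ⟨h2, h3⟩ := pairRepeat_of_pairIndex_eq hpq h
      exact .inr ⟨fun i _ => by rw [h], h2, h3⟩

end Grouping

/-! ### The honest prover -/

section HonestProver

theorem HonestData.downLabels_congr {tgt : ℕ → ℕ → Fin 4 → ℕ} {col : ℕ → ℕ → Fin 9}
    {c c' : ℕ → ℕ → ℕ → Bool → Fq} {J q : ℕ} (hq : q ≤ J)
    (h : ∀ i, J - q ≤ i → coinAt c i = coinAt c' i) :
    HonestData.downLabels ⟨tgt, col, c⟩ J q = HonestData.downLabels ⟨tgt, col, c'⟩ J q := by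
  induction q with
  | zero => simp only [HonestData.downLabels, h J (by omega)]
  | succ q ih =>
    simp only [HonestData.downLabels]
    rw [ih (by omega) fun i hi => h i (by omega), h _ le_rfl]

/-- Level `i` absorbs symbols of the levels above only, so its labels use no coins of lower levels,
which are drawn later. This makes the honest prover causal. -/
theorem HonestData.tower_congr {tgt : ℕ → ℕ → Fin 4 → ℕ} {col : ℕ → ℕ → Fin 9}
    {c c' : ℕ → ℕ → ℕ → Bool → Fq} {J i : ℕ} (hi : i ≤ J)
    (h : ∀ g, ∀ i' ≥ i, c g i' = c' g i') (v : ℕ) :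
    HonestData.tower ⟨tgt, col, c⟩ J v i = HonestData.tower ⟨tgt, col, c'⟩ J v i := by
  have hcells : HonestData.cells ⟨tgt, col, c⟩ J i = HonestData.cells ⟨tgt, col, c'⟩ J i := by
    refine HonestData.downLabels_congr (by omega) fun i' hi' => ?_
    funext j
    rw [coinAt_eq, coinAt_eq, h _ i' (by omega)]
  rw [HonestData.tower_eq hi, HonestData.tower_eq hi]
  cases i <;> simp only [HonestData.label, hcells]

variable {V : Type} {n J : ℕ}

/-- The data of the honest prover. -/
noncomputable def LRInstance.honestData (I : LRInstance V n) (hn : 0 < n)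
    (tgt : ℕ → ℕ → Fin 4 → ℕ) (col : ℕ → ℕ → Fin 9) (d : ℕ) (ω : (sortProtocol J).Coins V) :
    HonestData :=
  ⟨tgt, col, fun g => coinsOf fun i => ω i (I.nodeAt hn (pairHead d g))⟩

/-- The honest prover. -/
noncomputable def honestProver (I : LRInstance V n) (hn : 0 < n) (tgt : ℕ → ℕ → Fin 4 → ℕ)
    (col : ℕ → ℕ → Fin 9) (d : ℕ) : (sortProtocol J).Prover V where
  msg ρ ω v := labelCode (if (ρ : ℕ) = 0 then
      { Classical.arbitrary Label with stut := pairRepeat d (I.pos v) }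
    else (I.honestData hn tgt col d ω).tower J (pairIndex d (I.pos v)) (J + 1 - ρ))
  causal ρ ω ω' h := by
    funext v
    split_ifs with h0
    · rfl
    · rw [LRInstance.honestData, LRInstance.honestData, HonestData.tower_congr (by omega)]
      intro g i hi
      funext j a
      have h1 : ω (levelRound J i) = ω' (levelRound J i) := by
        refine h _ ?_
        show J - i + 1 ≤ (ρ : ℕ)
        omega
      simp only [coinsOf, h1]

theorem sortProtocol_complete [Fintype V] (I : LRInstance V n) (hn : 0 < n)
    (hplanar : IsPlanar I.graph) (hyes : I.IsYes) :
    ∃ P : (sortProtocol (topLevel n)).Prover V,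
      (∀ i ω v, (P.msg i ω v).length ≤ Nat.card Label) ∧
      ∀ ω, DIP.Accepts I.network P ω := by
  set J := topLevel n with hJ
  have hs := span_pos J
  have hWn := span_topLevel_le hn
  rw [← hJ] at hWn
  -- The number of groups is `n` rounded down to a multiple of the top row length. The remainder `d`
  -- is less than `span J ≤ N`, so it can be absorbed by making `d` of the groups pairs.
  set N := n / span J * span J with hN
  have hNn : N ≤ n := Nat.div_mul_le_self _ _
  have hnN : n < N + span J := by
    have := Nat.div_add_mod' n (span J)
    have := Nat.mod_lt n hs
    omega
  have hWN : span J ≤ N := Nat.le_mul_of_pos_left _ (Nat.div_pos hWn hs)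
  have hNS : N ≤ span (J + 1) := hNn.trans (lt_span_topLevel_succ n).le
  set d := n - N with hd
  -- The rows of each level are intervals of the path, and every level gets its own slots and
  -- colors.
  have horient := fun i => I.graph.exists_block_orientation (pos := I.pos)
    (fun u v h => I.graph_adj.2 (.inl (I.path_adj u v h))) hplanar
    (f := fun p => pairIndex d p / span i)
    fun p q h => Nat.div_le_div_right (pairIndex_mono d h)
  choose tgt col hcol using horient
  refine ⟨honestProver I hn tgt col d, fun i ω v => exists_labelCode.choose_spec.2 _, fun ω => ?_⟩
  rw [accepts_iff I hn]
  refine HonestData.runOK (D := I.honestData hn tgt col d ω) (N := N) (d := d) (by omega) (by omega)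
    (dvd_mul_left _ _) hNS (fun p hp => ?_) (fun p hp => ?_) (fun g => rfl) fun p hp q hq he => ?_
  -- Indices above `J` are harmless: `levelRound` and `tower` both treat them as `J`.
  · funext i
    refine (congrArg (fun l => labelOf (labelCode l)) (if_neg (Nat.succ_ne_zero (J - i)))).trans ?_
    rw [labelOf_labelCode, I.pos_nodeAt hn hp]
    simp only [HonestData.tower, levelRound]
    congr 1
    omega
  · refine (congrArg (fun l => (labelOf (labelCode l)).stut) (if_pos rfl)).trans ?_
    rw [labelOf_labelCode, I.pos_nodeAt hn hp]
  · have hlt : p < q := by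
      have := hyes _ _ he.1 (by
        rw [LRInstance.PathEdge, I.pos_nodeAt hn hp, I.pos_nodeAt hn hq]; exact he.2)
      rw [Fin.lt_def, I.pos_nodeAt hn hp, I.pos_nodeAt hn hq] at this
      exact this
    refine ⟨hlt, fun i _ hne => ?_⟩
    have := hcol i _ _ (I.graph_adj.2 (.inl he.1))
    rw [I.pos_nodeAt hn hp, I.pos_nodeAt hn hq] at this
    exact this he.2 (by omega) hne

end HonestProver

theorem mainTheorem5 :
    ∃ (C : ℕ) (𝒟 : ℕ → DIP EdgeMark), ∀ n : ℕ,
      (𝒟 n).rounds ≤ C * max 1 (logStar n) ∧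
      ∀ (V : Type) [Fintype V] (I : LRInstance V n), IsPlanar I.graph →
        (I.IsYes → ∃ P : (𝒟 n).Prover V,
          DIP.MessagesAtMost P C ∧ DIP.acceptProb I.network P = 1) ∧
        (¬ I.IsYes → ∀ P : (𝒟 n).Prover V, DIP.acceptProb I.network P ≤ 1 / 8) := by
  -- The constant bounds the unary code of a label and the 126 coins of a verifier round, and it
  -- exceeds the `5` that is needed for the `2 * J + 3` rounds.
  refine ⟨Nat.card Label + 126, fun n => sortProtocol (topLevel n), fun n => ⟨?_, ?_⟩⟩
  · rw [sortProtocol_rounds]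
    have h1 : topLevel n ≤ max 1 (logStar n) := (topLevel_le_logStar n).trans (le_max_right _ _)
    have h2 : 1 ≤ max 1 (logStar n) := le_max_left _ _
    have h3 : 5 * max 1 (logStar n) ≤ (Nat.card Label + 126) * max 1 (logStar n) :=
      Nat.mul_le_mul_right _ (by omega)
    omega
  · intro V _ I hplanar
    refine ⟨fun hyes => ?_, fun hno P => sortProtocol_sound I hno P⟩
    obtain ⟨P, hlen, hacc⟩ : ∃ P : (sortProtocol (topLevel n)).Prover V,
        (∀ i ω v, (P.msg i ω v).length ≤ Nat.card Label) ∧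
        ∀ ω, DIP.Accepts I.network P ω := by
      -- Without nodes every prover is accepted.
      rcases Nat.eq_zero_or_pos n with rfl | hn
      · exact ⟨⟨fun _ _ _ => [], fun _ _ _ _ => rfl⟩, fun _ _ _ => Nat.zero_le _,
          fun ω v => (I.pos v).elim0⟩
      · exact sortProtocol_complete I hn hplanar hyes
    refine ⟨P, fun i => ⟨?_, fun ω v => (hlen i ω v).trans (Nat.le_add_right _ _)⟩, ?_⟩
    · show (if (i : ℕ) = 0 then 0 else 126) ≤ _
      split_ifs <;> omega
    · rw [DIP.acceptProb, Nat.card_congr (Equiv.subtypeUnivEquiv hacc)]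
      exact div_self (Nat.cast_ne_zero.2 Nat.card_pos.ne')
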